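/- Theorem (phonon spectrum and eigenstates of the harmonic crystal). Setting. Let $a_1,a_2,a_3$ be a basis of $\mathbb R^3$ generating a Bravais lattice, let $N,L\ge 1$, let $B$ be the Bravais lattice modulo the periods $La_1,La_2,La_3$ ($L^3$ unit cells), and let $BZ$ be the set of the $L^3$ lattice momenta $q=\frac1L\sum_j m_jb_j$ ($m_j\in\mathbb Z$, $\langle b_j,a_k\rangle=2\pi\delta_{jk}$) modulo reciprocal lattice vectors; put $v_q(R)=L^{-3/2}e^{i\langle q,R\rangle}$. Let $I=\{1,\dots,N\}\times\{x,y,z\}$, let $\mu_\alpha=\mu_{(r,j)}=\mu_r>0$ be the masses, and let $u=(u^\alpha(R))_{R\in B,\alpha\in I}$ be the real displacements. Let $K_{\alpha\beta}(R,S)$ be a real force matrix and $V(u)=\frac12\sum u^\alpha(R)K_{\alpha\beta}(R,S)u^\beta(S)$. Assume that $K$ is symmetric, $K_{\alpha\beta}(R,S)=K_{\beta\alpha}(S,R)$; that it is invariant under lattice translations, so that $K_{\alpha\beta}(R,S)=K_{\alpha\beta}(R-S)$ with $K_{\alpha\beta}(R):=K_{\alpha\beta}(R,0)$; that $V\ge0$;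 that $V$ is invariant under uniform shifts $u^{(r,j)}(R)\mapsto u^{(r,j)}(R)+\varepsilon^j$; and that the crystal is stable, i.e. $V(u)=0$ only if $u$ is a uniform shift. Let $$H=-\tfrac12\sum_{R,\alpha}\tfrac1{\mu_\alpha}\partial_{u^\alpha(R)}^2+V(u),\qquad H_{\rm ph}=H-T_{\rm cm},\qquad T_{\rm cm}=-\frac{1}{2L^3\sum_r\mu_r}\sum_{j}\Bigl(\sum_{R,r}\partial_{u^{(r,j)}(R)}\Bigr)^2,$$ where $T_{\rm cm}$ is the kinetic energy of the centre of mass. Claim. The matrices $\tilde\kappa_{\alpha\beta}(q)=\sum_{R\in B}e^{-i\langle q,R\rangle}K_{\alpha\beta}(R)/\sqrt{\mu_\alpha\mu_\beta}$ are Hermitian and positive semidefinite with $\tilde\kappa(-q)=\tilde\kappa(q)^*$ (complex conjugate). There are $\omega_\alpha(q)\ge0$ and orthonormal vectors $y_\alpha(q)$, $\alpha\in I$, with $\tilde\kappa(q)y_\alpha(q)=\omega_\alpha(q)^2y_\alpha(q)$ and $y_\alpha(-q)=y_\alpha(q)^*$. For every such choice the following holds. 1. The matrix $Y(q)$ with columns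 $y_\alpha(q)$ is unitary, $\tilde\kappa(q)=Y(q)\,\mathrm{diag}(\omega_\alpha(q)^2)\,Y(q)^+$, and $\omega_\alpha(-q)=\omega_\alpha(q)$. There are precisely three pairs $(q,\alpha)$ with $\omega_\alpha(q)=0$, all with $q=0$. Put $Q=\{(q,\alpha)\in BZ\times I:\omega_\alpha(q)\neq0\}$. 2. Let $x_q^\alpha=\sum_{R,\beta}v_q(R)^*\sqrt{\mu_\beta}\,y_\alpha^\beta(q)^*u^\beta(R)$ and $\partial_{x_q^\alpha}=\sum_{R,\beta}v_q(R)\mu_\beta^{-1/2}y^\beta_\alpha(q)\,\partial_{u^\beta(R)}$. Then $[\partial_{x_q^\alpha},x_k^\beta]=\delta_{qk}\delta_{\alpha\beta}$, $T_{\rm cm}=-\frac12\sum_{\alpha:\omega_\alpha(0)=0}\partial_{x_0^\alpha}^2$ and $H_{\rm ph}=\frac12\sum_{(q,\alpha)\in Q}\{-\partial_{x_{-q}^\alpha}\partial_{x_q^\alpha}+\omega_\alpha(q)^2x_{-q}^\alpha x_q^\alpha\}$. 3. For $(q,\alpha)\in Q$ let $a_q^\alpha=\sqrt{\omega_\alpha(q)/2}\,x_q^\alpha+(2\omega_\alpha(q))^{-1/2}\partial_{x_{-q}^\alpha}$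 and ${a^+}_q^\alpha=\sqrt{\omega_\alpha(q)/2}\,x_{-q}^\alpha-(2\omega_\alpha(q))^{-1/2}\partial_{x_q^\alpha}$. Then $[a_q^\alpha,a_k^\beta]=[{a^+}_q^\alpha,{a^+}_k^\beta]=0$, $[a_q^\alpha,{a^+}_k^\beta]=\delta_{qk}\delta_{\alpha\beta}$, and $$H_{\rm ph}=\sum_{(q,\alpha)\in Q}\omega_\alpha(q)\bigl({a^+}_q^\alpha a_q^\alpha+\tfrac12\bigr).$$ (The operator identities in 2 and 3 hold on all smooth functions of $u$.) 4. Let $\mathcal H$ be the $L^2$-space of the displacements with centre of mass at the origin ($\sum_{R,r}\mu_ru^{(r,j)}(R)=0$ for all $j$), and let $\mathcal D$ be the space of smooth functions of $u$ that are invariant under uniform shifts and are Schwartz functions on that subspace. The operators $H_{\rm ph}$, $a_q^\alpha$, ${a^+}_q^\alpha$ map $\mathcal D$ to itself, and $a_q^\alpha$, ${a^+}_q^\alpha$ are mutually adjoint on $\mathcal D\subset\mathcal H$. The ground state is $$\Psi_0(u)=\exp\Bigl\{-\tfrac12\sum_{(q,\alpha)\in Q}\omega_\alpha(q)\,x_{-q}^\alpha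 x_q^\alpha\Bigr\}=\exp\bigl\{-\tfrac12\,u^tM^{1/2}\bigl(M^{-1/2}KM^{-1/2}\bigr)^{1/2}M^{1/2}u\bigr\},$$ where $M$ is the diagonal matrix of the masses; it satisfies $a_q^\alpha\Psi_0=0$ for all $(q,\alpha)\in Q$. 5. For $n:Q\to\mathbb N_0$ the states $\Psi_n=\prod_{(q,\alpha)\in Q}({a^+}_q^\alpha)^{n_q^\alpha}\Psi_0\in\mathcal D$ satisfy $$H_{\rm ph}\Psi_n=E_n\Psi_n,\qquad E_n=\sum_{(q,\alpha)\in Q}\omega_\alpha(q)\bigl(n_q^\alpha+\tfrac12\bigr).$$ They are non-zero, pairwise orthogonal and span a dense subspace of $\mathcal H$. The closure of $H_{\rm ph}$, defined on $\mathcal D$, is a self-adjoint operator on $\mathcal H$ with spectrum exactly $\{E_n\}$. Moreover $E_0<E_n$ for $n\ne0$, and $\Psi_0$ is, up to a factor, the only eigenvector with eigenvalue $E_0$. In particular, given the lattice and the masses, the dispersion relations $\omega_\alpha(q)$ and polarization vectors $y_\alpha(q)$ determine the spectrum and all eigenstates. -/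

import Mathlib

open scoped ContDiff ComplexConjugate ComplexOrder

noncomputable section

namespace Phonon

/-! ### Bravais lattice with periodic boundary conditions, reciprocal lattice -/

/-- Physical space `ℝ³`. -/
abbrev Space : Type := EuclideanSpace ℝ (Fin 3)

/-- The unit cells of the Bravais lattice `B` modulo periods `L a₁, L a₂, L a₃`. -/
abbrev Cell (L : ℕ) : Type := Fin 3 → ZMod L

/-- The lattice momenta compatible with the periodic boundary conditions, modulo reciprocal lattice
vectors.  Every class has exactly one representative in the Brillouin zone; negation in this group
is `q ↦ -q` in the Brillouin zone. -/
abbrev Momentum (L : ℕ) : Type := Fin 3 → ZMod L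

/-- The index set `I = {1, …, N} × {x, y, z}`: ion in the unit cell and Cartesian direction. -/
abbrev Branch (N : ℕ) : Type := Fin N × Fin 3

/-- Labels of the displacement coordinates `u^α(R)`. -/
abbrev Site (N L : ℕ) : Type := Cell L × Branch N

/-- Primitive vectors of the Bravais lattice and the (dimensionless) masses of the `N` ions in the
unit cell. -/
structure Crystal (N : ℕ) where
  primitive : Module.Basis (Fin 3) ℝ Space
  mass : Fin N → ℝ
  mass_pos : ∀ r, 0 < mass r

variable {N L : ℕ}

/-- The mass `μ_α`, `α = (r, j)`. -/
def Crystal.mu (C : Crystal N) (α : Branch N) : ℝ := C.mass α.1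

/-- The primitive reciprocal vectors `b_j`, with `⟨b_j, a_k⟩ = 2π δ_{jk}`. -/
def Crystal.reciprocal (C : Crystal N) (j : Fin 3) : Space :=
  (2 * Real.pi) •
    (InnerProductSpace.toDual ℝ Space).symm (LinearMap.toContinuousLinearMap (C.primitive.coord j))

theorem Crystal.inner_reciprocal (C : Crystal N) (j k : Fin 3) :
    inner ℝ (C.reciprocal j) (C.primitive k) = if j = k then 2 * Real.pi else 0 := by
  rw [Crystal.reciprocal, real_inner_smul_left, InnerProductSpace.toDual_symm_apply]
  by_cases h : j = k
  · simp [h]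
  · simp [h]

/-- The Bravais lattice vector `R = ∑ n_j a_j` of a cell. -/
def Crystal.latticeVector (C : Crystal N) (R : Cell L) : Space :=
  ∑ j, ((R j).val : ℝ) • C.primitive j

/-- The lattice momentum `q = ∑ (m_j / L) b_j`, with `m_j` an integer of absolute value at most
`L / 2`. -/
def Crystal.momentumVector (C : Crystal N) (q : Momentum L) : Space :=
  ∑ j, (((q j).valMinAbs : ℝ) / (L : ℝ)) • C.reciprocal j

/-- The phase `e^{i⟨q, R⟩}`. -/
def Crystal.phase (C : Crystal N) (q : Momentum L) (R : Cell L) : ℂ :=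
  Complex.exp (Complex.I * ((inner ℝ (C.momentumVector q) (C.latticeVector R) : ℝ) : ℂ))

/-- The Fourier mode `v_q(R) = L^{-3/2} e^{i⟨q, R⟩}`. -/
def Crystal.fourierMode (C : Crystal N) (q : Momentum L) (R : Cell L) : ℂ :=
  C.phase q R / (Real.sqrt ((L : ℝ) ^ 3) : ℂ)

/-! ### Displacements and force matrix -/

/-- The space of displacements `u = (u^α(R))`. -/
abbrev Displ (N L : ℕ) : Type := EuclideanSpace ℝ (Site N L)

/-- The displacement that shifts all ions by the same vector `ε`. -/
def uniformShift (N L : ℕ) (ε : Space) : Displ N L := WithLp.toLp 2 fun s => ε s.2.2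

/-- The harmonic potential energy `V(u) = ½ ∑ u^α(R) K_{αβ}(R, S) u^β(S)`. -/
def potential [NeZero L] (K : Matrix (Site N L) (Site N L) ℝ) (u : Displ N L) : ℝ :=
  (1 / 2) * ∑ s, ∑ t, u s * K s t * u t

/-- The properties of the force matrix of a stable harmonic crystal. -/
structure IsStableForceMatrix [NeZero L] (K : Matrix (Site N L) (Site N L) ℝ) : Prop where
  /-- `K_{αβ}(R, S) = K_{βα}(S, R)`. -/
  symm : ∀ s t, K s t = K t s
  /-- Invariance under Bravais lattice translations. -/
  translation : ∀ (a R S : Cell L) (α β : Branch N), K (R + a, α) (S + a, β) = K (R, α) (S, β)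
  /-- `u = 0` is a global minimum of the potential energy. -/
  nonneg : ∀ u, 0 ≤ potential K u
  /-- Moving the whole crystal costs no energy. -/
  shift_invariant : ∀ u ε, potential K (u + uniformShift N L ε) = potential K u
  /-- The crystal does not disintegrate: there is no zero mode besides the centre-of-mass motion. -/
  stable : ∀ u, potential K u = 0 → ∃ ε, u = uniformShift N L ε

/-- The mass-weighted dynamical matrix
`κ̃_{αβ}(q) = ∑_R e^{-i⟨q, R⟩} K_{αβ}(R) / √(μ_α μ_β)`, where `K_{αβ}(R) = K_{αβ}(R, 0)`. -/
def dynamicalMatrix [NeZero L] (C : Crystal N) (K : Matrix (Site N L) (Site N L) ℝ)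
    (q : Momentum L) : Matrix (Branch N) (Branch N) ℂ :=
  Matrix.of fun α β =>
    ∑ R : Cell L, conj (C.phase q R) * (K (R, α) (0, β) : ℂ) /
      (Real.sqrt (C.mu α * C.mu β) : ℂ)

/-! ### Dispersion relations and polarization vectors -/

/-- Candidate dispersion relations `ω_α(q)` and polarization vectors `y_α(q)`. -/
structure ModeData (N L : ℕ) where
  freq : Momentum L → Branch N → ℝ
  pol : Momentum L → Branch N → EuclideanSpace ℂ (Branch N)

/-- The `y_α(q)` are orthonormal eigenvectors of `κ̃(q)` with eigenvalues `ω_α(q)²`, `ω_α(q) ≥ 0`,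
indexed so that `y_α(-q) = y_α(q)^*`. -/
structure IsNormalModes [NeZero L] (C : Crystal N) (K : Matrix (Site N L) (Site N L) ℝ)
    (S : ModeData N L) : Prop where
  freq_nonneg : ∀ q α, 0 ≤ S.freq q α
  orthonormal : ∀ q, Orthonormal ℂ (S.pol q)
  eigen : ∀ q α, (dynamicalMatrix C K q).mulVec (S.pol q α) =
    fun β => ((S.freq q α : ℂ) ^ 2) * S.pol q α β
  pol_neg : ∀ q α β, S.pol (-q) α β = conj (S.pol q α β)

/-- The matrix `Y(q)` with columns `y_α(q)`. -/
def ModeData.polMatrix (S : ModeData N L) (q : Momentum L) : Matrix (Branch N) (Branch N) ℂ :=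
  Matrix.of fun β α => S.pol q α β

/-- The set `Q = {(q, α) | ω_α(q) ≠ 0}` of phonon modes. -/
abbrev ModeData.Mode (S : ModeData N L) : Type :=
  {p : Momentum L × Branch N // S.freq p.1 p.2 ≠ 0}

/-- The energy `E_n = ∑_Q ω_α(q) (n_q^α + ½)`. -/
def ModeData.energy [NeZero L] (S : ModeData N L) (n : S.Mode → ℕ) : ℝ :=
  ∑ p : S.Mode, S.freq p.1.1 p.1.2 * ((n p : ℝ) + 1 / 2)

/-! ### Smooth wave functions and operators on them -/

/-- Smooth wave functions `Ψ(u)`. -/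
def Wave (N L : ℕ) [NeZero L] : Subalgebra ℂ (Displ N L → ℂ) where
  carrier := {Ψ | ContDiff ℝ ∞ Ψ}
  mul_mem' {f g} (ha : ContDiff ℝ ∞ f) (hb : ContDiff ℝ ∞ g) := ha.mul hb
  add_mem' {f g} (ha : ContDiff ℝ ∞ f) (hb : ContDiff ℝ ∞ g) := ha.add hb
  algebraMap_mem' c := (contDiff_const : ContDiff ℝ ∞ fun _ : Displ N L => c)

section Operators

variable [NeZero L]

/-- Multiplication by a smooth function. -/
def mulOp (f : Wave N L) : Module.End ℂ (Wave N L) := LinearMap.mulLeft ℂ f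

/-- The partial derivative `∂/∂u^α(R)`. -/
def partialOp (s : Site N L) : Module.End ℂ (Wave N L) where
  toFun Ψ := ⟨fun u => fderiv ℝ Ψ.1 u (EuclideanSpace.single s 1), by
    have h : ContDiff ℝ ∞ Ψ.1 := Ψ.2
    exact (h.fderiv_right (m := ∞) (by simp)).clm_apply contDiff_const⟩
  map_add' Ψ Φ := by
    have h : ContDiff ℝ ∞ Ψ.1 := Ψ.2
    have h' : ContDiff ℝ ∞ Φ.1 := Φ.2
    ext u
    have := fderiv_add (h.differentiable (by simp) u) (h'.differentiable (by simp) u)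
    exact congrArg (fun l => l (EuclideanSpace.single s 1)) this
  map_smul' c Ψ := by
    have h : ContDiff ℝ ∞ Ψ.1 := Ψ.2
    ext u
    have := fderiv_const_smul (h.differentiable (by simp) u) c
    exact congrArg (fun l => l (EuclideanSpace.single s 1)) this

/-- The potential energy as a smooth function. -/
def potentialWave (K : Matrix (Site N L) (Site N L) ℝ) : Wave N L :=
  ⟨fun u => (potential K u : ℂ), by
    have h : ContDiff ℝ ∞ (potential K) := by
      unfold potential
      fun_prop
    exact Complex.ofRealCLM.contDiff.comp h⟩

/-- The Hamiltonian of the lattice vibrations,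
`H = -½ ∑ (1/μ_α) ∂²/∂u^α(R)² + V(u)`. -/
def hamiltonian (C : Crystal N) (K : Matrix (Site N L) (Site N L) ℝ) : Module.End ℂ (Wave N L) :=
  (-(1 / 2) : ℂ) • (∑ s : Site N L, ((1 / C.mu s.2 : ℝ) : ℂ) • partialOp s ^ 2) +
    mulOp (potentialWave K)

/-- The kinetic energy of the centre-of-mass motion, `P² / (2 M)` with total momentum
`P_j = -i ∑_{R, r} ∂/∂u^{(r,j)}(R)` and total mass `M = L³ ∑_r μ_r`. -/
def centerOfMassKinetic (C : Crystal N) : Module.End ℂ (Wave N L) :=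
  ((-(1 / (2 * ((L : ℝ) ^ 3 * ∑ r, C.mass r))) : ℝ) : ℂ) •
    ∑ j : Fin 3, (∑ R : Cell L, ∑ r : Fin N, partialOp (R, (r, j))) ^ 2

/-- The phonon Hamiltonian `H_ph = H - T_cm`. -/
def phononHamiltonian (C : Crystal N) (K : Matrix (Site N L) (Site N L) ℝ) :
    Module.End ℂ (Wave N L) :=
  hamiltonian C K - centerOfMassKinetic C

/-- The Fourier coordinates `ξ_q^α = ∑_R u^α(R) v_q(R)^*`, so that
`u^α(R) = ∑_q ξ_q^α v_q(R)`. -/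
def fourierCoord (C : Crystal N) (q : Momentum L) (α : Branch N) (u : Displ N L) : ℂ :=
  ∑ R : Cell L, (u (R, α) : ℂ) * conj (C.fourierMode q R)

/-- The normal coordinates `x_q^α = ⟨y_α(q), η_q⟩`, where `η_q^β = √μ_β ξ_q^β`. -/
def normalCoord (C : Crystal N) (S : ModeData N L) (q : Momentum L) (α : Branch N)
    (u : Displ N L) : ℂ :=
  ∑ β, conj (S.pol q α β) * ((Real.sqrt (C.mu β) : ℂ) * fourierCoord C q β u)

theorem contDiff_normalCoord (C : Crystal N) (S : ModeData N L) (q : Momentum L) (α : Branch N) :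
    ContDiff ℝ ∞ (normalCoord C S q α) := by
  have h : ∀ s : Site N L, ContDiff ℝ ∞ fun u : Displ N L => ((u s : ℝ) : ℂ) := fun s =>
    Complex.ofRealCLM.contDiff.comp (by fun_prop : ContDiff ℝ ∞ fun u : Displ N L => u s)
  unfold normalCoord fourierCoord
  refine ContDiff.sum fun β _ => contDiff_const.mul (contDiff_const.mul ?_)
  exact ContDiff.sum fun R _ => (h (R, β)).mul contDiff_const

/-- Multiplication by `x_q^α`. -/
def xOp (C : Crystal N) (S : ModeData N L) (q : Momentum L) (α : Branch N) :
    Module.End ℂ (Wave N L) :=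
  mulOp ⟨normalCoord C S q α, contDiff_normalCoord C S q α⟩

/-- The derivative with respect to the complex coordinate `x_q^α`, by the chain rule
`∂/∂x_q^α = ∑_{R, β} (∂u^β(R)/∂x_q^α) ∂/∂u^β(R)`,
`u^β(R) = ∑_{q, α} v_q(R) y_α^β(q) x_q^α / √μ_β`. -/
def dxOp (C : Crystal N) (S : ModeData N L) (q : Momentum L) (α : Branch N) :
    Module.End ℂ (Wave N L) :=
  ∑ R : Cell L, ∑ β : Branch N,
    (C.fourierMode q R * S.pol q α β / (Real.sqrt (C.mu β) : ℂ)) • partialOp (R, β)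

/-- The annihilation operator
`a_q^α = √(ω_α(q)/2) x_q^α + (2 ω_α(q))^{-1/2} ∂/∂x_{-q}^α`. -/
def annihilation (C : Crystal N) (S : ModeData N L) (p : S.Mode) : Module.End ℂ (Wave N L) :=
  (Real.sqrt (S.freq p.1.1 p.1.2 / 2) : ℂ) • xOp C S p.1.1 p.1.2 +
    ((1 / Real.sqrt (2 * S.freq p.1.1 p.1.2) : ℝ) : ℂ) • dxOp C S (-p.1.1) p.1.2

/-- The creation operator
`a⁺_q^α = √(ω_α(q)/2) x_{-q}^α - (2 ω_α(q))^{-1/2} ∂/∂x_q^α`. -/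
def creation (C : Crystal N) (S : ModeData N L) (p : S.Mode) : Module.End ℂ (Wave N L) :=
  (Real.sqrt (S.freq p.1.1 p.1.2 / 2) : ℂ) • xOp C S (-p.1.1) p.1.2 -
    ((1 / Real.sqrt (2 * S.freq p.1.1 p.1.2) : ℝ) : ℂ) • dxOp C S p.1.1 p.1.2

/-- The phonon vacuum `Ψ₀(u) = exp(-½ ∑_Q ω_α(q) x_{-q}^α x_q^α)`. -/
def groundState (C : Crystal N) (S : ModeData N L) : Wave N L :=
  ⟨fun u => Complex.exp (-(1 / 2) * ∑ p : S.Mode, (S.freq p.1.1 p.1.2 : ℂ) *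
      (normalCoord C S (-p.1.1) p.1.2 u * normalCoord C S p.1.1 p.1.2 u)), by
    have h : ∀ p : S.Mode, ContDiff ℝ ∞ fun u : Displ N L => (S.freq p.1.1 p.1.2 : ℂ) *
        (normalCoord C S (-p.1.1) p.1.2 u * normalCoord C S p.1.1 p.1.2 u) := fun p =>
      contDiff_const.mul ((contDiff_normalCoord C S _ _).mul (contDiff_normalCoord C S _ _))
    exact ContDiff.cexp (contDiff_const.mul (ContDiff.sum fun p _ => h p))⟩

/-- The states `Ψ_n = ∏_Q (a⁺_q^α)^{n_q^α} Ψ₀`.  The factors commute, so the order in which the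
modes are listed does not matter. -/
def phononState (C : Crystal N) (S : ModeData N L) (n : S.Mode → ℕ) : Wave N L :=
  ((Finset.univ : Finset S.Mode).toList.map fun p => creation C S p ^ n p).prod (groundState C S)

/-! ### The Hilbert space of the relative motion -/

/-- Displacements with centre of mass at rest at the origin:
`∑_{R, r} μ_r u^{(r,j)}(R) = 0` for `j = x, y, z`. -/
def relDispl (C : Crystal N) (L : ℕ) [NeZero L] : Submodule ℝ (Displ N L) where
  carrier := {u | ∀ j : Fin 3, ∑ R : Cell L, ∑ r : Fin N, C.mass r * u (R, (r, j)) = 0}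
  add_mem' {u v} hu hv j := by
    simp only [PiLp.add_apply, mul_add, Finset.sum_add_distrib, hu j, hv j, add_zero]
  zero_mem' j := by simp
  smul_mem' c u hu j := by
    have : ∀ R : Cell L, ∀ r : Fin N,
        C.mass r * (c • u) (R, (r, j)) = c * (C.mass r * u (R, (r, j))) := by
      intro R r
      simp only [PiLp.smul_apply, smul_eq_mul]
      ring
    simp only [this, ← Finset.mul_sum, hu j, mul_zero]

/-- The Hilbert space of the relative motion of the ions: square integrable functions of the
displacements with centre of mass at the origin. -/
abbrev RelL2 (C : Crystal N) (L : ℕ) [NeZero L] : Type :=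
  MeasureTheory.Lp ℂ 2 (MeasureTheory.volume : MeasureTheory.Measure (relDispl C L))

/-- Wave functions that do not depend on the centre-of-mass coordinates and are Schwartz functions
of the relative coordinates. -/
def vibStates (C : Crystal N) (L : ℕ) [NeZero L] : Submodule ℂ (Wave N L) where
  carrier := {Ψ | (∀ u ε, Ψ.1 (u + uniformShift N L ε) = Ψ.1 u) ∧
    ∃ f : SchwartzMap (relDispl C L) ℂ, ∀ w, f w = Ψ.1 (w : Displ N L)}
  add_mem' := by
    rintro Ψ Φ ⟨h, f, hf⟩ ⟨h', g, hg⟩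
    exact ⟨fun u ε => congrArg₂ (· + ·) (h u ε) (h' u ε), f + g,
      fun w => congrArg₂ (· + ·) (hf w) (hg w)⟩
  zero_mem' := ⟨fun _ _ => rfl, 0, fun _ => rfl⟩
  smul_mem' := by
    rintro c Ψ ⟨h, f, hf⟩
    exact ⟨fun u ε => congrArg (c * ·) (h u ε), c • f, fun w => congrArg (c * ·) (hf w)⟩

theorem memLp_vibStates (C : Crystal N) (Ψ : vibStates C L) :
    MeasureTheory.MemLp (fun w : relDispl C L => Ψ.1.1 (w : Displ N L)) 2
      MeasureTheory.volume := by
  obtain ⟨f, hf⟩ := Ψ.2.2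
  have h := f.memLp 2 MeasureTheory.volume
  rwa [show (f : relDispl C L → ℂ) = fun w : relDispl C L => Ψ.1.1 (w : Displ N L) from
    funext hf] at h

/-- A vibrational wave function as an element of the Hilbert space. -/
def toRelL2 (C : Crystal N) (L : ℕ) [NeZero L] : vibStates C L →ₗ[ℂ] RelL2 C L where
  toFun Ψ := (memLp_vibStates C Ψ).toLp _
  map_add' _ _ := rfl
  map_smul' _ _ := rfl

/-- The graph of `H_ph` on vibrational wave functions. -/
def phononGraph (C : Crystal N) (K : Matrix (Site N L) (Site N L) ℝ) :
    Submodule ℂ (RelL2 C L × RelL2 C L) where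
  carrier := {x | ∃ Ψ Φ : vibStates C L, Φ.1 = phononHamiltonian C K Ψ.1 ∧
    x = (toRelL2 C L Ψ, toRelL2 C L Φ)}
  add_mem' := by
    rintro _ _ ⟨Ψ, Φ, h, rfl⟩ ⟨Ψ', Φ', h', rfl⟩
    exact ⟨Ψ + Ψ', Φ + Φ', by simp [h, h'], by simp⟩
  zero_mem' := ⟨0, 0, by simp, by simp; rfl⟩
  smul_mem' := by
    rintro c _ ⟨Ψ, Φ, h, rfl⟩
    exact ⟨c • Ψ, c • Φ, by simp [h], by simp⟩

/-- `H_ph` as a densely defined operator, with domain the vibrational wave functions. -/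
def phononOperator (C : Crystal N) (K : Matrix (Site N L) (Site N L) ℝ) :
    RelL2 C L →ₗ.[ℂ] RelL2 C L :=
  (phononGraph C K).toLinearPMap

end Operators

/-- The spectrum of an unbounded operator: the complement of the set of all `z` for which `A - z`
has an everywhere defined bounded inverse. -/
def unboundedSpectrum {E : Type*} [NormedAddCommGroup E] [NormedSpace ℂ E] (A : E →ₗ.[ℂ] E) :
    Set ℂ :=
  {z | ¬ ∃ T : E →L[ℂ] E,
    (∀ f : E, ∃ h : T f ∈ A.domain, A ⟨T f, h⟩ - z • T f = f) ∧
    ∀ f : A.domain, T (A f - z • (f : E)) = f}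

end Phonon

end

noncomputable section

namespace Phonon

variable {N L : ℕ}

/-! ### Characters of the cell group -/

/-! The mass-weighted force matrix $A=M^{-1/2}KM^{-1/2}$ is real, symmetric, non-negative and
commutes with lattice translations. Plane waves $v_q\otimes y$ therefore reduce it to the blocks
$\tilde\kappa(q)$ (`sum_massWeighted_mul`), and the vectors $e_{q\alpha}=v_q\otimes y_\alpha(q)$
form an orthonormal eigenbasis of $A$ with eigenvalues $\omega_\alpha(q)^2$ (`sum_modeVec`,
`sum_modeVec'`, `massWeighted_eq`). Stability identifies the kernel of $A$ with the vectors
$\sqrt{\mu_r}\,c_j$. These are independent of the cell, so they have $q=0$; the projection onto them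
is the explicit matrix `comProj`, whose trace is 3 and whose quadratic form in the derivatives is
the centre-of-mass kinetic energy (`sum_zero_modes`).

In the coordinates $x_q^\alpha$ the kinetic and potential energies are diagonal, and subtracting
$T_{\rm cm}$ removes exactly the zero modes (`phononHamiltonian_eq`). Factorizing one mode into
$a^+a$ leaves first-order cross terms which cancel between $q$ and $-q$ (`normal_ordering`,
`phononHamiltonian_eq_sum`). The canonical commutation relations and $a\Psi_0=0$ then give
eigenstates and eigenvalues by pure algebra (`annihilate_listWord`, `number_listWord`).

The analytic part has three ingredients. On the relative displacements $\Psi_0$ is a non-degenerate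
Gaussian, hence Schwartz (`groundState_mem`), and integration by parts makes $a$ and $a^+$ mutually
adjoint (`integral_conj_mul_annihilation`). The span of the $\Psi_n$ contains every power of every
linear functional times $\Psi_0$; a vector orthogonal to all of these gives a function with
vanishing Fourier transform, so it is zero (`ae_eq_zero_of_gaussian_moments`,
`topologicalClosure_span_vibState`). Finally, a symmetric operator whose domain contains an
orthonormal basis of eigenvectors has as closure the maximal diagonal operator, which is
self-adjoint (`topologicalClosure_graph`, `isSelfAdjoint_closure`). Its spectrum is the set of
eigenvalues because only finitely many energies lie below any bound (`finite_energy_le`,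
`unboundedSpectrum_closure`). -/

theorem sqrt_card_mul_self :
    (Real.sqrt ((L : ℝ) ^ 3) : ℂ) * Real.sqrt ((L : ℝ) ^ 3) = (L : ℂ) ^ 3 := by
  rw [← Complex.ofReal_mul, Real.mul_self_sqrt (by positivity)]
  push_cast; rfl

section Lattice

variable [NeZero L]

/-- Since $\langle b_j,a_k\rangle=2\pi\delta_{jk}$, the exponent is $2\pi i\sum_j m_jn_j/L$, which
only matters modulo $L$. The chosen integer representatives thus drop out, and every later
computation with phases takes place in `ZMod L`. -/
theorem Crystal.phase_eq_stdAddChar (C : Crystal N) (q : Momentum L) (R : Cell L) :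
    C.phase q R = ZMod.stdAddChar (∑ j, q j * R j) := by
  have h1 : (∑ j, q j * R j : ZMod L) =
      ((∑ j, (q j).valMinAbs * ((R j).val : ℤ) : ℤ) : ZMod L) := by
    push_cast
    simp
  have h2 : inner ℝ (C.momentumVector q) (C.latticeVector R) =
      ∑ j, ((q j).valMinAbs : ℝ) / L * ((R j).val : ℝ) * (2 * Real.pi) := by
    simp only [momentumVector, latticeVector, sum_inner, inner_sum, real_inner_smul_left,
      real_inner_smul_right, inner_reciprocal]
    refine Finset.sum_congr rfl fun i _ => ?_
    rw [Finset.sum_eq_single i]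
    · simp; ring
    · intro j _ hj; simp [hj]
    · simp
  rw [h1, ZMod.stdAddChar_coe, phase, h2]
  congr 1
  push_cast
  rw [Finset.mul_sum, Finset.mul_sum, Finset.sum_div]
  refine Finset.sum_congr rfl fun i _ => ?_
  ring

theorem Crystal.conj_phase (C : Crystal N) (q : Momentum L) (R : Cell L) :
    conj (C.phase q R) = C.phase (-q) R := by
  rw [phase_eq_stdAddChar, phase_eq_stdAddChar]
  have h : (∑ j, (-q) j * R j : ZMod L) = -∑ j, q j * R j := by simp
  rw [h, ZMod.stdAddChar_apply, ZMod.stdAddChar_apply, AddChar.map_neg_eq_inv,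
    ← Circle.coe_inv_eq_conj]

theorem Crystal.phase_add_right (C : Crystal N) (q : Momentum L) (R S : Cell L) :
    C.phase q (R + S) = C.phase q R * C.phase q S := by
  simp only [phase_eq_stdAddChar, Pi.add_apply, mul_add, Finset.sum_add_distrib,
    AddChar.map_add_eq_mul]

theorem Crystal.phase_add_left (C : Crystal N) (q k : Momentum L) (R : Cell L) :
    C.phase (q + k) R = C.phase q R * C.phase k R := by
  simp only [phase_eq_stdAddChar, Pi.add_apply, add_mul, Finset.sum_add_distrib,
    AddChar.map_add_eq_mul]

theorem Crystal.phase_zero_right (C : Crystal N) (q : Momentum L) : C.phase q (0 : Cell L) = 1 := by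
  simp [phase_eq_stdAddChar]

theorem Crystal.phase_zero_left (C : Crystal N) (R : Cell L) : C.phase (0 : Momentum L) R = 1 := by
  simp [phase_eq_stdAddChar]

theorem Crystal.phase_mul_conj (C : Crystal N) (q : Momentum L) (R : Cell L) :
    C.phase q R * conj (C.phase q R) = 1 := by
  rw [conj_phase, ← phase_add_left, add_neg_cancel, phase_zero_left]

theorem Crystal.eq_zero_of_phase_eq_one (C : Crystal N) (q : Momentum L)
    (h : ∀ R : Cell L, C.phase q R = 1) : q = 0 := by
  funext j
  have hj := h (Pi.single j 1)
  rw [phase_eq_stdAddChar] at hj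
  have h1 : (∑ i, q i * (Pi.single j 1 : Cell L) i : ZMod L) = q j := by
    rw [Finset.sum_eq_single j]
    · simp
    · intro i _ hi; simp [hi]
    · simp
  rw [h1, ← AddChar.map_zero_eq_one (ZMod.stdAddChar (N := L))] at hj
  exact ZMod.injective_stdAddChar hj

/-- Translating the summation variable by $S$ multiplies the sum by the phase at $S$; for $q\ne0$
some $S$ has phase different from 1. -/
theorem Crystal.sum_phase (C : Crystal N) (q : Momentum L) :
    ∑ R : Cell L, C.phase q R = if q = 0 then (L : ℂ) ^ 3 else 0 := by
  split_ifs with hq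
  · simp [hq, phase_zero_left, ZMod.card]
  · have : ∃ S : Cell L, C.phase q S ≠ 1 := by
      by_contra! h
      exact hq (C.eq_zero_of_phase_eq_one q h)
    obtain ⟨S, hS⟩ := this
    have h1 : ∑ R : Cell L, C.phase q (R + S) = ∑ R : Cell L, C.phase q R :=
      Fintype.sum_equiv (Equiv.addRight S) _ _ fun _ => rfl
    simp only [phase_add_right, ← Finset.sum_mul] at h1
    have h2 : (∑ R : Cell L, C.phase q R) * (C.phase q S - 1) = 0 := by
      rw [mul_sub, h1]; ring
    exact (mul_eq_zero.1 h2).resolve_right (sub_ne_zero.2 hS)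

theorem Crystal.conj_fourierMode (C : Crystal N) (q : Momentum L) (R : Cell L) :
    conj (C.fourierMode q R) = C.fourierMode (-q) R := by
  simp [fourierMode, conj_phase]

theorem Crystal.sum_fourierMode (C : Crystal N) (q k : Momentum L) :
    ∑ R : Cell L, conj (C.fourierMode q R) * C.fourierMode k R = if q = k then 1 else 0 := by
  have h : ∀ R : Cell L, conj (C.fourierMode q R) * C.fourierMode k R =
      C.phase (k - q) R / (L : ℂ) ^ 3 := by
    intro R
    rw [conj_fourierMode, fourierMode, fourierMode, sub_eq_add_neg, phase_add_left,
      ← sqrt_card_mul_self]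
    ring
  simp only [h, ← Finset.sum_div, sum_phase, sub_eq_zero, eq_comm (a := k)]
  split_ifs
  · exact div_self (pow_ne_zero _ (Nat.cast_ne_zero.2 (NeZero.ne L)))
  · simp

end Lattice

/-! ### The force matrix -/

theorem Crystal.mu_pos (C : Crystal N) (α : Branch N) : 0 < C.mu α := C.mass_pos _

theorem Crystal.sqrt_mu_ne_zero (C : Crystal N) (α : Branch N) : (Real.sqrt (C.mu α) : ℂ) ≠ 0 :=
  Complex.ofReal_ne_zero.2 (Real.sqrt_pos.2 (C.mu_pos α)).ne'

theorem Crystal.sqrt_mu_mul_self (C : Crystal N) (α : Branch N) :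
    (Real.sqrt (C.mu α) : ℂ) * Real.sqrt (C.mu α) = C.mu α := by
  rw [← Complex.ofReal_mul, Real.mul_self_sqrt (C.mu_pos α).le]

theorem sum_site [NeZero L] {M : Type*} [AddCommMonoid M] (f : Site N L → M) :
    ∑ s, f s = ∑ R : Cell L, ∑ α : Branch N, f (R, α) :=
  Fintype.sum_prod_type f

/-- The mass-weighted force matrix `M^{-1/2} K M^{-1/2}`. -/
def massWeighted (C : Crystal N) (K : Matrix (Site N L) (Site N L) ℝ) (s t : Site N L) : ℝ :=
  K s t / Real.sqrt (C.mu s.2 * C.mu t.2)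

theorem ofReal_massWeighted (C : Crystal N) (K : Matrix (Site N L) (Site N L) ℝ) (s t : Site N L) :
    (massWeighted C K s t : ℂ) =
      (K s t : ℂ) / (Real.sqrt (C.mu s.2) * Real.sqrt (C.mu t.2)) := by
  rw [massWeighted, Real.sqrt_mul (C.mu_pos _).le]
  push_cast; rfl

section Force

variable [NeZero L] {C : Crystal N} {K : Matrix (Site N L) (Site N L) ℝ}

theorem massWeighted_symm (hK : IsStableForceMatrix K) (s t : Site N L) :
    massWeighted C K s t = massWeighted C K t s := by
  rw [massWeighted, massWeighted, hK.symm, mul_comm]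

/-- The mass-weighted force matrix maps `v_q ⊗ y` to `v_q ⊗ κ̃(q) y`. -/
theorem sum_massWeighted_mul (hK : IsStableForceMatrix K) (q : Momentum L) (y : Branch N → ℂ)
    (R : Cell L) (α : Branch N) :
    ∑ t : Site N L, (massWeighted C K (R, α) t : ℂ) * (C.fourierMode q t.1 * y t.2) =
      C.fourierMode q R * (dynamicalMatrix C K q).mulVec y α := by
  rw [sum_site, Finset.sum_comm]
  simp only [Matrix.mulVec, dotProduct, dynamicalMatrix, Matrix.of_apply,
    Finset.mul_sum, Finset.sum_mul]
  refine Finset.sum_congr rfl fun β _ => ?_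
  -- The sum over $S$ is rewritten as a sum over $R-S$, the only quantity on which the force matrix
  -- depends.
  refine Fintype.sum_equiv (Equiv.subLeft R) _ _ fun S => ?_
  have h1 : K (R, α) (S, β) = K (R - S, α) (0, β) := by
    have := hK.translation S (R - S) 0 α β
    simpa using this
  have h2 : C.phase q S = C.phase q R * conj (C.phase q (R - S)) := by
    have : C.phase q R = C.phase q (R - S) * C.phase q S := by
      rw [← Crystal.phase_add_right, sub_add_cancel]
    rw [this, mul_right_comm, Crystal.phase_mul_conj, one_mul]
  rw [massWeighted, h1, Crystal.fourierMode, Crystal.fourierMode, h2]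
  simp only [Equiv.subLeft_apply]
  push_cast
  ring

theorem quadForm_nonneg (hK : IsStableForceMatrix K) (u : Site N L → ℝ) :
    0 ≤ ∑ s, ∑ t, u s * K s t * u t := by
  have := hK.nonneg (WithLp.toLp 2 u)
  simpa [potential] using this

/-- The cross terms between real and imaginary parts cancel by symmetry. This carries non-negativity
and stability, which are assumed for real displacements, over to complex vectors such as plane
waves. -/
theorem sum_conj_mul_mul (A : Site N L → Site N L → ℝ) (hA : ∀ s t, A s t = A t s)
    (z : Site N L → ℂ) :
    ∑ s, ∑ t, conj (z s) * (A s t : ℂ) * z t =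
      ((∑ s, ∑ t, (z s).re * A s t * (z t).re + ∑ s, ∑ t, (z s).im * A s t * (z t).im : ℝ) : ℂ) := by
  have h : ∑ s, ∑ t, (z s).re * A s t * (z t).im = ∑ s, ∑ t, (z s).im * A s t * (z t).re := by
    rw [Finset.sum_comm]
    refine Finset.sum_congr rfl fun s _ => Finset.sum_congr rfl fun t _ => ?_
    rw [hA t s]; ring
  apply Complex.ext
  · simp only [Complex.re_sum, Complex.ofReal_re, ← Finset.sum_add_distrib]
    refine Finset.sum_congr rfl fun s _ => Finset.sum_congr rfl fun t _ => ?_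
    simp
  · rw [Complex.ofReal_im]
    have : (∑ s, ∑ t, conj (z s) * (A s t : ℂ) * z t).im =
        ∑ s, ∑ t, ((z s).re * A s t * (z t).im - (z s).im * A s t * (z t).re) := by
      simp only [Complex.im_sum]
      refine Finset.sum_congr rfl fun s _ => Finset.sum_congr rfl fun t _ => ?_
      simp; ring
    rw [this]
    simp only [Finset.sum_sub_distrib, h, sub_self]

theorem sum_massWeighted_eq (K : Matrix (Site N L) (Site N L) ℝ) (z : Site N L → ℂ) :
    ∑ s, ∑ t, conj (z s) * (massWeighted C K s t : ℂ) * z t =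
      ∑ s, ∑ t, conj (z s / Real.sqrt (C.mu s.2)) * (K s t : ℂ) * (z t / Real.sqrt (C.mu t.2)) := by
  refine Finset.sum_congr rfl fun s _ => Finset.sum_congr rfl fun t _ => ?_
  rw [ofReal_massWeighted]
  simp
  ring

theorem massWeighted_nonneg (hK : IsStableForceMatrix K) (z : Site N L → ℂ) :
    0 ≤ ∑ s, ∑ t, conj (z s) * (massWeighted C K s t : ℂ) * z t := by
  rw [sum_massWeighted_eq, sum_conj_mul_mul _ hK.symm]
  exact Complex.zero_le_real.2 (add_nonneg (quadForm_nonneg hK _) (quadForm_nonneg hK _))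

theorem dynamicalMatrix_neg (q : Momentum L) :
    dynamicalMatrix C K (-q) = (dynamicalMatrix C K q).map conj := by
  ext α β
  simp [dynamicalMatrix, Crystal.conj_phase]

theorem dynamicalMatrix_isHermitian (hK : IsStableForceMatrix K) (q : Momentum L) :
    (dynamicalMatrix C K q).IsHermitian := by
  ext α β
  simp only [dynamicalMatrix, Matrix.conjTranspose_apply, Matrix.of_apply, star_sum]
  -- Reversing $R$ matches the two sums: symmetry followed by translation gives
  -- $K_{\beta\alpha}(R)=K_{\alpha\beta}(-R)$.
  refine Fintype.sum_equiv (Equiv.neg _) _ _ fun R => ?_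
  have h1 : K (R, β) (0, α) = K (-R, α) (0, β) := by
    rw [hK.symm]
    have := hK.translation R (-R) 0 α β
    simpa using this
  have h2 : C.phase q R = conj (C.phase q (-R)) := by
    have := C.phase_mul_conj q (-R)
    have h := C.phase_add_right q R (-R)
    rw [add_neg_cancel, Crystal.phase_zero_right] at h
    calc C.phase q R = C.phase q R * (C.phase q (-R) * conj (C.phase q (-R))) := by
          rw [this, mul_one]
      _ = (C.phase q R * C.phase q (-R)) * conj (C.phase q (-R)) := by ring
      _ = _ := by rw [← h, one_mul]
  simp [h1, ← h2, mul_comm (C.mu α)]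

/-- Evaluated on $v_q\otimes y$, the non-negative form of the mass-weighted force matrix is $\langle
y,\tilde\kappa(q)y\rangle$, because $v_q$ is normalized. -/
theorem dynamicalMatrix_posSemidef (hK : IsStableForceMatrix K) (q : Momentum L) :
    (dynamicalMatrix C K q).PosSemidef := by
  refine Matrix.PosSemidef.of_dotProduct_mulVec_nonneg (dynamicalMatrix_isHermitian hK q)
    fun y => ?_
  have h := massWeighted_nonneg (C := C) hK fun t : Site N L => C.fourierMode q t.1 * y t.2
  have h1 : ∀ s : Site N L, ∑ t : Site N L, conj (C.fourierMode q s.1 * y s.2) *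
      (massWeighted C K s t : ℂ) * (C.fourierMode q t.1 * y t.2) =
      (conj (C.fourierMode q s.1) * C.fourierMode q s.1) *
        (conj (y s.2) * (dynamicalMatrix C K q).mulVec y s.2) := by
    rintro ⟨R, α⟩
    simp only [mul_assoc, ← Finset.mul_sum]
    have := sum_massWeighted_mul (C := C) hK q y R α
    rw [this, map_mul]
    ring
  simp only [h1, sum_site, ← Finset.mul_sum, ← Finset.sum_mul, C.sum_fourierMode,
    if_true, one_mul] at h
  exact h

end Force

end Phonon

namespace Phonon

variable {N L : ℕ} [NeZero L] {C : Crystal N} {K : Matrix (Site N L) (Site N L) ℝ}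
  {S : ModeData N L}

/-! ### Uniform shifts -/

theorem potential_add (hK : IsStableForceMatrix K) (u v : Displ N L) :
    potential K (u + v) = potential K u + potential K v + ∑ s, u s * ∑ t, K s t * v t := by
  have h : ∑ s, ∑ t, v s * K s t * u t = ∑ s, ∑ t, u s * K s t * v t := by
    rw [Finset.sum_comm]
    refine Finset.sum_congr rfl fun s _ => Finset.sum_congr rfl fun t _ => ?_
    rw [hK.symm t s]; ring
  have h2 : ∑ s, ∑ t, (u + v) s * K s t * (u + v) t = ∑ s, ∑ t, u s * K s t * u t +
      ∑ s, ∑ t, v s * K s t * v t + ∑ s, ∑ t, v s * K s t * u t +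
      ∑ s, ∑ t, u s * K s t * v t := by
    simp only [← Finset.sum_add_distrib, PiLp.add_apply]
    refine Finset.sum_congr rfl fun s _ => Finset.sum_congr rfl fun t _ => ?_
    ring
  have h3 : ∑ s, u s * ∑ t, K s t * v t = ∑ s, ∑ t, u s * K s t * v t := by
    simp only [Finset.mul_sum, mul_assoc]
  rw [potential, potential, potential, h2, h, h3]
  ring

/-- A uniform shift has zero energy, so shift invariance kills the cross term in the expansion of
$V(u+\varepsilon)$. Taking for $u$ a unit vector isolates one component of the force. -/
theorem sum_force_shift (hK : IsStableForceMatrix K) (ε : Space) (s : Site N L) :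
    ∑ t, K s t * ε t.2.2 = 0 := by
  have h0 : potential K (uniformShift N L ε) = 0 := by
    have := hK.shift_invariant 0 ε
    rw [zero_add] at this
    rw [this]
    simp [potential]
  have h := potential_add hK (EuclideanSpace.single s 1) (uniformShift N L ε)
  rw [hK.shift_invariant, h0, add_zero, left_eq_add, Finset.sum_eq_single s] at h
  · simpa [uniformShift] using h
  · intro t _ ht; simp [ht]
  · simp

theorem sum_massWeighted_shift (hK : IsStableForceMatrix K) (c : Fin 3 → ℂ) (s : Site N L) :
    ∑ t, (massWeighted C K s t : ℂ) * (Real.sqrt (C.mu t.2) * c t.2.2) = 0 := by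
  have h1 : ∀ t, (massWeighted C K s t : ℂ) * (Real.sqrt (C.mu t.2) * c t.2.2) =
      (K s t * c t.2.2) / Real.sqrt (C.mu s.2) := by
    intro t
    have := C.sqrt_mu_ne_zero t.2
    rw [ofReal_massWeighted]
    field_simp
  have hre := sum_force_shift hK (WithLp.toLp 2 fun j => (c j).re) s
  have him := sum_force_shift hK (WithLp.toLp 2 fun j => (c j).im) s
  have h2 : ∑ t, (K s t : ℂ) * c t.2.2 = 0 := by
    apply Complex.ext
    · simpa using hre
    · simpa using him
  simp only [h1, ← Finset.sum_div, h2, zero_div]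

/-- The complex form is the sum of the non-negative energies of the real and imaginary parts, so
both vanish and stability applies to each separately. -/
theorem exists_eq_shift (hK : IsStableForceMatrix K) (z : Site N L → ℂ)
    (hz : ∑ s, ∑ t, conj (z s) * (massWeighted C K s t : ℂ) * z t = 0) :
    ∃ c : Fin 3 → ℂ, ∀ s, z s = Real.sqrt (C.mu s.2) * c s.2.2 := by
  rw [sum_massWeighted_eq, sum_conj_mul_mul _ hK.symm, Complex.ofReal_eq_zero,
    add_eq_zero_iff_of_nonneg (quadForm_nonneg hK _) (quadForm_nonneg hK _)] at hz
  obtain ⟨ε, hε⟩ := hK.stable (WithLp.toLp 2 fun s => (z s / Real.sqrt (C.mu s.2)).re)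
    (by simp only [potential]; rw [hz.1, mul_zero])
  obtain ⟨δ, hδ⟩ := hK.stable (WithLp.toLp 2 fun s => (z s / Real.sqrt (C.mu s.2)).im)
    (by simp only [potential]; rw [hz.2, mul_zero])
  refine ⟨fun j => ⟨ε j, δ j⟩, fun s => ?_⟩
  have h1 : (z s / Real.sqrt (C.mu s.2)).re = ε s.2.2 := congrArg (fun u : Displ N L => u s) hε
  have h2 : (z s / Real.sqrt (C.mu s.2)).im = δ s.2.2 := congrArg (fun u : Displ N L => u s) hδ
  change z s = _ * (⟨ε s.2.2, δ s.2.2⟩ : ℂ)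
  rw [← h1, ← h2, Complex.eta, mul_div_cancel₀ _ (C.sqrt_mu_ne_zero _)]

/-! ### The orthonormal basis of normal modes -/

/-- The normal mode `e_{qα}^β(R) = v_q(R) y_α^β(q)`. -/
def modeVec (C : Crystal N) (S : ModeData N L) (p : Momentum L × Branch N) (s : Site N L) : ℂ :=
  C.fourierMode p.1 s.1 * S.pol p.1 p.2 s.2

/-- The map `(q, α) ↦ (-q, α)`. -/
def negMode (p : Momentum L × Branch N) : Momentum L × Branch N := (-p.1, p.2)

@[simp] theorem negMode_negMode {N L : ℕ} (p : Momentum L × Branch N) :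
    negMode (negMode p) = p := by
  simp [negMode]

theorem negMode_involutive {N L : ℕ} :
    Function.Involutive (negMode : Momentum L × Branch N → _) :=
  negMode_negMode

/-- `ω_α(q)` as a function of the pair `(q, α)`. -/
def ModeData.omega (S : ModeData N L) (p : Momentum L × Branch N) : ℝ := S.freq p.1 p.2

namespace IsNormalModes

theorem sum_pol (hS : IsNormalModes C K S) (q : Momentum L) (α α' : Branch N) :
    ∑ β, conj (S.pol q α β) * S.pol q α' β = if α = α' then 1 else 0 := by
  have := orthonormal_iff_ite.1 (hS.orthonormal q) α α'
  rw [← this, PiLp.inner_apply]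
  simp [mul_comm]

theorem modeVec_neg (hS : IsNormalModes C K S) (p : Momentum L × Branch N) (s : Site N L) :
    modeVec C S (negMode p) s = conj (modeVec C S p s) := by
  simp [modeVec, negMode, hS.pol_neg, Crystal.conj_fourierMode]

theorem sum_modeVec (hS : IsNormalModes C K S) (p p' : Momentum L × Branch N) :
    ∑ s, conj (modeVec C S p s) * modeVec C S p' s = if p = p' then 1 else 0 := by
  obtain ⟨q, α⟩ := p
  obtain ⟨k, α'⟩ := p'
  have h : ∀ (R : Cell L) (β : Branch N),
      conj (modeVec C S (q, α) (R, β)) * modeVec C S (k, α') (R, β) =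
      (conj (C.fourierMode q R) * C.fourierMode k R) * (conj (S.pol q α β) * S.pol k α' β) := by
    intro R β
    simp only [modeVec, map_mul]
    ring
  simp only [sum_site, h, ← Finset.mul_sum, ← Finset.sum_mul, C.sum_fourierMode, Prod.mk.injEq]
  by_cases hqk : q = k
  · subst hqk
    simp [hS.sum_pol]
  · simp [hqk]

theorem sum_modeVec' (hS : IsNormalModes C K S) (s t : Site N L) :
    ∑ p, conj (modeVec C S p s) * modeVec C S p t = if s = t then 1 else 0 := by
  -- Modes and sites are indexed by the same finite type, so orthonormality of the rows says that a
  -- square matrix has a right inverse. This is also a left inverse, which is completeness.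
  let U : Matrix (Site N L) (Site N L) ℂ := Matrix.of fun p s => modeVec C S p s
  have h1 : U * U.conjTranspose = 1 := by
    ext p p'
    have := hS.sum_modeVec p' p
    simp only [Matrix.mul_apply, U, Matrix.of_apply, Matrix.conjTranspose_apply, Matrix.one_apply,
      RCLike.star_def, eq_comm (a := p), ← this]
    exact Finset.sum_congr rfl fun _ _ => mul_comm _ _
  have h2 := congrArg (fun A : Matrix (Site N L) (Site N L) ℂ => A s t) (mul_eq_one_comm.1 h1)
  simpa [Matrix.mul_apply, U, Matrix.one_apply] using h2

theorem sum_massWeighted_modeVec (hS : IsNormalModes C K S) (hK : IsStableForceMatrix K)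
    (p : Momentum L × Branch N) (s : Site N L) :
    ∑ t, (massWeighted C K s t : ℂ) * modeVec C S p t = (S.omega p : ℂ) ^ 2 * modeVec C S p s := by
  obtain ⟨R, α⟩ := s
  have := sum_massWeighted_mul (C := C) hK p.1 (S.pol p.1 p.2) R α
  simp only [modeVec]
  rw [this, hS.eigen, ModeData.omega]
  ring

/-- Spectral decomposition, obtained by inserting the resolution of the identity `sum_modeVec'` and
applying the eigenvalue equation. -/
theorem massWeighted_eq (hS : IsNormalModes C K S) (hK : IsStableForceMatrix K) (s t : Site N L) :
    (massWeighted C K s t : ℂ) =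
      ∑ p, (S.omega p : ℂ) ^ 2 * (modeVec C S p s * conj (modeVec C S p t)) := by
  calc (massWeighted C K s t : ℂ)
      = ∑ t', (massWeighted C K s t' : ℂ) *
          ∑ p, conj (modeVec C S p t) * modeVec C S p t' := by
        simp [hS.sum_modeVec']
    _ = ∑ p, (∑ t', (massWeighted C K s t' : ℂ) * modeVec C S p t') * conj (modeVec C S p t) := by
        simp only [Finset.mul_sum, Finset.sum_mul]
        rw [Finset.sum_comm]
        refine Finset.sum_congr rfl fun s _ => Finset.sum_congr rfl fun t _ => ?_
        ring
    _ = _ := by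
        simp only [hS.sum_massWeighted_modeVec hK, mul_assoc]

/-- Conjugating the eigenvalue equation at $q$ gives one at $-q$ for the same vector $y_\alpha(-q)$;
hence the squares agree, and non-negativity fixes the sign. -/
theorem freq_neg (hS : IsNormalModes C K S) (q : Momentum L) (α : Branch N) :
    S.freq (-q) α = S.freq q α := by
  have hne : S.pol q α ≠ 0 := (hS.orthonormal q).ne_zero α
  obtain ⟨β, hβ⟩ : ∃ β, S.pol q α β ≠ 0 := by
    by_contra! h
    exact hne (by ext β; simpa using h β)
  have h1 := congrFun (hS.eigen (-q) α) β
  have h2 := congrArg conj (congrFun (hS.eigen q α) β)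
  have h3 : (dynamicalMatrix C K (-q)).mulVec (S.pol (-q) α) β =
      conj ((dynamicalMatrix C K q).mulVec (S.pol q α) β) := by
    simp [Matrix.mulVec, dotProduct, dynamicalMatrix_neg, hS.pol_neg]
  rw [h3, h2, hS.pol_neg, map_mul, map_pow, Complex.conj_ofReal] at h1
  have h4 := mul_right_cancel₀ (by simpa using hβ) h1
  have h5 : S.freq q α ^ 2 = S.freq (-q) α ^ 2 := by exact_mod_cast h4
  exact ((sq_eq_sq₀ (hS.freq_nonneg _ _) (hS.freq_nonneg _ _)).1 h5).symm

theorem omega_neg (hS : IsNormalModes C K S) (p : Momentum L × Branch N) :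
    S.omega (negMode p) = S.omega p := hS.freq_neg _ _

/-- Uniform shifts lie in the kernel of the symmetric mass-weighted matrix, and eigenvectors for
different eigenvalues are orthogonal. -/
theorem sum_conj_modeVec_shift (hS : IsNormalModes C K S) (hK : IsStableForceMatrix K)
    {p : Momentum L × Branch N} (hp : S.omega p ≠ 0) (c : Fin 3 → ℂ) :
    ∑ s, conj (modeVec C S p s) * (Real.sqrt (C.mu s.2) * c s.2.2) = 0 := by
  have h1 : (S.omega p : ℂ) ^ 2 * ∑ s, conj (modeVec C S p s) * (Real.sqrt (C.mu s.2) * c s.2.2) =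
      0 := by
    calc _ = ∑ s, conj (∑ t, (massWeighted C K s t : ℂ) * modeVec C S p t) *
          (Real.sqrt (C.mu s.2) * c s.2.2) := by
          simp only [hS.sum_massWeighted_modeVec hK, Finset.mul_sum, map_mul, map_pow,
            Complex.conj_ofReal, mul_assoc]
      _ = ∑ t, conj (modeVec C S p t) * ∑ s, (massWeighted C K t s : ℂ) *
          (Real.sqrt (C.mu s.2) * c s.2.2) := by
          simp only [map_sum, map_mul, Complex.conj_ofReal, Finset.mul_sum, Finset.sum_mul]
          rw [Finset.sum_comm]
          refine Finset.sum_congr rfl fun s _ => Finset.sum_congr rfl fun t _ => ?_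
          rw [massWeighted_symm hK s t]
          ring
      _ = 0 := by simp [sum_massWeighted_shift hK]
  exact (mul_eq_zero.1 h1).resolve_left (pow_ne_zero _ (Complex.ofReal_ne_zero.2 hp))

theorem modeVec_eq_shift (hS : IsNormalModes C K S) (hK : IsStableForceMatrix K)
    {p : Momentum L × Branch N} (hp : S.omega p = 0) :
    ∃ c : Fin 3 → ℂ, ∀ s, modeVec C S p s = Real.sqrt (C.mu s.2) * c s.2.2 := by
  refine exists_eq_shift hK _ ?_
  simp only [mul_assoc, ← Finset.mul_sum, hS.sum_massWeighted_modeVec hK, hp]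
  simp

/-- A zero mode is a uniform shift and so takes the same value in every cell. Dividing by a non-zero
polarization component shows that the phase is identically 1. -/
theorem momentum_eq_zero (hS : IsNormalModes C K S) (hK : IsStableForceMatrix K)
    {q : Momentum L} {α : Branch N} (hp : S.freq q α = 0) : q = 0 := by
  obtain ⟨c, hc⟩ := hS.modeVec_eq_shift hK (p := (q, α)) hp
  have hne : S.pol q α ≠ 0 := (hS.orthonormal q).ne_zero α
  obtain ⟨β, hβ⟩ : ∃ β, S.pol q α β ≠ 0 := by
    by_contra! h
    exact hne (by ext β; simpa using h β)
  refine C.eq_zero_of_phase_eq_one q fun R => ?_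
  have h1 : modeVec C S (q, α) (R, β) = modeVec C S (q, α) (0, β) := by rw [hc, hc]
  have h2 := mul_right_cancel₀ hβ h1
  simp only [Crystal.fourierMode, Crystal.phase_zero_right] at h2
  have h3 : (Real.sqrt ((L : ℝ) ^ 3) : ℂ) ≠ 0 := by
    have : (0 : ℝ) < (L : ℝ) ^ 3 := pow_pos (Nat.cast_pos.2 (NeZero.pos L)) _
    exact Complex.ofReal_ne_zero.2 (Real.sqrt_pos.2 this).ne'
  exact (div_left_inj' h3).1 h2

end IsNormalModes

/-! ### The centre-of-mass projection and the number of zero modes -/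

/-- The total mass of the crystal. -/
def Crystal.totalMass (C : Crystal N) (L : ℕ) : ℝ := (L : ℝ) ^ 3 * ∑ r, C.mass r

theorem Crystal.totalMass_pos [NeZero N] (C : Crystal N) : 0 < C.totalMass L :=
  mul_pos (pow_pos (Nat.cast_pos.2 (NeZero.pos L)) _)
    (Finset.sum_pos (fun r _ => C.mass_pos r) Finset.univ_nonempty)

theorem sum_mu_ite (C : Crystal N) (j : Fin 3) :
    ∑ s : Site N L, (if s.2.2 = j then (C.mu s.2 : ℂ) else 0) = C.totalMass L := by
  rw [sum_site]
  simp only [Fintype.sum_prod_type, Finset.sum_ite_eq', Finset.mem_univ, if_true, Finset.sum_const,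
    Crystal.totalMass, Crystal.mu]
  simp [ZMod.card]

/-- The projection onto the centre-of-mass motion. -/
def comProj (C : Crystal N) (s t : Site N L) : ℂ :=
  if s.2.2 = t.2.2 then Real.sqrt (C.mu s.2) * Real.sqrt (C.mu t.2) / C.totalMass L else 0

namespace IsNormalModes

theorem sum_comProj_of_ne (hS : IsNormalModes C K S) (hK : IsStableForceMatrix K)
    {p : Momentum L × Branch N} (hp : S.omega p ≠ 0) (t : Site N L) :
    ∑ s, comProj C t s * modeVec C S p s = 0 := by
  have h := congrArg conj (hS.sum_conj_modeVec_shift hK hp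
    fun j => if t.2.2 = j then (Real.sqrt (C.mu t.2) / C.totalMass L : ℂ) else 0)
  simp only [map_sum, map_mul, Complex.conj_conj, map_zero, Complex.conj_ofReal] at h
  rw [← h]
  refine Finset.sum_congr rfl fun s _ => ?_
  rw [comProj]
  split_ifs
  · simp; ring
  · simp

theorem sum_comProj_of_eq [NeZero N] (hS : IsNormalModes C K S) (hK : IsStableForceMatrix K)
    {p : Momentum L × Branch N} (hp : S.omega p = 0) (t : Site N L) :
    ∑ s, comProj C t s * modeVec C S p s = modeVec C S p t := by
  obtain ⟨c, hc⟩ := hS.modeVec_eq_shift hK hp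
  have h1 : ∀ s, comProj C t s * modeVec C S p s =
      (if s.2.2 = t.2.2 then (C.mu s.2 : ℂ) else 0) *
        (Real.sqrt (C.mu t.2) * c t.2.2 / C.totalMass L) := by
    intro s
    rw [comProj, hc]
    by_cases h : s.2.2 = t.2.2
    · rw [if_pos h, if_pos h.symm, h, ← C.sqrt_mu_mul_self s.2]; ring
    · rw [if_neg h, if_neg (Ne.symm h)]; simp
  have hM : (C.totalMass L : ℂ) ≠ 0 := Complex.ofReal_ne_zero.2 C.totalMass_pos.ne'
  rw [Finset.sum_congr rfl fun s _ => h1 s, ← Finset.sum_mul, sum_mu_ite, hc]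
  field_simp

/-- The matrix `comProj` fixes the modes with $\omega=0$ and annihilates the others, so completeness
of the modes identifies it with the spectral projection onto the kernel. -/
theorem sum_zero_modes [NeZero N] (hS : IsNormalModes C K S) (hK : IsStableForceMatrix K)
    (s t : Site N L) :
    ∑ p, (if S.omega p = 0 then conj (modeVec C S p s) * modeVec C S p t else 0) =
      comProj C t s := by
  calc _ = ∑ p, conj (modeVec C S p s) * ∑ s', comProj C t s' * modeVec C S p s' := by
        refine Finset.sum_congr rfl fun p _ => ?_
        split_ifs with hp
        · rw [hS.sum_comProj_of_eq hK hp]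
        · rw [hS.sum_comProj_of_ne hK hp, mul_zero]
    _ = ∑ s', comProj C t s' * ∑ p, conj (modeVec C S p s) * modeVec C S p s' := by
        simp only [Finset.mul_sum]
        rw [Finset.sum_comm]
        refine Finset.sum_congr rfl fun s _ => Finset.sum_congr rfl fun t _ => ?_
        ring
    _ = _ := by simp [hS.sum_modeVec']

/-- The number of zero modes is the trace of the projection onto them. In the site basis each
Cartesian direction contributes total mass over total mass, that is 1. -/
theorem ncard_zero_modes [NeZero N] (hS : IsNormalModes C K S) (hK : IsStableForceMatrix K) :
    {α | S.freq 0 α = 0}.ncard = 3 := by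
  have h1 : ∑ s : Site N L, ∑ p, (if S.omega p = 0 then
      conj (modeVec C S p s) * modeVec C S p s else 0) =
      ∑ p : Momentum L × Branch N, if S.omega p = 0 then 1 else 0 := by
    rw [Finset.sum_comm]
    refine Finset.sum_congr rfl fun p _ => ?_
    split_ifs
    · simp [hS.sum_modeVec]
    · simp
  have h2 : ∑ p : Momentum L × Branch N, (if S.omega p = 0 then (1 : ℂ) else 0) =
      ∑ α, if S.freq 0 α = 0 then (1 : ℂ) else 0 := by
    rw [Fintype.sum_prod_type, Finset.sum_eq_single 0]
    · rfl
    · intro q _ hq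
      refine Finset.sum_eq_zero fun α _ => if_neg fun h => hq (hS.momentum_eq_zero hK h)
    · simp
  have h3 : ∑ s : Site N L, comProj C s s = 3 := by
    have hM : (C.totalMass L : ℂ) ≠ 0 := Complex.ofReal_ne_zero.2 C.totalMass_pos.ne'
    have : ∀ s : Site N L, comProj C s s =
        ∑ j : Fin 3, (if s.2.2 = j then (C.mu s.2 : ℂ) else 0) / C.totalMass L := by
      intro s
      simp [comProj, Crystal.sqrt_mu_mul_self, ← Finset.sum_div]
    simp only [this]
    rw [Finset.sum_comm]
    simp only [← Finset.sum_div, sum_mu_ite]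
    simp [hM]
  simp only [hS.sum_zero_modes hK, h3, h2] at h1
  rw [Finset.sum_boole] at h1
  have h4 : (Finset.univ.filter fun α => S.freq 0 α = 0).card = 3 := by exact_mod_cast h1.symm
  rw [← Set.ncard_coe_finset] at h4
  simpa using h4

theorem polMatrix_mem_unitaryGroup (hS : IsNormalModes C K S) (q : Momentum L) :
    S.polMatrix q ∈ Matrix.unitaryGroup (Branch N) ℂ := by
  rw [Matrix.mem_unitaryGroup_iff']
  ext α β
  simp [Matrix.mul_apply, ModeData.polMatrix, Matrix.star_apply, hS.sum_pol, Matrix.one_apply]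

theorem dynamicalMatrix_eq (hS : IsNormalModes C K S) (q : Momentum L) :
    dynamicalMatrix C K q = S.polMatrix q *
      Matrix.diagonal (fun α => (S.freq q α : ℂ) ^ 2) * (S.polMatrix q).conjTranspose := by
  have h1 := Matrix.mem_unitaryGroup_iff.1 (hS.polMatrix_mem_unitaryGroup q)
  have h2 : dynamicalMatrix C K q * S.polMatrix q = S.polMatrix q *
      Matrix.diagonal (fun α => (S.freq q α : ℂ) ^ 2) := by
    ext β α
    rw [Matrix.mul_diagonal]
    have := congrFun (hS.eigen q α) β
    simp only [ModeData.polMatrix, Matrix.of_apply, Matrix.mul_apply]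
    rw [mul_comm, ← this]
    rfl
  rw [← h2, Matrix.mul_assoc, ← Matrix.star_eq_conjTranspose, h1, Matrix.mul_one]

end IsNormalModes

/-! ### Existence of normal modes -/

/-- The last clause is needed at momenta with $-q=q$, where $y(-q)=y(q)^*$ forces real
polarizations. There the dynamical matrix is real symmetric and has a real eigenbasis; elsewhere any
Hermitian eigenbasis will do. -/
theorem exists_modes (hK : IsStableForceMatrix K) (q : Momentum L) :
    ∃ (w : Branch N → ℝ) (y : Branch N → EuclideanSpace ℂ (Branch N)), (∀ α, 0 ≤ w α) ∧
      Orthonormal ℂ y ∧ (∀ α, (dynamicalMatrix C K q).mulVec (y α) =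
        fun β => ((w α : ℂ) ^ 2) * y α β) ∧ (-q = q → ∀ α β, conj (y α β) = y α β) := by
  have hA := dynamicalMatrix_posSemidef (C := C) hK q
  -- It is enough to find eigenvalues $v_\alpha$; positive semidefiniteness makes them non-negative,
  -- and the frequencies are their square roots.
  suffices h : ∃ (v : Branch N → ℝ) (y : Branch N → EuclideanSpace ℂ (Branch N)),
      Orthonormal ℂ y ∧ (∀ α, (dynamicalMatrix C K q).mulVec (y α) =
        fun β => (v α : ℂ) * y α β) ∧ (-q = q → ∀ α β, conj (y α β) = y α β) by
    obtain ⟨v, y, hy, hv, hr⟩ := h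
    have hnonneg : ∀ α, 0 ≤ v α := by
      intro α
      have h1 := hA.dotProduct_mulVec_nonneg (y α)
      have h2 : star (y α : Branch N → ℂ) ⬝ᵥ (y α : Branch N → ℂ) = 1 := by
        have := (orthonormal_iff_ite.1 hy) α α
        rw [PiLp.inner_apply] at this
        simpa [dotProduct, mul_comm, Complex.mul_conj, Complex.normSq_eq_norm_sq] using this
      have h3 : (fun β => (v α : ℂ) * y α β) = (v α : ℂ) • (y α : Branch N → ℂ) := rfl
      rw [hv, h3, dotProduct_smul, h2] at h1
      simpa using h1
    refine ⟨fun α => Real.sqrt (v α), y, fun α => Real.sqrt_nonneg _, hy, fun α => ?_, hr⟩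
    rw [hv]
    funext β
    rw [← Complex.ofReal_pow, Real.sq_sqrt (hnonneg α)]
  by_cases hq : -q = q
  · let B : Matrix (Branch N) (Branch N) ℝ := (dynamicalMatrix C K q).map Complex.re
    have hB : ∀ α β, ((B α β : ℝ) : ℂ) = dynamicalMatrix C K q α β := by
      intro α β
      have h1 : dynamicalMatrix C K (-q) α β = conj (dynamicalMatrix C K q α β) := by
        rw [dynamicalMatrix_neg]; rfl
      rw [hq] at h1
      exact Complex.conj_eq_iff_re.1 h1.symm
    have hBh : B.IsHermitian := by
      ext α β
      have h1 := congrArg Complex.re (hA.isHermitian.apply α β)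
      simpa [B] using h1
    refine ⟨hBh.eigenvalues, fun α => WithLp.toLp 2 fun β => (hBh.eigenvectorBasis α β : ℂ),
      ?_, fun α => ?_, fun _ α β => by simp⟩
    · rw [orthonormal_iff_ite]
      intro α α'
      have h1 := orthonormal_iff_ite.1 hBh.eigenvectorBasis.orthonormal α α'
      rw [PiLp.inner_apply] at h1 ⊢
      have h2 := congrArg (fun x : ℝ => (x : ℂ)) h1
      simpa [apply_ite] using h2
    · funext β
      have h1 := congrArg (fun x : ℝ => (x : ℂ)) (congrFun (hBh.mulVec_eigenvectorBasis α) β)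
      simpa [Matrix.mulVec, dotProduct, hB] using h1
  · refine ⟨hA.isHermitian.eigenvalues, fun α => hA.isHermitian.eigenvectorBasis α,
      hA.isHermitian.eigenvectorBasis.orthonormal, fun α => ?_, fun h => absurd h hq⟩
    rw [hA.isHermitian.mulVec_eigenvectorBasis]
    rfl

/-- An arbitrary enumeration of the momenta selects one member of each pair $\{q,-q\}$. The
eigenvectors are chosen freely there and by complex conjugation at the partner; self-paired momenta
use the real choice. -/
theorem exists_isNormalModes (C : Crystal N) (hK : IsStableForceMatrix K) :
    ∃ S : ModeData N L, IsNormalModes C K S := by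
  choose w y hw hy hv hr using exists_modes (C := C) hK
  let o : Momentum L ≃ Fin (Fintype.card (Momentum L)) := Fintype.equivFin _
  let P : Momentum L → Prop := fun q => o q ≤ o (-q)
  have hP : ∀ q, -q ≠ q → (P (-q) ↔ ¬ P q) := by
    intro q hq
    have : o (-q) ≠ o q := fun h => hq (o.injective h)
    simp only [P, neg_neg, not_le]
    exact ⟨fun h => lt_of_le_of_ne h this, le_of_lt⟩
  classical
  let cj : EuclideanSpace ℂ (Branch N) → EuclideanSpace ℂ (Branch N) :=
    fun z => WithLp.toLp 2 fun β => conj (z β)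
  refine ⟨⟨fun q => if P q then w q else w (-q),
    fun q α => if P q then y q α else cj (y (-q) α)⟩, ?_, ?_, ?_, ?_⟩
  · intro q α
    dsimp only
    split_ifs <;> exact hw _ _
  · intro q
    dsimp only
    split_ifs
    · exact hy q
    · rw [orthonormal_iff_ite]
      intro α α'
      have h := congrArg conj (orthonormal_iff_ite.1 (hy (-q)) α α')
      rw [PiLp.inner_apply] at h ⊢
      simpa [cj] using h
  · intro q α
    dsimp only
    split_ifs
    · exact hv q α
    · funext β
      have h := congrArg conj (congrFun (hv (-q) α) β)
      simpa [Matrix.mulVec, dotProduct, dynamicalMatrix_neg, cj] using h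
  · intro q α β
    dsimp only
    by_cases hq : -q = q
    · have : P q := by simp [P, hq]
      have this' : P (-q) := by simp [P, hq]
      rw [if_pos this, if_pos this', hq]
      exact (hr q hq α β).symm
    · by_cases h : P q
      · have h' := mt (hP q hq).1 (not_not.2 h)
        rw [if_pos h, if_neg h']
        simp [cj]
      · rw [if_neg h, if_pos ((hP q hq).2 h)]
        simp [cj]

end Phonon

namespace Phonon

variable {N L : ℕ} [NeZero L] {C : Crystal N} {K : Matrix (Site N L) (Site N L) ℝ}
  {S : ModeData N L}

/-! ### Differentiation and multiplication operators -/

theorem contDiff_wave (Ψ : Wave N L) : ContDiff ℝ ∞ Ψ.1 := Ψ.2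

theorem differentiable_wave (Ψ : Wave N L) : Differentiable ℝ Ψ.1 :=
  (contDiff_wave Ψ).differentiable (by simp)

theorem partialOp_apply (s : Site N L) (Ψ : Wave N L) (u : Displ N L) :
    (partialOp s Ψ).1 u = fderiv ℝ Ψ.1 u (EuclideanSpace.single s 1) := rfl

theorem partialOp_comm (s t : Site N L) :
    partialOp s * partialOp t = partialOp t * partialOp s := by
  have key : ∀ (s t : Site N L) (Ψ : Wave N L) (u : Displ N L), (partialOp s (partialOp t Ψ)).1 u =
      fderiv ℝ (fderiv ℝ Ψ.1) u (EuclideanSpace.single s 1) (EuclideanSpace.single t 1) := by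
    intro s t Ψ u
    have h : Differentiable ℝ (fderiv ℝ Ψ.1) :=
      ((contDiff_wave Ψ).fderiv_right (m := ∞) (by simp)).differentiable (by simp)
    rw [partialOp_apply]
    change fderiv ℝ (fun u => fderiv ℝ Ψ.1 u (EuclideanSpace.single t 1)) u _ = _
    rw [fderiv_clm_apply (h u) (differentiableAt_const _)]
    simp
  ext Ψ u
  change (partialOp s (partialOp t Ψ)).1 u = (partialOp t (partialOp s Ψ)).1 u
  rw [key, key]
  exact ((contDiff_wave Ψ).contDiffAt.isSymmSndFDerivAt (by
    simp only [minSmoothness_of_isRCLikeNormedField]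
    exact WithTop.coe_le_coe.2 (le_top : (2 : ℕ∞) ≤ ⊤))).eq _ _

theorem partialOp_mul (s : Site N L) (f g : Wave N L) :
    partialOp s (f * g) = partialOp s f * g + f * partialOp s g := by
  ext u
  change fderiv ℝ (f.1 * g.1) u _ = fderiv ℝ f.1 u _ * g.1 u + f.1 u * fderiv ℝ g.1 u _
  rw [fderiv_mul (differentiable_wave f u) (differentiable_wave g u)]
  simp
  ring

theorem lie_partialOp_mulOp (s : Site N L) (f : Wave N L) :
    ⁅partialOp s, mulOp f⁆ = mulOp (partialOp s f) := by
  refine LinearMap.ext fun g => ?_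
  change partialOp s (f * g) - f * partialOp s g = partialOp s f * g
  rw [partialOp_mul]
  abel

theorem mulOp_mul (f g : Wave N L) : mulOp (f * g) = mulOp f * mulOp g :=
  LinearMap.ext fun h => mul_assoc f g h

/-- `x_q^α` as a smooth function. -/
def normalWave (C : Crystal N) (S : ModeData N L) (p : Momentum L × Branch N) : Wave N L :=
  ⟨normalCoord C S p.1 p.2, contDiff_normalCoord C S p.1 p.2⟩

theorem xOp_eq (C : Crystal N) (S : ModeData N L) (q : Momentum L) (α : Branch N) :
    xOp C S q α = mulOp (normalWave C S (q, α)) := rfl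

theorem normalCoord_eq (C : Crystal N) (S : ModeData N L) (q : Momentum L) (α : Branch N)
    (u : Displ N L) : normalCoord C S q α u =
      ∑ s, conj (modeVec C S (q, α) s) * (Real.sqrt (C.mu s.2) : ℂ) * (u s : ℂ) := by
  rw [sum_site, Finset.sum_comm, normalCoord]
  refine Finset.sum_congr rfl fun β _ => ?_
  rw [fourierCoord, Finset.mul_sum, Finset.mul_sum]
  refine Finset.sum_congr rfl fun R _ => ?_
  simp only [modeVec, map_mul]
  ring

theorem dxOp_eq (C : Crystal N) (S : ModeData N L) (q : Momentum L) (α : Branch N) :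
    dxOp C S q α =
      ∑ s, (modeVec C S (q, α) s / (Real.sqrt (C.mu s.2) : ℂ)) • partialOp s := by
  rw [sum_site]
  rfl

theorem fderiv_normalCoord (C : Crystal N) (S : ModeData N L) (q : Momentum L) (α : Branch N)
    (u v : Displ N L) : fderiv ℝ (normalCoord C S q α) u v = normalCoord C S q α v := by
  let l : Displ N L →ₗ[ℝ] ℂ :=
    { toFun := normalCoord C S q α
      map_add' := fun u v => by
        simp only [normalCoord_eq, PiLp.add_apply, Complex.ofReal_add, mul_add,
          Finset.sum_add_distrib]
      map_smul' := fun c u => by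
        simp only [normalCoord_eq, PiLp.smul_apply, smul_eq_mul, Complex.ofReal_mul,
          RingHom.id_apply, Complex.real_smul, Finset.mul_sum]
        exact Finset.sum_congr rfl fun _ _ => by ring }
  have : fderiv ℝ (normalCoord C S q α) u = LinearMap.toContinuousLinearMap l :=
    (LinearMap.toContinuousLinearMap l).fderiv
  rw [this]
  rfl

theorem partialOp_normalWave (s : Site N L) (p : Momentum L × Branch N) :
    partialOp s (normalWave C S p) =
      algebraMap ℂ _ (conj (modeVec C S p s) * (Real.sqrt (C.mu s.2) : ℂ)) := by
  ext u
  change fderiv ℝ (normalCoord C S p.1 p.2) u _ = conj (modeVec C S p s) * Real.sqrt (C.mu s.2)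
  rw [fderiv_normalCoord, normalCoord_eq, Finset.sum_eq_single s]
  · simp
  · intro t _ ht; simp [ht]
  · simp

theorem mulOp_algebraMap (c : ℂ) :
    mulOp (algebraMap ℂ (Wave N L) c) = c • (1 : Module.End ℂ (Wave N L)) := by
  refine LinearMap.ext fun g => ?_
  change algebraMap ℂ (Wave N L) c * g = c • g
  rw [Algebra.smul_def]

theorem dxOp_comm (q k : Momentum L) (α β : Branch N) :
    dxOp C S q α * dxOp C S k β = dxOp C S k β * dxOp C S q α := by
  simp only [dxOp_eq, Finset.sum_mul, Finset.mul_sum, smul_mul_assoc, mul_smul_comm,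
    Finset.smul_sum]
  rw [Finset.sum_comm]
  refine Finset.sum_congr rfl fun s _ => Finset.sum_congr rfl fun t _ => ?_
  rw [partialOp_comm, smul_comm]

theorem xOp_comm (q k : Momentum L) (α β : Branch N) :
    xOp C S q α * xOp C S k β = xOp C S k β * xOp C S q α := by
  rw [xOp_eq, xOp_eq, ← mulOp_mul, mul_comm, mulOp_mul]

theorem sum_smul_commutator {A ι : Type*} [Ring A] [Algebra ℂ A] [Fintype ι] (c : ι → ℂ) (P : ι → A)
    (f : A) : (∑ i, c i • P i) * f - f * ∑ i, c i • P i = ∑ i, c i • (P i * f - f * P i) := by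
  rw [Finset.sum_mul, Finset.mul_sum, ← Finset.sum_sub_distrib]
  simp only [smul_mul_assoc, mul_smul_comm, smul_sub]

/-- The factors $\sqrt{\mu}$ and $1/\sqrt{\mu}$ cancel, leaving the orthonormality relation of the
modes. -/
theorem IsNormalModes.lie_dxOp_xOp (hS : IsNormalModes C K S) (p p' : Momentum L × Branch N) :
    ⁅dxOp C S p.1 p.2, xOp C S p'.1 p'.2⁆ = if p = p' then 1 else 0 := by
  have h : ∀ s : Site N L, modeVec C S p s / (Real.sqrt (C.mu s.2) : ℂ) *
      (conj (modeVec C S p' s) * (Real.sqrt (C.mu s.2) : ℂ)) =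
      conj (modeVec C S p' s) * modeVec C S p s := by
    intro s
    have := C.sqrt_mu_ne_zero s.2
    field_simp
  rw [xOp_eq, dxOp_eq]
  refine (sum_smul_commutator (A := Module.End ℂ (Wave N L)) _ _ _).trans ?_
  have h' : ∀ s, partialOp s * mulOp (normalWave C S p') - mulOp (normalWave C S p') * partialOp s =
      mulOp (partialOp s (normalWave C S p')) := fun s => lie_partialOp_mulOp s _
  simp only [Prod.mk.eta]
  rw [Finset.sum_congr rfl fun s _ => congrArg (_ • ·) (h' s)]
  simp only [partialOp_normalWave, mulOp_algebraMap, smul_smul, h,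
    ← Finset.sum_smul, hS.sum_modeVec, eq_comm (a := p')]
  split_ifs <;> simp

theorem IsNormalModes.dxOp_mul_xOp (hS : IsNormalModes C K S) (p p' : Momentum L × Branch N) :
    dxOp C S p.1 p.2 * xOp C S p'.1 p'.2 =
      xOp C S p'.1 p'.2 * dxOp C S p.1 p.2 + if p = p' then 1 else 0 := by
  rw [← hS.lie_dxOp_xOp]
  exact (add_sub_cancel _ _).symm

/-! ### The Hamiltonian in normal coordinates -/

namespace IsNormalModes

theorem normalCoord_neg (hS : IsNormalModes C K S) (q : Momentum L) (α : Branch N)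
    (u : Displ N L) : normalCoord C S (-q) α u = conj (normalCoord C S q α u) := by
  have h := fun s => hS.modeVec_neg (q, α) s
  simp only [negMode] at h
  simp [normalCoord_eq, h]

theorem dxOp_neg_mul_dxOp (hS : IsNormalModes C K S) (p : Momentum L × Branch N) :
    dxOp C S (-p.1) p.2 * dxOp C S p.1 p.2 = ∑ s, ∑ t,
      (conj (modeVec C S p s) * modeVec C S p t) •
        ((1 / ((Real.sqrt (C.mu s.2) : ℂ) * Real.sqrt (C.mu t.2))) •
          (partialOp s * partialOp t)) := by
  have h := fun s => hS.modeVec_neg p s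
  simp only [negMode] at h
  simp only [dxOp_eq, h, Finset.sum_mul, Finset.mul_sum, smul_mul_assoc, mul_smul_comm, smul_smul,
    Finset.smul_sum]
  rw [Finset.sum_comm]
  refine Finset.sum_congr rfl fun s _ => Finset.sum_congr rfl fun t _ => ?_
  congr 1
  simp only [Prod.mk.eta]
  field_simp

/-- The weights `c` allow two uses: $c=1$ turns the inner sum into the identity matrix and yields
the whole kinetic energy, while the indicator of $\omega=0$ turns it into `comProj` and yields the
centre-of-mass part. -/
theorem sum_smul_dxOp (hS : IsNormalModes C K S) (c : Momentum L × Branch N → ℂ) :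
    ∑ p, c p • (dxOp C S (-p.1) p.2 * dxOp C S p.1 p.2) = ∑ s, ∑ t,
      (∑ p, c p * (conj (modeVec C S p s) * modeVec C S p t)) •
        ((1 / ((Real.sqrt (C.mu s.2) : ℂ) * Real.sqrt (C.mu t.2))) •
          (partialOp s * partialOp t)) := by
  simp only [hS.dxOp_neg_mul_dxOp, Finset.smul_sum, Finset.sum_smul, Finset.sum_mul, smul_smul]
  rw [Finset.sum_comm]
  refine Finset.sum_congr rfl fun s _ => ?_
  rw [Finset.sum_comm]
  simp only [mul_assoc]

theorem sum_dxOp (hS : IsNormalModes C K S) :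
    ∑ p : Momentum L × Branch N, dxOp C S (-p.1) p.2 * dxOp C S p.1 p.2 =
      ∑ s : Site N L, ((1 / C.mu s.2 : ℝ) : ℂ) • partialOp s ^ 2 := by
  have h := hS.sum_smul_dxOp fun _ => 1
  simp only [one_smul, one_mul, hS.sum_modeVec'] at h
  rw [h]
  refine Finset.sum_congr rfl fun s _ => ?_
  rw [Finset.sum_eq_single s]
  · rw [if_pos rfl, one_smul, C.sqrt_mu_mul_self, pow_two]
    push_cast; rfl
  · intro t _ ht; rw [if_neg ht.symm, zero_smul]
  · simp

/-- The square roots of the masses in `comProj` cancel the mass weighting of the derivatives. What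
remains is a sum over pairs of sites with equal direction, which is the square of the total
derivative in each direction. -/
theorem centerOfMassKinetic_eq_sum [NeZero N] (hS : IsNormalModes C K S)
    (hK : IsStableForceMatrix K) : centerOfMassKinetic C = (-(1 / 2) : ℂ) •
      ∑ p : Momentum L × Branch N,
        if S.omega p = 0 then dxOp C S (-p.1) p.2 * dxOp C S p.1 p.2 else 0 := by
  have h := hS.sum_smul_dxOp fun p => if S.omega p = 0 then 1 else 0
  simp only [ite_smul, one_smul, zero_smul, ite_mul, one_mul, zero_mul,
    hS.sum_zero_modes hK] at h
  rw [h, centerOfMassKinetic]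
  have h1 : ∀ s t : Site N L, comProj C t s •
      ((1 / ((Real.sqrt (C.mu s.2) : ℂ) * Real.sqrt (C.mu t.2))) • (partialOp s * partialOp t)) =
      (1 / C.totalMass L : ℂ) • if s.2.2 = t.2.2 then partialOp s * partialOp t else 0 := by
    intro s t
    have hs := C.sqrt_mu_ne_zero s.2
    have ht := C.sqrt_mu_ne_zero t.2
    have hM : (C.totalMass L : ℂ) ≠ 0 := Complex.ofReal_ne_zero.2 C.totalMass_pos.ne'
    rw [comProj]
    by_cases hst : s.2.2 = t.2.2
    · rw [if_pos hst.symm, if_pos hst, smul_smul]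
      congr 1
      field_simp
    · rw [if_neg (Ne.symm hst), if_neg hst]; simp
  have h2 : ∀ j : Fin 3, ∑ R : Cell L, ∑ r : Fin N, partialOp (R, (r, j)) =
      ∑ s : Site N L, if s.2.2 = j then partialOp s else 0 := by
    intro j
    simp [Fintype.sum_prod_type]
  have h3 : ∑ j : Fin 3, (∑ R : Cell L, ∑ r : Fin N, partialOp (R, (r, j))) ^ 2 =
      ∑ s : Site N L, ∑ t : Site N L, if s.2.2 = t.2.2 then partialOp s * partialOp t else 0 := by
    simp only [h2, pow_two, Finset.sum_mul, Finset.mul_sum]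
    rw [Finset.sum_comm]
    refine Finset.sum_congr rfl fun s _ => ?_
    rw [Finset.sum_comm]
    refine Finset.sum_congr rfl fun t _ => ?_
    rw [Finset.sum_eq_single s.2.2]
    · by_cases hst : s.2.2 = t.2.2
      · rw [if_pos rfl, if_pos hst.symm, if_pos hst, partialOp_comm]
      · rw [if_neg (Ne.symm hst), if_neg hst, zero_mul]
    · intro j _ hj; simp [hj.symm]
    · simp
  simp only [h1, ← Finset.smul_sum, h3, smul_smul]
  congr 1
  have hM : (C.totalMass L : ℂ) ≠ 0 := Complex.ofReal_ne_zero.2 C.totalMass_pos.ne'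
  change ((-(1 / (2 * C.totalMass L)) : ℝ) : ℂ) = _
  push_cast
  field_simp

theorem centerOfMassKinetic_eq [NeZero N] (hS : IsNormalModes C K S)
    (hK : IsStableForceMatrix K) : centerOfMassKinetic C = (-(1 / 2) : ℂ) •
      ∑ α : Branch N, (if S.freq 0 α = 0 then dxOp C S 0 α ^ 2 else 0) := by
  rw [hS.centerOfMassKinetic_eq_sum hK, Fintype.sum_prod_type, Finset.sum_eq_single 0]
  · simp [ModeData.omega, pow_two]
  · intro q _ hq
    refine Finset.sum_eq_zero fun α _ => if_neg fun h => hq (hS.momentum_eq_zero hK h)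
  · simp

theorem sum_mode {M : Type*} [AddCommMonoid M] (f : Momentum L × Branch N → M) :
    ∑ p : S.Mode, f p.1 = ∑ p, if S.omega p = 0 then 0 else f p := by
  calc _ = ∑ p ∈ Finset.univ.filter (fun p => S.omega p ≠ 0), f p :=
        (Finset.sum_subtype _ (fun p => by rw [Finset.mem_filter]; simp [ModeData.omega]) _).symm
    _ = _ := by
        rw [Finset.sum_filter]
        exact Finset.sum_congr rfl fun p _ => ite_not _ _ _

theorem sum_quadratic (c : Momentum L × Branch N → ℂ) (w w' : Site N L → ℂ) :
    ∑ s, ∑ t, w s * (∑ p, c p * (modeVec C S p s * conj (modeVec C S p t))) * w' t =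
      ∑ p, c p * ((∑ s, modeVec C S p s * w s) * ∑ t, conj (modeVec C S p t) * w' t) := by
  simp only [Finset.mul_sum, Finset.sum_mul]
  have h : ∀ f : Site N L → Site N L → Momentum L × Branch N → ℂ,
      ∑ s, ∑ t, ∑ p, f s t p = ∑ p, ∑ t, ∑ s, f s t p := by
    intro f
    rw [Finset.sum_comm]
    refine (Finset.sum_congr rfl fun t _ => Finset.sum_comm).trans Finset.sum_comm
  rw [h]
  refine Finset.sum_congr rfl fun p _ => ?_
  refine Finset.sum_congr rfl fun s _ => Finset.sum_congr rfl fun t _ => ?_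
  ring

theorem sum_normalCoord (hS : IsNormalModes C K S) (c : Momentum L × Branch N → ℂ)
    (u : Displ N L) :
    ∑ p : Momentum L × Branch N,
        c p * (normalCoord C S (-p.1) p.2 u * normalCoord C S p.1 p.2 u) =
      ∑ s, ∑ t, ((Real.sqrt (C.mu s.2) : ℂ) * u s) *
        (∑ p, c p * (modeVec C S p s * conj (modeVec C S p t))) *
          (Real.sqrt (C.mu t.2) * u t) := by
  rw [sum_quadratic]
  simp only [hS.normalCoord_neg, normalCoord_eq, map_sum, map_mul, Complex.conj_conj,
    Complex.conj_ofReal, Prod.mk.eta, mul_assoc]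

theorem potential_eq (hS : IsNormalModes C K S) (hK : IsStableForceMatrix K) (u : Displ N L) :
    (potential K u : ℂ) = (1 / 2) * ∑ p : Momentum L × Branch N,
      (S.omega p : ℂ) ^ 2 * (normalCoord C S (-p.1) p.2 u * normalCoord C S p.1 p.2 u) := by
  have h1 : ∀ s t, (u s : ℂ) * K s t * u t = ((Real.sqrt (C.mu s.2) : ℂ) * u s) *
      massWeighted C K s t * (Real.sqrt (C.mu t.2) * u t) := by
    intro s t
    have hs := C.sqrt_mu_ne_zero s.2
    have ht := C.sqrt_mu_ne_zero t.2
    rw [ofReal_massWeighted]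
    field_simp
  rw [hS.sum_normalCoord, potential]
  simp only [← hS.massWeighted_eq hK, ← h1]
  push_cast
  rfl

/-- All modes enter the full kinetic energy, and the subtraction of $T_{\rm cm}$ removes those with
$\omega=0$; in the potential energy these have coefficient $\omega^2=0$ anyway. -/
theorem phononHamiltonian_eq [NeZero N] (hS : IsNormalModes C K S) (hK : IsStableForceMatrix K) :
    phononHamiltonian C K = (1 / 2 : ℂ) • ∑ p : S.Mode,
      (-(dxOp C S (-p.1.1) p.1.2 * dxOp C S p.1.1 p.1.2) +
        ((S.freq p.1.1 p.1.2 : ℂ) ^ 2) •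
          (xOp C S (-p.1.1) p.1.2 * xOp C S p.1.1 p.1.2)) := by
  have hV : mulOp (potentialWave K) = (1 / 2 : ℂ) • ∑ p : Momentum L × Branch N,
      ((S.omega p : ℂ) ^ 2) • (xOp C S (-p.1) p.2 * xOp C S p.1 p.2) := by
    refine LinearMap.ext fun Ψ => Subtype.ext (funext fun u => ?_)
    simp only [LinearMap.smul_apply, LinearMap.sum_apply]
    change (potential K u : ℂ) * Ψ.1 u = _
    rw [hS.potential_eq hK, Finset.mul_sum, Finset.sum_mul, Finset.smul_sum]
    simp only [AddSubmonoidClass.coe_finsetSum, Finset.sum_apply]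
    refine Finset.sum_congr rfl fun p _ => ?_
    change _ = (1 / 2) * ((S.omega p : ℂ) ^ 2 *
      (normalCoord C S (-p.1) p.2 u * (normalCoord C S p.1 p.2 u * Ψ.1 u)))
    ring
  rw [phononHamiltonian, hamiltonian, ← hS.sum_dxOp, hV, hS.centerOfMassKinetic_eq_sum hK]
  have h := sum_mode (S := S) fun p => -(dxOp C S (-p.1) p.2 * dxOp C S p.1 p.2) +
    ((S.freq p.1 p.2 : ℂ) ^ 2) • (xOp C S (-p.1) p.2 * xOp C S p.1 p.2)
  rw [h]
  have h2 : ∀ p : Momentum L × Branch N, (if S.omega p = 0 then 0 else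
      -(dxOp C S (-p.1) p.2 * dxOp C S p.1 p.2) +
        ((S.freq p.1 p.2 : ℂ) ^ 2) • (xOp C S (-p.1) p.2 * xOp C S p.1 p.2)) =
      (if S.omega p = 0 then dxOp C S (-p.1) p.2 * dxOp C S p.1 p.2 else 0) -
      dxOp C S (-p.1) p.2 * dxOp C S p.1 p.2 +
      ((S.omega p : ℂ) ^ 2) • (xOp C S (-p.1) p.2 * xOp C S p.1 p.2) := by
    intro p
    split_ifs with hp
    · simp only [hp, Complex.ofReal_zero, ne_eq, OfNat.ofNat_ne_zero, not_false_eq_true, zero_pow,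
        zero_smul, add_zero]
      exact (sub_self (G := Module.End ℂ (Wave N L)) _).symm
    · rw [ModeData.omega]
      refine congrArg (· + _) ?_
      exact (zero_sub (G := Module.End ℂ (Wave N L)) _).symm
  simp only [h2, Finset.sum_add_distrib]
  have h3 := Finset.sum_sub_distrib (s := (Finset.univ : Finset (Momentum L × Branch N)))
    (fun p => if S.omega p = 0 then dxOp C S (-p.1) p.2 * dxOp C S p.1 p.2 else 0)
    (fun p => dxOp C S (-p.1) p.2 * dxOp C S p.1 p.2)
  erw [h3]
  module

/-- `(q, α) ↦ (-q, α)` on the phonon modes. -/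
def negEquiv (hS : IsNormalModes C K S) : S.Mode ≃ S.Mode where
  toFun p := ⟨negMode p.1, by
    have := hS.omega_neg p.1
    rw [ModeData.omega, ModeData.omega] at this
    rw [this]
    exact p.2⟩
  invFun p := ⟨negMode p.1, by
    have := hS.omega_neg p.1
    rw [ModeData.omega, ModeData.omega] at this
    rw [this]
    exact p.2⟩
  left_inv p := Subtype.ext (negMode_negMode _)
  right_inv p := Subtype.ext (negMode_negMode _)

end IsNormalModes

/-! ### Algebra of the ladder operators -/

theorem sqrt_freq_coeff {w : ℝ} (hw : 0 < w) :
    (Real.sqrt (w / 2) : ℂ) * Real.sqrt (w / 2) = w / 2 ∧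
    (w : ℂ) * (((1 / Real.sqrt (2 * w) : ℝ) : ℂ) * ((1 / Real.sqrt (2 * w) : ℝ) : ℂ)) = 1 / 2 ∧
    (Real.sqrt (w / 2) : ℂ) * ((1 / Real.sqrt (2 * w) : ℝ) : ℂ) = 1 / 2 := by
  refine ⟨?_, ?_, ?_⟩
  · rw [← Complex.ofReal_mul, Real.mul_self_sqrt (by positivity)]
    push_cast; rfl
  · rw [← Complex.ofReal_mul, ← Complex.ofReal_mul, div_mul_div_comm,
      Real.mul_self_sqrt (by positivity)]
    have : w * (1 * 1 / (2 * w)) = 1 / 2 := by field_simp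
    rw [this]
    push_cast; rfl
  · have : Real.sqrt (w / 2) * (1 / Real.sqrt (2 * w)) = 1 / 2 := by
      rw [mul_one_div, ← Real.sqrt_div' _ (by positivity), Real.sqrt_eq_iff_mul_self_eq
        (by positivity) (by positivity)]
      field_simp
    rw [← Complex.ofReal_mul, this]
    push_cast; rfl

/-- Here `x'`, `d'` stand for the coordinate and derivative at $-q$. The constant from reordering `d
* x` cancels the zero-point term. The two terms of type $x\partial$ remain: one belongs to $-q$ and
the other, with opposite sign, to $q$. -/
theorem normal_ordering {A : Type*} [Ring A] [Algebra ℂ A] {x x' d d' : A} {r k w : ℂ}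
    (hdx : d * x = x * d + 1) (hdd : d * d' = d' * d) (hr : r * r = w / 2)
    (hk : w * (k * k) = 1 / 2) (hrk : r * k = 1 / 2) :
    w • ((r • x' - k • d) * (r • x + k • d') + (1 / 2 : ℂ) • 1) =
      (1 / 2 : ℂ) • (-(d' * d) + w ^ 2 • (x' * x)) + (w / 2) • (x' * d') +
        (-1 : ℂ) • ((w / 2) • (x * d)) := by
  rw [sub_mul, mul_add, mul_add]
  simp only [smul_mul_assoc, mul_smul_comm, smul_smul, hdx, hdd]
  rw [hr, hrk, mul_comm k r, hrk]
  simp only [smul_add, smul_sub, smul_smul, hk]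
  module

/-- With `σ` the map $q\mapsto-q$: commutators of equal type have two contributions of opposite
sign, which cancel because `r` and `k` are `σ`-invariant. In the mixed commutator the two
contributions are $rk=\frac12$ each and add up to 1. -/
theorem ladder_commutators {A ι : Type*} [Ring A] [Algebra ℂ A] [DecidableEq ι] {σ : ι → ι}
    (hσ : Function.Involutive σ) {X D : ι → A} {r k : ι → ℂ} (hXX : ∀ i j, X i * X j = X j * X i)
    (hDD : ∀ i j, D i * D j = D j * D i)
    (hDX : ∀ i j, D i * X j = X j * D i + if i = j then 1 else 0)
    (hr : ∀ i, r (σ i) = r i) (hk : ∀ i, k (σ i) = k i) (i j : ι) (hi : r i * k i = 1 / 2) :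
    (r i • X i + k i • D (σ i)) * (r j • X j + k j • D (σ j)) -
      (r j • X j + k j • D (σ j)) * (r i • X i + k i • D (σ i)) = 0 ∧
    (r i • X (σ i) - k i • D i) * (r j • X (σ j) - k j • D j) -
      (r j • X (σ j) - k j • D j) * (r i • X (σ i) - k i • D i) = 0 ∧
    (r i • X i + k i • D (σ i)) * (r j • X (σ j) - k j • D j) -
      (r j • X (σ j) - k j • D j) * (r i • X i + k i • D (σ i)) = if i = j then 1 else 0 := by
  have hσ' : ∀ i j, σ i = j ↔ i = σ j := fun i j =>
    ⟨fun h => by rw [← h, hσ], fun h => by rw [h, hσ]⟩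
  have hσ'' : σ i = σ j ↔ i = j := hσ.injective.eq_iff
  simp only [mul_add, add_mul, mul_sub, sub_mul, smul_mul_assoc, mul_smul_comm, hDX, hσ', hσ j,
    eq_comm (a := j)]
  rw [hXX j i, hXX (σ j) (σ i), hXX (σ j) i, hDD j i, hDD (σ j) (σ i), hDD j (σ i)]
  refine ⟨?_, ?_, ?_⟩
  · by_cases h : i = σ j
    · simp only [h, hr, hk, if_true]; module
    · simp only [h, if_false]; module
  · by_cases h : i = σ j
    · simp only [h, hr, hk, if_true]; module
    · simp only [h, if_false]; module
  · by_cases h : i = j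
    · subst h
      simp only [if_true]
      have h2 : (r i * k i + r i * k i) • (1 : A) = 1 := by rw [hi]; norm_num
      refine Eq.trans ?_ h2
      module
    · simp only [h, if_false]; module

namespace IsNormalModes

theorem freq_pos (hS : IsNormalModes C K S) (p : S.Mode) : 0 < S.freq p.1.1 p.1.2 :=
  lt_of_le_of_ne (hS.freq_nonneg _ _) p.2.symm

theorem phononHamiltonian_eq_sum [NeZero N] (hS : IsNormalModes C K S)
    (hK : IsStableForceMatrix K) :
    phononHamiltonian C K = ∑ p : S.Mode, (S.freq p.1.1 p.1.2 : ℂ) •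
      (creation C S p * annihilation C S p + (1 / 2 : ℂ) • 1) := by
  let F : S.Mode → Module.End ℂ (Wave N L) := fun p =>
    (S.freq p.1.1 p.1.2 / 2 : ℂ) • (xOp C S p.1.1 p.1.2 * dxOp C S p.1.1 p.1.2)
  -- The cross terms left by `normal_ordering` are `F` at $-q$ minus `F` at $q$, so reindexing by
  -- $q\mapsto-q$ makes their sum vanish.
  have hF : ∑ p, F (hS.negEquiv p) = ∑ p, F p := Equiv.sum_comp hS.negEquiv F
  have h : ∀ p : S.Mode, (S.freq p.1.1 p.1.2 : ℂ) •
      (creation C S p * annihilation C S p + (1 / 2 : ℂ) • 1) =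
      (1 / 2 : ℂ) • (-(dxOp C S (-p.1.1) p.1.2 * dxOp C S p.1.1 p.1.2) +
        ((S.freq p.1.1 p.1.2 : ℂ) ^ 2) • (xOp C S (-p.1.1) p.1.2 * xOp C S p.1.1 p.1.2)) +
      F (hS.negEquiv p) + (-1 : ℂ) • F p := by
    intro p
    obtain ⟨h1, h2, h3⟩ := sqrt_freq_coeff (hS.freq_pos p)
    have h4 : F (hS.negEquiv p) = (S.freq p.1.1 p.1.2 / 2 : ℂ) •
        (xOp C S (-p.1.1) p.1.2 * dxOp C S (-p.1.1) p.1.2) := by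
      change (S.freq (-p.1.1) p.1.2 / 2 : ℂ) • _ = _
      rw [hS.freq_neg]
      rfl
    have h5 := hS.dxOp_mul_xOp p.1 p.1
    rw [if_pos rfl] at h5
    rw [h4]
    exact normal_ordering (A := Module.End ℂ (Wave N L)) h5 (dxOp_comm _ _ _ _) h1 h2 h3
  simp only [h, Finset.sum_add_distrib, ← Finset.smul_sum, hF, hS.phononHamiltonian_eq hK]
  module

theorem commutation_relations (hS : IsNormalModes C K S) (p p' : S.Mode) :
    ⁅annihilation C S p, annihilation C S p'⁆ = 0 ∧ ⁅creation C S p, creation C S p'⁆ = 0 ∧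
      ⁅annihilation C S p, creation C S p'⁆ = if p = p' then 1 else 0 := by
  have h := ladder_commutators (A := Module.End ℂ (Wave N L)) (σ := negMode)
    (X := fun p : Momentum L × Branch N => xOp C S p.1 p.2) (D := fun p => dxOp C S p.1 p.2)
    (r := fun p => (Real.sqrt (S.omega p / 2) : ℂ))
    (k := fun p => ((1 / Real.sqrt (2 * S.omega p) : ℝ) : ℂ)) negMode_involutive
    (fun i j => xOp_comm _ _ _ _) (fun i j => dxOp_comm _ _ _ _)
    hS.dxOp_mul_xOp (fun i => by rw [hS.omega_neg]) (fun i => by rw [hS.omega_neg]) p.1 p'.1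
    (sqrt_freq_coeff (hS.freq_pos p)).2.2
  refine ⟨h.1, h.2.1, ?_⟩
  simp only [Subtype.ext_iff]
  exact h.2.2

end IsNormalModes
end Phonon

namespace Phonon

/-! ### Fock states of a representation of the canonical commutation relations -/

section Fock

variable {V ι : Type*} [AddCommMonoid V] [Module ℂ V]

/-- The product of the powers `c p ^ n p`, in the order of the list. -/
def listWord (c : ι → Module.End ℂ V) (l : List ι) (n : ι → ℕ) : Module.End ℂ V :=
  (l.map fun p => c p ^ n p).prod

variable {a c : ι → Module.End ℂ V}

variable [DecidableEq ι]

theorem listWord_add_single_of_notMem {l : List ι} {p : ι} (hp : p ∉ l) (n : ι → ℕ) :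
    listWord c l (n + Pi.single p 1) = listWord c l n := by
  rw [listWord, listWord]
  congr 1
  refine List.map_congr_left fun q hq => ?_
  have : q ≠ p := fun h => hp (h ▸ hq)
  simp [this]

theorem listWord_add_single (hc : ∀ i j, c i * c j = c j * c i) {l : List ι} (hl : l.Nodup)
    {p : ι} (hp : p ∈ l) (n : ι → ℕ) :
    listWord c l (n + Pi.single p 1) = c p * listWord c l n := by
  induction l with
  | nil => simp at hp
  | cons q l ih =>
    have hcons : ∀ m, listWord c (q :: l) m = c q ^ m q * listWord c l m := fun m => by
      simp [listWord]
    rw [List.nodup_cons] at hl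
    rw [hcons, hcons]
    by_cases hpq : p = q
    · subst hpq
      rw [listWord_add_single_of_notMem hl.1]
      simp [pow_succ', mul_assoc]
    · rw [ih hl.2 ((List.mem_cons.1 hp).resolve_left hpq)]
      have h1 : (n + (Pi.single p 1 : ι → ℕ)) q = n q := by simp [Ne.symm hpq]
      have h2 : c q ^ n q * c p = c p * c q ^ n q := (Commute.pow_left (hc q p) _)
      rw [h1, ← mul_assoc, h2, mul_assoc]

theorem listWord_commute_of_eq_zero (hac : ∀ i j, i ≠ j → a i * c j = c j * a i) (l : List ι)
    {n : ι → ℕ} {p : ι} (hp : n p = 0) : Commute (a p) (listWord c l n) := by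
  refine Commute.list_prod_right _ _ fun x hx => ?_
  obtain ⟨q, -, rfl⟩ := List.mem_map.1 hx
  by_cases hpq : p = q
  · subst hpq
    rw [hp, pow_zero]
    exact Commute.one_right _
  · exact Commute.pow_right (hac p q hpq) _

/-- Induction on the occupation of mode `p`: one creation operator is pulled to the front, and
commuting `a p` past it adds one copy of the remaining state. For `n p = 0` the truncated
subtraction is harmless, because the coefficient vanishes. -/
theorem annihilate_listWord {Ω : V} (hc : ∀ i j, c i * c j = c j * c i)
    (hac : ∀ i j, a i * c j = c j * a i + if i = j then 1 else 0) (hΩ : ∀ i, a i Ω = 0)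
    {l : List ι} (hl : l.Nodup) {p : ι} (hp : p ∈ l) (n : ι → ℕ) :
    a p (listWord c l n Ω) = (n p : ℂ) • listWord c l (n - Pi.single p 1) Ω := by
  obtain ⟨k, hk⟩ : ∃ k, n p = k := ⟨_, rfl⟩
  induction k generalizing n with
  | zero =>
    have h := listWord_commute_of_eq_zero (a := a) (c := c)
      (fun i j hij => by rw [hac, if_neg hij, add_zero]) l hk
    have h' := congrArg (fun T : Module.End ℂ V => T Ω) h.eq
    simp only [Module.End.mul_apply, hΩ, map_zero] at h'
    rw [h', hk]
    simp
  | succ k ih =>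
    set m := n - Pi.single p 1 with hm
    have hmp : m p = k := by simp [hm, hk]
    have hn : n = m + Pi.single p 1 := by
      funext q
      by_cases hq : q = p
      · subst hq; simp [hmp, hk]
      · simp [hm, hq]
    have h1 : a p (listWord c l n Ω) = c p (a p (listWord c l m Ω)) + listWord c l m Ω := by
      rw [hn, listWord_add_single hc hl hp, Module.End.mul_apply]
      have h' := congrArg (fun T : Module.End ℂ V => T (listWord c l m Ω)) (hac p p)
      simpa using h'
    rw [h1, ih m hmp, map_smul, ← Module.End.mul_apply, ← listWord_add_single hc hl hp, hk, hmp]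
    rcases Nat.eq_zero_or_pos k with rfl | hk0
    · simp
    · have h2 : m - Pi.single p 1 + Pi.single p 1 = m := by
        funext q
        by_cases hq : q = p
        · subst hq; simp only [Pi.add_apply, Pi.sub_apply, Pi.single_eq_same]; omega
        · simp [hq]
      rw [h2]
      push_cast
      rw [add_smul, one_smul]

theorem number_listWord {Ω : V} (hc : ∀ i j, c i * c j = c j * c i)
    (hac : ∀ i j, a i * c j = c j * a i + if i = j then 1 else 0) (hΩ : ∀ i, a i Ω = 0)
    {l : List ι} (hl : l.Nodup) {p : ι} (hp : p ∈ l) (n : ι → ℕ) :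
    c p (a p (listWord c l n Ω)) = (n p : ℂ) • listWord c l n Ω := by
  rw [annihilate_listWord hc hac hΩ hl hp, map_smul, ← Module.End.mul_apply,
    ← listWord_add_single hc hl hp]
  rcases Nat.eq_zero_or_pos (n p) with h0 | h0
  · simp [h0]
  · congr 3
    funext q
    by_cases hq : q = p
    · subst hq; simp only [Pi.add_apply, Pi.sub_apply, Pi.single_eq_same]; omega
    · simp [hq]

/-- Lowering an occupied mode gives a non-zero multiple of a state with one quantum fewer, which is
non-zero by induction on the total number of quanta. No inner product is involved. -/
theorem listWord_ne_zero [Fintype ι] {Ω : V} (hc : ∀ i j, c i * c j = c j * c i)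
    (hac : ∀ i j, a i * c j = c j * a i + if i = j then 1 else 0) (hΩ : ∀ i, a i Ω = 0)
    (hΩ0 : Ω ≠ 0) {l : List ι} (hl : l.Nodup) (hp : ∀ p, p ∈ l) (n : ι → ℕ) :
    listWord c l n Ω ≠ 0 := by
  obtain ⟨k, hk⟩ : ∃ k, ∑ p, n p = k := ⟨_, rfl⟩
  induction k generalizing n with
  | zero =>
    have h0 : ∀ p, n p = 0 := by simpa using hk
    simpa [listWord, h0] using hΩ0
  | succ k ih =>
    obtain ⟨p, hnp⟩ : ∃ p, n p ≠ 0 := by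
      by_contra! h
      simp [h] at hk
    have hn : n = n - Pi.single p 1 + Pi.single p 1 := by
      funext q
      by_cases hq : q = p
      · subst hq; simp only [Pi.add_apply, Pi.sub_apply, Pi.single_eq_same]; omega
      · simp [hq]
    have hk' : ∑ q, (n - (Pi.single p 1 : ι → ℕ)) q = k := by
      have h : ∑ q, (n - (Pi.single p 1 : ι → ℕ) + (Pi.single p 1 : ι → ℕ)) q = k + 1 := by
        rw [← hn, hk]
      simp only [Pi.add_apply, Finset.sum_add_distrib, Finset.sum_pi_single', Finset.mem_univ,
        if_true] at h
      omega
    intro h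
    have h1 := annihilate_listWord hc hac hΩ hl (hp p) n
    rw [h, map_zero] at h1
    exact ih _ hk' ((IsUnit.mk0 (n p : ℂ) (Nat.cast_ne_zero.2 hnp)).smul_eq_zero.1 h1.symm)

end Fock

/-! ### Operators with a complete set of eigenvectors -/

section Spectral

variable {E ι : Type*} [NormedAddCommGroup E] [InnerProductSpace ℂ E]

/-- The graph of the operator which is diagonal in the basis `b`, with eigenvalues `w`. -/
def diagGraph (b : HilbertBasis ι ℂ E) (w : ι → ℝ) : Submodule ℂ (E × E) where
  carrier := {x | ∀ i, inner ℂ (b i) x.2 = (w i : ℂ) * inner ℂ (b i) x.1}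
  add_mem' hx hy i := by
    simp only [Prod.snd_add, Prod.fst_add, inner_add_right, hx i, hy i, mul_add]
  zero_mem' i := by simp
  smul_mem' c x hx i := by
    simp only [Prod.smul_snd, Prod.smul_fst, inner_smul_right, hx i]
    ring

variable {b : HilbertBasis ι ℂ E} {w : ι → ℝ} {A : E →ₗ.[ℂ] E}

theorem HilbertBasis.ext_inner (b : HilbertBasis ι ℂ E) {x y : E}
    (h : ∀ i, inner ℂ (b i) x = inner ℂ (b i) y) : x = y := by
  apply b.repr.injective
  ext i
  rw [b.repr_apply_apply, b.repr_apply_apply, h]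

theorem mem_diagGraph_basis (i : ι) : (b i, (w i : ℂ) • b i) ∈ diagGraph b w := by
  classical
  intro j
  rw [inner_smul_right]
  by_cases h : i = j
  · rw [h]
  · have := b.orthonormal.2 (Ne.symm h)
    simp [this]

theorem isClosed_diagGraph : IsClosed (diagGraph b w : Set (E × E)) := by
  have : (diagGraph b w : Set (E × E)) =
      ⋂ i, {x | inner ℂ (b i) x.2 = (w i : ℂ) * inner ℂ (b i) x.1} := by
    ext x; simp [diagGraph]
  rw [this]
  exact isClosed_iInter fun i => isClosed_eq (by fun_prop) (by fun_prop)

/-- Pairing with the eigenvectors `b i` puts the graph of a symmetric operator inside the closed set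
`diagGraph b w`. Conversely, if `(f, g)` lies there, the partial sums of both expansions run through
the graph and converge to `(f, g)` simultaneously. -/
theorem topologicalClosure_graph (hA : A.IsFormalAdjoint A)
    (hb : ∀ i, (b i, (w i : ℂ) • b i) ∈ A.graph) :
    A.graph.topologicalClosure = diagGraph b w := by
  refine le_antisymm (Submodule.topologicalClosure_minimal _ ?_ isClosed_diagGraph) ?_
  · rintro ⟨f, g⟩ hfg i
    obtain ⟨x, rfl, rfl⟩ := (LinearPMap.mem_graph_iff A).1 hfg
    obtain ⟨y, hy, hy'⟩ := (LinearPMap.mem_graph_iff A).1 (hb i)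
    dsimp only at hy hy'
    have := hA y x
    rw [hy', hy, inner_smul_left, Complex.conj_ofReal] at this
    exact this.symm
  · rintro ⟨f, g⟩ hfg
    have hf := b.hasSum_repr f
    have hg := b.hasSum_repr g
    simp only [b.repr_apply_apply] at hf hg
    have h := hf.prodMk hg
    refine mem_closure_of_tendsto h (Filter.Eventually.of_forall fun s => ?_)
    refine Submodule.sum_mem _ fun i _ => ?_
    have h1 : inner ℂ (b i) g = (w i : ℂ) * inner ℂ (b i) f := hfg i
    have h2 := A.graph.smul_mem (inner ℂ (b i) f) (hb i)
    rw [h1]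
    convert h2 using 1
    rw [Prod.smul_mk, smul_smul, mul_comm]

theorem graph_closure (hA : A.IsFormalAdjoint A)
    (hb : ∀ i, (b i, (w i : ℂ) • b i) ∈ A.graph) : A.closure.graph = diagGraph b w := by
  have h : A.IsClosable := by
    -- Closability: a pair `(0, g)` in the diagonal graph has all coefficients of `g` equal to zero.
    refine ⟨(diagGraph b w).toLinearPMap, ?_⟩
    rw [topologicalClosure_graph hA hb, Submodule.toLinearPMap_graph_eq]
    rintro ⟨f, g⟩ hfg (rfl : f = 0)
    refine HilbertBasis.ext_inner b fun i => ?_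
    have := hfg i
    simpa using this
  rw [← h.graph_closure_eq_closure_graph, topologicalClosure_graph hA hb]

/-- Testing the adjoint relation on the eigenvectors forces the diagonal form. Conversely,
Parseval's identity and the reality of the eigenvalues show that every diagonal pair satisfies it,
so the adjoint has the same graph. -/
theorem isSelfAdjoint_closure [CompleteSpace E] (hA : A.IsFormalAdjoint A)
    (hb : ∀ i, (b i, (w i : ℂ) • b i) ∈ A.graph) : IsSelfAdjoint A.closure := by
  have hG := graph_closure hA hb
  have hdense : Dense (A.closure.domain : Set E) := by
    have h1 : Submodule.span ℂ (Set.range b) ≤ A.closure.domain := by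
      rw [Submodule.span_le]
      rintro _ ⟨i, rfl⟩
      have h2 : (b i, (w i : ℂ) • b i) ∈ A.closure.graph := by
        rw [hG]; exact mem_diagGraph_basis i
      exact LinearPMap.mem_domain_of_mem_graph h2
    rw [Submodule.dense_iff_topologicalClosure_eq_top, ← top_le_iff, ← b.dense_span]
    exact Submodule.topologicalClosure_mono h1
  rw [LinearPMap.isSelfAdjoint_def]
  refine LinearPMap.eq_of_eq_graph ?_
  rw [LinearPMap.adjoint_graph_eq_graph_adjoint hdense, hG]
  ext ⟨x, y⟩
  rw [Submodule.mem_adjoint_iff]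
  constructor
  · intro h i
    have h1 := h _ _ (mem_diagGraph_basis (b := b) (w := w) i)
    rw [inner_smul_left, Complex.conj_ofReal, sub_eq_zero] at h1
    exact h1.symm
  · intro h f g hfg
    rw [← b.tsum_inner_mul_inner g x, ← b.tsum_inner_mul_inner f y, sub_eq_zero]
    refine tsum_congr fun i => ?_
    have h1 : inner ℂ (b i) g = (w i : ℂ) * inner ℂ (b i) f := hfg i
    have h2 : inner ℂ (b i) y = (w i : ℂ) * inner ℂ (b i) x := h i
    rw [← inner_conj_symm g, ← inner_conj_symm f, h1, h2, map_mul, Complex.conj_ofReal]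
    ring

theorem exists_diagonal (b : HilbertBasis ι ℂ E) (d : ι → ℂ) (c : ℝ) (hd : ∀ i, ‖d i‖ ≤ c) :
    ∃ T : E →L[ℂ] E, ∀ f i, inner ℂ (b i) (T f) = d i * inner ℂ (b i) f := by
  have hle : ∀ (x : lp (fun _ : ι => ℂ) 2) i, ‖d i * x i‖ ≤ ‖((c : ℂ) • x) i‖ := by
    intro x i
    have h1 : ‖((c : ℂ) • x) i‖ = |c| * ‖x i‖ := by
      rw [lp.coeFn_smul, Pi.smul_apply, norm_smul, Complex.norm_real, Real.norm_eq_abs]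
    rw [h1, norm_mul]
    exact mul_le_mul_of_nonneg_right ((hd i).trans (le_abs_self c)) (norm_nonneg _)
  let L : lp (fun _ : ι => ℂ) 2 →ₗ[ℂ] lp (fun _ : ι => ℂ) 2 :=
    { toFun := fun x => ⟨fun i => d i * x i, (lp.memℓp ((c : ℂ) • x)).mono' (hle x)⟩
      map_add' := fun x y => by ext i; simp only [lp.coeFn_add, Pi.add_apply, mul_add]
      map_smul' := fun a x => by ext i; simp; ring }
  -- The absolute value covers an empty index set, where the bound `c` may be negative.
  have hL : ∀ x, ‖L x‖ ≤ |c| * ‖x‖ := by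
    intro x
    refine (lp.norm_mono (p := 2) (by norm_num) (x := L x) (y := (c : ℂ) • x) (hle x)).trans ?_
    rw [norm_smul]
    simp
  refine ⟨(b.repr.symm.toContinuousLinearEquiv : _ →L[ℂ] E) ∘L (L.mkContinuous |c| hL) ∘L
    (b.repr.toContinuousLinearEquiv : E →L[ℂ] _), fun f i => ?_⟩
  rw [← b.repr_apply_apply, ← b.repr_apply_apply]
  simp [L]

theorem eq_smul_of_closure_eq {i₀ : ι} (hA : A.IsFormalAdjoint A)
    (hb : ∀ i, (b i, (w i : ℂ) • b i) ∈ A.graph) (hi : ∀ i, i ≠ i₀ → w i ≠ w i₀)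
    (f : A.closure.domain) (hf : A.closure f = (w i₀ : ℂ) • (f : E)) :
    (f : E) = inner ℂ (b i₀) (f : E) • b i₀ := by
  classical
  have h : ((f : E), A.closure f) ∈ diagGraph b w := by
    rw [← graph_closure hA hb]
    exact A.closure.mem_graph f
  refine HilbertBasis.ext_inner b fun i => ?_
  have h1 := h i
  simp only [hf, inner_smul_right] at h1
  rw [inner_smul_right, orthonormal_iff_ite.1 b.orthonormal]
  by_cases hii : i = i₀
  · simp [hii]
  · rw [if_neg hii, mul_zero]
    have h2 : ((w i : ℂ) - w i₀) * inner ℂ (b i) (f : E) = 0 := by rw [sub_mul, h1, sub_self]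
    refine (mul_eq_zero.1 h2).resolve_left (sub_ne_zero.2 fun h3 => hi i hii ?_)
    exact_mod_cast h3

/-- At positive distance `δ` from all eigenvalues, the diagonal operator with entries $(w_i-z)^{-1}$
is bounded by $\delta^{-1}$ and inverts $A-z$. At an eigenvalue, a left inverse would have to send
$0$ to the eigenvector. The hypothesis `hw` excludes accumulation of eigenvalues at other points. -/
theorem unboundedSpectrum_closure (hA : A.IsFormalAdjoint A)
    (hb : ∀ i, (b i, (w i : ℂ) • b i) ∈ A.graph)
    (hw : ∀ z : ℂ, z ∉ Set.range (fun i => (w i : ℂ)) → ∃ δ > 0, ∀ i, δ ≤ ‖(w i : ℂ) - z‖) :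
    unboundedSpectrum A.closure = Set.range fun i => (w i : ℂ) := by
  have hG := graph_closure hA hb
  ext z
  constructor
  · intro hz
    by_contra hzw
    obtain ⟨δ, hδ, hδw⟩ := hw z hzw
    obtain ⟨T, hT⟩ := exists_diagonal b (fun i => ((w i : ℂ) - z)⁻¹) δ⁻¹ fun i => by
      rw [norm_inv]
      exact inv_anti₀ hδ (hδw i)
    have hne : ∀ i, (w i : ℂ) - z ≠ 0 := fun i h => hzw ⟨i, sub_eq_zero.1 h⟩
    refine hz ⟨T, fun f => ?_, fun f => ?_⟩
    · have h1 : (T f, f + z • T f) ∈ A.closure.graph := by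
        rw [hG]
        intro i
        simp only [inner_add_right, inner_smul_right, hT]
        have := hne i
        field_simp
        ring
      obtain ⟨y, hy1, hy2⟩ := (LinearPMap.mem_graph_iff _).1 h1
      have hmem := LinearPMap.mem_domain_of_mem_graph h1
      refine ⟨hmem, ?_⟩
      have : y = ⟨T f, hmem⟩ := Subtype.ext hy1
      rw [← this, hy2]
      simp
    · have h1 : ((f : E), A.closure f) ∈ diagGraph b w := by
        rw [← hG]
        exact A.closure.mem_graph f
      refine HilbertBasis.ext_inner b fun i => ?_
      have h2 := h1 i
      dsimp only at h2
      rw [hT, inner_sub_right, inner_smul_right, h2, ← sub_mul, inv_mul_cancel_left₀ (hne i)]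
  · rintro ⟨i, rfl⟩ ⟨T, -, hT⟩
    have h1 : (b i, (w i : ℂ) • b i) ∈ A.closure.graph := by
      rw [hG]; exact mem_diagGraph_basis i
    obtain ⟨y, hy1, hy2⟩ := (LinearPMap.mem_graph_iff _).1 h1
    have h2 := hT y
    dsimp only at hy1 hy2 h2
    rw [hy2, hy1, sub_self, map_zero] at h2
    exact b.orthonormal.ne_zero i h2.symm

end Spectral
end Phonon

namespace Phonon

/-! ### Gaussians -/

/-- The exponential series bounds $(1+t)^m$ by $m!\,e^{1+t}$, and $1+t-t^2/2=\frac32-\frac12(t-1)^2$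
gives the constant. -/
theorem one_add_pow_mul_exp_le (m : ℕ) {t : ℝ} (ht : 0 ≤ t) :
    (1 + t) ^ m * Real.exp (-(t ^ 2 / 2)) ≤ m.factorial * Real.exp (3 / 2) := by
  have h1 : (1 + t) ^ m ≤ m.factorial * Real.exp (1 + t) := by
    have := Real.pow_div_factorial_le_exp (1 + t) (by positivity) m
    rwa [div_le_iff₀' (by positivity)] at this
  have h2 : Real.exp (1 + t) * Real.exp (-(t ^ 2 / 2)) ≤ Real.exp (3 / 2) := by
    rw [← Real.exp_add, Real.exp_le_exp]
    nlinarith [sq_nonneg (t - 1)]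
  calc (1 + t) ^ m * Real.exp (-(t ^ 2 / 2))
      ≤ (m.factorial * Real.exp (1 + t)) * Real.exp (-(t ^ 2 / 2)) := by gcongr
    _ = m.factorial * (Real.exp (1 + t) * Real.exp (-(t ^ 2 / 2))) := by ring
    _ ≤ _ := by gcongr

/-- The standard Gaussian as a Schwartz function. -/
def gaussianSchwartz (F : Type*) [NormedAddCommGroup F] [InnerProductSpace ℝ F] :
    SchwartzMap F ℂ where
  toFun v := ((Real.exp (-(‖v‖ ^ 2 / 2)) : ℝ) : ℂ)
  smooth' := Complex.ofRealCLM.contDiff.comp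
    (Real.contDiff_exp.comp (((contDiff_norm_sq ℝ).div_const 2).neg))
  decay' k n := by
    obtain ⟨l, C, hC, h⟩ := (Function.hasTemperateGrowth_norm_sq
      (H := F)).norm_iteratedFDeriv_le_uniform n
    refine ⟨n.factorial * (1 + C) ^ n * ((k + l * n).factorial * Real.exp (3 / 2)), fun v => ?_⟩
    -- The Gaussian is `g` composed with $\|v\|^2$. Derivatives of `g` carry powers of $-\frac12$,
    -- so they are bounded by the Gaussian itself; derivatives of $\|v\|^2$ grow polynomially, and
    -- the bound for iterated derivatives of a composition combines the two.
    let g : ℝ → ℂ := fun t => ((Real.exp (-(1 / 2) * t) : ℝ) : ℂ)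
    have hg : ContDiff ℝ ∞ g := Complex.ofRealCLM.contDiff.comp
      (Real.contDiff_exp.comp (contDiff_const.mul contDiff_id))
    have hgd : ∀ i ≤ n, ‖iteratedFDeriv ℝ i g (‖v‖ ^ 2)‖ ≤ Real.exp (-(‖v‖ ^ 2 / 2)) := by
      intro i _
      have h1 : ‖iteratedFDeriv ℝ i g (‖v‖ ^ 2)‖ =
          ‖iteratedFDeriv ℝ i (fun t : ℝ => Real.exp (-(1 / 2) * t)) (‖v‖ ^ 2)‖ :=
        Complex.ofRealLI.norm_iteratedFDeriv_comp_left (n := ∞)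
          (Real.contDiff_exp.comp (contDiff_const.mul contDiff_id)).contDiffAt
          (by exact_mod_cast le_top)
      rw [h1, norm_iteratedFDeriv_eq_norm_iteratedDeriv, iteratedDeriv_exp_const_mul]
      rw [norm_mul, norm_pow, Real.norm_of_nonneg (Real.exp_pos _).le]
      have h2 : ‖(-(1 / 2) : ℝ)‖ ^ i ≤ 1 := pow_le_one₀ (norm_nonneg _) (by norm_num)
      calc _ ≤ 1 * Real.exp (-(1 / 2) * ‖v‖ ^ 2) := by gcongr
        _ = _ := by rw [one_mul]; congr 1; ring
    have hfg : (fun v : F => ((Real.exp (-(‖v‖ ^ 2 / 2)) : ℝ) : ℂ)) =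
        g ∘ fun v : F => ‖v‖ ^ 2 := by
      funext v
      simp only [g, Function.comp_apply]
      congr 2; ring
    have hD : ∀ i, 1 ≤ i → i ≤ n → ‖iteratedFDeriv ℝ i (fun v : F => ‖v‖ ^ 2) v‖ ≤
        ((1 + C) * (1 + ‖v‖) ^ l) ^ i := by
      intro i hi hin
      -- The constant is enlarged from `C` to `1 + C` so that the base is at least 1 and may be
      -- raised to the power `i`, as the composition bound requires.
      have h1 : 1 ≤ (1 + C) * (1 + ‖v‖) ^ l :=
        one_le_mul_of_one_le_of_one_le (by linarith) (one_le_pow₀ (by linarith [norm_nonneg v]))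
      calc _ ≤ C * (1 + ‖v‖) ^ l := h i hin v
        _ ≤ (1 + C) * (1 + ‖v‖) ^ l := by gcongr; linarith
        _ ≤ _ := le_self_pow₀ h1 (by omega)
    have key := norm_iteratedFDeriv_comp_le (n := n) hg (contDiff_norm_sq ℝ)
      (by exact_mod_cast le_top) v hgd hD
    rw [hfg]
    calc ‖v‖ ^ k * ‖iteratedFDeriv ℝ n (g ∘ fun v : F => ‖v‖ ^ 2) v‖
        ≤ (1 + ‖v‖) ^ k * (n.factorial * Real.exp (-(‖v‖ ^ 2 / 2)) *
            ((1 + C) * (1 + ‖v‖) ^ l) ^ n) := by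
          gcongr
          linarith
      _ = n.factorial * (1 + C) ^ n * ((1 + ‖v‖) ^ (k + l * n) * Real.exp (-(‖v‖ ^ 2 / 2))) := by
          rw [mul_pow, ← pow_mul, pow_add]; ring
      _ ≤ _ := mul_le_mul_of_nonneg_left (one_add_pow_mul_exp_le _ (norm_nonneg v)) (by positivity)

theorem gaussianSchwartz_apply {F : Type*} [NormedAddCommGroup F] [InnerProductSpace ℝ F] (v : F) :
    gaussianSchwartz F v = ((Real.exp (-(‖v‖ ^ 2 / 2)) : ℝ) : ℂ) := rfl

/-! ### Density of polynomials times a Gaussian -/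

section Density

open MeasureTheory FourierTransform

variable {E : Type*} [NormedAddCommGroup E] [InnerProductSpace ℝ E] [FiniteDimensional ℝ E]
  [MeasurableSpace E] [BorelSpace E]

/-- Every test function is the Fourier transform of a Schwartz function, and self-adjointness of the
Fourier integral moves the transform onto `h`, where it vanishes. -/
theorem ae_eq_zero_of_fourier_eq_zero {h : E → ℂ} (hh : Integrable h) (h0 : ∀ ξ, 𝓕 h ξ = 0) :
    ∀ᵐ x, h x = 0 := by
  refine ae_eq_zero_of_integral_contDiff_smul_eq_zero hh.locallyIntegrable fun g hg hgs => ?_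
  have hgs' : HasCompactSupport fun x => (g x : ℂ) := hgs.comp_left Complex.ofReal_zero
  have hg' : ContDiff ℝ ∞ fun x => (g x : ℂ) := Complex.ofRealCLM.contDiff.comp hg
  let φ : SchwartzMap E ℂ := 𝓕⁻ (hgs'.toSchwartzMap hg')
  have h1 : ∀ x, (𝓕 (φ : E → ℂ) : E → ℂ) x = (g x : ℂ) := by
    intro x
    rw [← SchwartzMap.fourier_coe]
    simp [φ]
  have h2 := VectorFourier.integral_fourierIntegral_smul_eq_flip (L := innerₗ E)
    (μ := volume) (ν := volume) Real.continuous_fourierChar continuous_inner hh φ.integrable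
  have h3 : ∫ x, h x • (𝓕 (φ : E → ℂ) : E → ℂ) x = 0 := by
    have h4 : ∀ ξ, VectorFourier.fourierIntegral Real.fourierChar volume (innerₗ E) h ξ = 0 := h0
    simp only [h4, zero_smul, integral_zero, flip_innerₗ] at h2
    exact h2.symm
  rw [← h3]
  refine integral_congr_ae (Filter.Eventually.of_forall fun x => ?_)
  simp [h1, mul_comm]

theorem exp_mul_gaussian_le {a : ℝ} (ha : 0 < a) (c t : ℝ) :
    Real.exp (c * t) * Real.exp (-a * t ^ 2) ≤
      Real.exp (c ^ 2 / (2 * a)) * Real.exp (-(a / 2) * t ^ 2) := by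
  rw [← Real.exp_add, ← Real.exp_add, Real.exp_le_exp]
  have h : 0 ≤ (a * t - c) ^ 2 / (2 * a) := by positivity
  have h2 : (a * t - c) ^ 2 / (2 * a) = a / 2 * t ^ 2 - c * t + c ^ 2 / (2 * a) := by
    field_simp; ring
  linarith

theorem memLp_gaussian {a : ℝ} (ha : 0 < a) :
    MemLp (fun v : E => Real.exp (-a * ‖v‖ ^ 2)) 2 := by
  have hc : Continuous fun v : E => Real.exp (-a * ‖v‖ ^ 2) := by fun_prop
  rw [memLp_two_iff_integrable_sq hc.aestronglyMeasurable]
  have h := (GaussianFourier.integrable_cexp_neg_mul_sq_norm_add (V := E) (b := ((2 * a : ℝ) : ℂ))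
    (by simpa using ha) 0 0).norm
  refine h.congr (Filter.Eventually.of_forall fun v => ?_)
  simp only [Complex.norm_exp]
  rw [← Real.exp_nat_mul]
  congr 1
  simp [← Complex.ofReal_pow]
  ring

/-- Half of the Gaussian exponent absorbs the factor $e^{c\|v\|}$; the other half is still square
integrable and pairs with `f`. -/
theorem integrable_exp_mul_gaussian {f G : E → ℂ} (hf : MemLp f 2) (hGc : Continuous G) {a : ℝ}
    (ha : 0 < a) (hG : ∀ v, ‖G v‖ ≤ Real.exp (-a * ‖v‖ ^ 2)) (c : ℝ) :
    Integrable fun v => Real.exp (c * ‖v‖) * ‖f v * G v‖ := by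
  have h1 : MemLp (fun v : E => Real.exp (c ^ 2 / (2 * a)) * Real.exp (-(a / 2) * ‖v‖ ^ 2)) 2 :=
    (memLp_gaussian (half_pos ha)).const_mul _
  have h2 := hf.norm.integrable_mul h1
  refine h2.mono' ?_ (Filter.Eventually.of_forall fun v => ?_)
  · have hc : Continuous fun v : E => Real.exp (c * ‖v‖) := by fun_prop
    exact hc.aestronglyMeasurable.mul
      (hf.aestronglyMeasurable.mul hGc.aestronglyMeasurable).norm
  · rw [Real.norm_of_nonneg (by positivity), norm_mul]
    calc Real.exp (c * ‖v‖) * (‖f v‖ * ‖G v‖)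
        ≤ Real.exp (c * ‖v‖) * (‖f v‖ * Real.exp (-a * ‖v‖ ^ 2)) := by gcongr; exact hG v
      _ = ‖f v‖ * (Real.exp (c * ‖v‖) * Real.exp (-a * ‖v‖ ^ 2)) := by ring
      _ ≤ ‖f v‖ * (Real.exp (c ^ 2 / (2 * a)) * Real.exp (-(a / 2) * ‖v‖ ^ 2)) :=
        mul_le_mul_of_nonneg_left (exp_mul_gaussian_le ha c _) (norm_nonneg _)

/-- Expanding the Fourier character in powers of $\langle v,\xi\rangle$ expresses the transform of
$fG$ through its moments, which vanish. The exchange of sum and integral is dominated by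
$e^{2\pi\|\xi\|\|v\|}|fG|$, integrable because of the Gaussian decay. Since `G` has no zeros, `f`
itself vanishes almost everywhere. -/
theorem ae_eq_zero_of_gaussian_moments {f G : E → ℂ} (hf : MemLp f 2) (hGc : Continuous G)
    (hG0 : ∀ v, G v ≠ 0) {a : ℝ} (ha : 0 < a) (hG : ∀ v, ‖G v‖ ≤ Real.exp (-a * ‖v‖ ^ 2))
    (hm : ∀ (ξ : E) (k : ℕ), ∫ v, ((inner ℝ v ξ : ℝ) : ℂ) ^ k * (f v * G v) = 0) :
    ∀ᵐ v, f v = 0 := by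
  have hmeas : AEStronglyMeasurable (fun v => f v * G v) :=
    hf.aestronglyMeasurable.mul hGc.aestronglyMeasurable
  have hint : Integrable fun v => f v * G v := by
    have h := integrable_exp_mul_gaussian hf hGc ha hG 0
    simp only [zero_mul, Real.exp_zero, one_mul] at h
    exact (integrable_norm_iff hmeas).1 h
  have key : ∀ ξ, 𝓕 (fun v => f v * G v) ξ = 0 := by
    intro ξ
    let z : E → ℂ := fun v => ((-2 * Real.pi * inner ℝ v ξ : ℝ) : ℂ) * Complex.I
    have hz : ∀ v, ‖z v‖ ≤ 2 * Real.pi * ‖ξ‖ * ‖v‖ := by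
      intro v
      have h1 := norm_inner_le_norm (𝕜 := ℝ) v ξ
      simp only [z, norm_mul, Complex.norm_I, mul_one, Complex.norm_real, norm_neg,
        Real.norm_of_nonneg Real.pi_pos.le, RCLike.norm_ofNat]
      calc _ ≤ 2 * Real.pi * (‖v‖ * ‖ξ‖) := by gcongr
        _ = _ := by ring
    have hzc : Continuous z := by fun_prop
    have hs := hasSum_integral_of_dominated_convergence (μ := (volume : Measure E))
      (F := fun (k : ℕ) v => z v ^ k / (k.factorial : ℂ) * (f v * G v))
      (f := fun v => Complex.exp (z v) * (f v * G v))
      (fun k v => (2 * Real.pi * ‖ξ‖ * ‖v‖) ^ k / k.factorial * ‖f v * G v‖)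
      (fun k => (by fun_prop : Continuous fun v => z v ^ k / (k.factorial : ℂ)).aestronglyMeasurable.mul
        hmeas)
      (fun k => Filter.Eventually.of_forall fun v => by
        rw [norm_mul, norm_div, norm_pow, Complex.norm_natCast]
        gcongr
        exact hz v)
      (Filter.Eventually.of_forall fun v => (Real.summable_pow_div_factorial _).mul_right _)
      (by
        have h1 : ∀ v : E, ∑' k : ℕ, (2 * Real.pi * ‖ξ‖ * ‖v‖) ^ k / k.factorial * ‖f v * G v‖ =
            Real.exp (2 * Real.pi * ‖ξ‖ * ‖v‖) * ‖f v * G v‖ := by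
          intro v
          rw [tsum_mul_right, Real.exp_eq_exp_ℝ, NormedSpace.exp_eq_tsum_div]
        simp only [h1]
        exact integrable_exp_mul_gaussian hf hGc ha hG _)
      (Filter.Eventually.of_forall fun v => by
        refine HasSum.mul_right _ ?_
        rw [Complex.exp_eq_exp_ℂ]
        exact NormedSpace.expSeries_div_hasSum_exp (z v))
    have h0 : ∀ k : ℕ, ∫ v, z v ^ k / (k.factorial : ℂ) * (f v * G v) = 0 := by
      intro k
      have h1 : ∀ v, z v ^ k / (k.factorial : ℂ) * (f v * G v) =
          (((-2 * Real.pi : ℝ) : ℂ) * Complex.I) ^ k / (k.factorial : ℂ) *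
            (((inner ℝ v ξ : ℝ) : ℂ) ^ k * (f v * G v)) := by
        intro v
        simp only [z]
        push_cast
        ring
      simp only [h1]
      rw [integral_const_mul, hm, mul_zero]
    simp only [h0] at hs
    have h1 := hs.unique hasSum_zero
    rw [Real.fourier_eq', ← h1]
    refine integral_congr_ae (Filter.Eventually.of_forall fun v => ?_)
    simp only [z, smul_eq_mul]
  filter_upwards [ae_eq_zero_of_fourier_eq_zero hint key] with v hv
  exact (mul_eq_zero.1 hv).resolve_right (hG0 v)

end Density

end Phonon

namespace Phonon

variable {N L : ℕ} [NeZero L] {C : Crystal N} {K : Matrix (Site N L) (Site N L) ℝ}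
  {S : ModeData N L}

/-! ### Normal coordinates on the relative displacements -/

theorem normalCoord_add (p : Momentum L × Branch N) (u v : Displ N L) :
    normalCoord C S p.1 p.2 (u + v) = normalCoord C S p.1 p.2 u + normalCoord C S p.1 p.2 v := by
  simp only [normalCoord_eq, PiLp.add_apply, Complex.ofReal_add, mul_add, Finset.sum_add_distrib]

/-- `x_q^α` as a linear map on the relative displacements. -/
def relCoord (C : Crystal N) (S : ModeData N L) (p : Momentum L × Branch N) :
    relDispl C L →ₗ[ℝ] ℂ where
  toFun w := normalCoord C S p.1 p.2 w
  map_add' u v := normalCoord_add _ _ _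
  map_smul' c u := by
    simp only [normalCoord_eq, Submodule.coe_smul, PiLp.smul_apply, smul_eq_mul,
      Complex.ofReal_mul, RingHom.id_apply, Complex.real_smul, Finset.mul_sum]
    exact Finset.sum_congr rfl fun _ _ => by ring

theorem relCoord_apply (p : Momentum L × Branch N) (w : relDispl C L) :
    relCoord C S p w = normalCoord C S p.1 p.2 w := rfl

theorem sum_mass_relDispl (w : relDispl C L) (j : Fin 3) :
    ∑ s : Site N L, (if s.2.2 = j then (C.mu s.2 : ℂ) * (w : Displ N L) s else 0) = 0 := by
  have h := congrArg (fun x : ℝ => (x : ℂ)) (w.2 j)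
  rw [sum_site]
  simp only [Fintype.sum_prod_type, Finset.sum_ite_eq', Finset.mem_univ, if_true, Crystal.mu]
  simpa using h

/-- The real part of `M^{-1/2} e_{qα}`. -/
def modeRe (C : Crystal N) (S : ModeData N L) (p : Momentum L × Branch N) : Displ N L :=
  WithLp.toLp 2 fun s => (modeVec C S p s).re / Real.sqrt (C.mu s.2)

/-- The imaginary part of `M^{-1/2} e_{qα}`. -/
def modeIm (C : Crystal N) (S : ModeData N L) (p : Momentum L × Branch N) : Displ N L :=
  WithLp.toLp 2 fun s => (modeVec C S p s).im / Real.sqrt (C.mu s.2)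

theorem dxOp_apply (p : Momentum L × Branch N) (Ψ : Wave N L) (u : Displ N L) :
    (dxOp C S p.1 p.2 Ψ).1 u =
      fderiv ℝ Ψ.1 u (modeRe C S p) + Complex.I * fderiv ℝ Ψ.1 u (modeIm C S p) := by
  have h : ∀ v : Displ N L, fderiv ℝ Ψ.1 u v =
      ∑ s, (v s : ℂ) * fderiv ℝ Ψ.1 u (EuclideanSpace.single s 1) := by
    intro v
    have hv : v = ∑ s, v s • EuclideanSpace.single s (1 : ℝ) := by
      ext t
      simp [Pi.single_apply]
    conv_lhs => rw [hv]
    rw [map_sum]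
    refine Finset.sum_congr rfl fun s _ => ?_
    rw [map_smul, Complex.real_smul]
  rw [h (modeRe C S p), h (modeIm C S p), dxOp_eq, Finset.mul_sum, ← Finset.sum_add_distrib,
    LinearMap.sum_apply, AddSubmonoidClass.coe_finsetSum, Finset.sum_apply]
  refine Finset.sum_congr rfl fun s _ => ?_
  change (modeVec C S p s / (Real.sqrt (C.mu s.2) : ℂ)) *
    fderiv ℝ Ψ.1 u (EuclideanSpace.single s 1) = _
  simp only [modeRe, modeIm]
  conv_lhs => rw [← Complex.re_add_im (modeVec C S p s)]
  push_cast
  ring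

namespace IsNormalModes

/-- The coordinate of a zero mode is a linear combination of the components of the centre of mass,
which is at the origin. -/
theorem relCoord_eq_zero (hS : IsNormalModes C K S) (hK : IsStableForceMatrix K)
    {p : Momentum L × Branch N} (hp : S.omega p = 0) (w : relDispl C L) :
    relCoord C S p w = 0 := by
  obtain ⟨c, hc⟩ := hS.modeVec_eq_shift hK hp
  have h1 : ∀ s : Site N L, conj (modeVec C S p s) * (Real.sqrt (C.mu s.2) : ℂ) *
      ((w : Displ N L) s : ℂ) = ∑ j, conj (c j) *
        (if s.2.2 = j then (C.mu s.2 : ℂ) * (w : Displ N L) s else 0) := by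
    intro s
    simp only [mul_ite, mul_zero, Finset.sum_ite_eq, Finset.mem_univ, if_true]
    rw [hc, map_mul, Complex.conj_ofReal, ← C.sqrt_mu_mul_self]
    ring
  rw [relCoord_apply, normalCoord_eq]
  simp only [Prod.mk.eta, h1]
  rw [Finset.sum_comm]
  refine Finset.sum_eq_zero fun j _ => ?_
  rw [← Finset.mul_sum, sum_mass_relDispl, mul_zero]

theorem normalCoord_shift (hS : IsNormalModes C K S) (hK : IsStableForceMatrix K)
    {p : Momentum L × Branch N} (hp : S.omega p ≠ 0) (u : Displ N L) (ε : Space) :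
    normalCoord C S p.1 p.2 (u + uniformShift N L ε) = normalCoord C S p.1 p.2 u := by
  rw [normalCoord_add, add_eq_left, normalCoord_eq]
  have h := hS.sum_conj_modeVec_shift hK hp fun j => (ε j : ℂ)
  rw [← h]
  refine Finset.sum_congr rfl fun s _ => ?_
  rw [mul_assoc]
  rfl

theorem sum_modeVec_normalCoord (hS : IsNormalModes C K S) (u : Displ N L) (s : Site N L) :
    ∑ p : Momentum L × Branch N, modeVec C S p s * normalCoord C S p.1 p.2 u =
      Real.sqrt (C.mu s.2) * u s := by
  simp only [normalCoord_eq, Finset.mul_sum]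
  rw [Finset.sum_comm]
  have h : ∀ t : Site N L, ∑ p : Momentum L × Branch N, modeVec C S p s *
      (conj (modeVec C S (p.1, p.2) t) * (Real.sqrt (C.mu t.2) : ℂ) * (u t : ℂ)) =
      (if t = s then 1 else 0) * ((Real.sqrt (C.mu t.2) : ℂ) * (u t : ℂ)) := by
    intro t
    rw [← hS.sum_modeVec', Finset.sum_mul]
    refine Finset.sum_congr rfl fun p _ => ?_
    simp only [Prod.mk.eta]
    ring
  simp only [h]
  simp

/-- The zero-mode coordinates vanish on relative displacements, so the phonon modes alone
reconstruct them. This yields both the non-degeneracy of the ground-state Gaussian and the expansion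
of linear functionals used for completeness. -/
theorem ofReal_apply_eq (hS : IsNormalModes C K S) (hK : IsStableForceMatrix K)
    (w : relDispl C L) (s : Site N L) : (((w : Displ N L) s : ℝ) : ℂ) =
      ∑ p : S.Mode, modeVec C S p.1 s / (Real.sqrt (C.mu s.2) : ℂ) * relCoord C S p.1 w := by
  have h := sum_mode (S := S) fun p =>
    modeVec C S p s / (Real.sqrt (C.mu s.2) : ℂ) * relCoord C S p w
  rw [h]
  have h1 := hS.sum_modeVec_normalCoord (w : Displ N L) s
  have h2 : (((w : Displ N L) s : ℝ) : ℂ) = (∑ p : Momentum L × Branch N,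
      modeVec C S p s * normalCoord C S p.1 p.2 w) / Real.sqrt (C.mu s.2) := by
    rw [h1, mul_div_cancel_left₀ _ (C.sqrt_mu_ne_zero _)]
  rw [h2, Finset.sum_div]
  refine Finset.sum_congr rfl fun p _ => ?_
  split_ifs with hp
  · have h3 := hS.relCoord_eq_zero hK hp w
    rw [relCoord_apply] at h3
    rw [h3]; simp
  · rw [relCoord_apply]; ring

theorem eq_zero_of_relCoord (hS : IsNormalModes C K S) (hK : IsStableForceMatrix K)
    (w : relDispl C L) (h : ∀ p : S.Mode, relCoord C S p.1 w = 0) : w = 0 := by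
  ext s
  have h1 := hS.ofReal_apply_eq hK w s
  simp only [h, mul_zero, Finset.sum_const_zero] at h1
  simpa using h1

/-- Orthogonality of $e_p$ to the vectors $\sqrt{\mu_r}\,c_j$ is the centre-of-mass condition for
$M^{-1/2}e_p$. Hence the derivatives of phonon modes are tangent to the relative displacements. -/
theorem modeRe_mem (hS : IsNormalModes C K S) (hK : IsStableForceMatrix K)
    {p : Momentum L × Branch N} (hp : S.omega p ≠ 0) :
    modeRe C S p ∈ relDispl C L ∧ modeIm C S p ∈ relDispl C L := by
  have key : ∀ j : Fin 3, ∑ R : Cell L, ∑ r : Fin N,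
      (C.mass r : ℂ) * (modeVec C S p (R, (r, j)) / Real.sqrt (C.mu (r, j))) = 0 := by
    intro j
    have h := congrArg conj
      (hS.sum_conj_modeVec_shift hK hp fun i => if i = j then (1 : ℂ) else 0)
    rw [sum_site] at h
    simp only [Fintype.sum_prod_type, mul_ite, mul_one, mul_zero, Finset.sum_ite_eq',
      Finset.mem_univ, if_true, map_sum, map_mul, Complex.conj_conj, Complex.conj_ofReal,
      map_zero] at h
    rw [← h]
    refine Finset.sum_congr rfl fun R _ => Finset.sum_congr rfl fun r _ => ?_
    have h1 := C.sqrt_mu_ne_zero (r, j)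
    have h2 := C.sqrt_mu_mul_self (r, j)
    have h3 : (C.mass r : ℂ) = C.mu (r, j) := rfl
    rw [h3, ← h2]
    field_simp
  constructor
  · intro j
    have h := congrArg Complex.re (key j)
    simpa [modeRe, Complex.re_ofReal_mul, Complex.div_ofReal_re] using h
  · intro j
    have h := congrArg Complex.im (key j)
    simpa [modeIm, Complex.im_ofReal_mul, Complex.div_ofReal_im] using h

/-- `modeRe` as a relative displacement. -/
def relRe (hS : IsNormalModes C K S) (hK : IsStableForceMatrix K)
    {p : Momentum L × Branch N} (hp : S.omega p ≠ 0) : relDispl C L :=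
  ⟨modeRe C S p, (hS.modeRe_mem hK hp).1⟩

/-- `modeIm` as a relative displacement. -/
def relIm (hS : IsNormalModes C K S) (hK : IsStableForceMatrix K)
    {p : Momentum L × Branch N} (hp : S.omega p ≠ 0) : relDispl C L :=
  ⟨modeIm C S p, (hS.modeRe_mem hK hp).2⟩

end IsNormalModes

/-! ### The vibrational states are invariant -/

open LineDeriv in
theorem fderiv_eq_lineDerivOp (Ψ : Wave N L) (f : SchwartzMap (relDispl C L) ℂ)
    (hf : ∀ w, f w = Ψ.1 (w : Displ N L)) (v w : relDispl C L) :
    fderiv ℝ Ψ.1 (w : Displ N L) (v : Displ N L) = (∂_{v} f) w := by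
  rw [SchwartzMap.lineDerivOp_apply_eq_fderiv]
  have h1 : (f : relDispl C L → ℂ) = Ψ.1 ∘ (relDispl C L).subtypeL := funext hf
  rw [h1, fderiv_comp w (differentiable_wave Ψ _) (relDispl C L).subtypeL.differentiableAt,
    ContinuousLinearMap.fderiv]
  rfl

namespace IsNormalModes

open LineDeriv in
theorem dxOp_schwartz (hS : IsNormalModes C K S) (hK : IsStableForceMatrix K)
    {p : Momentum L × Branch N} (hp : S.omega p ≠ 0) (Ψ : Wave N L)
    (f : SchwartzMap (relDispl C L) ℂ) (hf : ∀ w, f w = Ψ.1 (w : Displ N L)) (w : relDispl C L) :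
    (dxOp C S p.1 p.2 Ψ).1 (w : Displ N L) =
      (∂_{hS.relRe hK hp} f) w + Complex.I * (∂_{hS.relIm hK hp} f) w := by
  rw [dxOp_apply, ← fderiv_eq_lineDerivOp Ψ f hf, ← fderiv_eq_lineDerivOp Ψ f hf]
  rfl

open LineDeriv in
theorem dxOp_mem (hS : IsNormalModes C K S) (hK : IsStableForceMatrix K)
    {p : Momentum L × Branch N} (hp : S.omega p ≠ 0) {Ψ : Wave N L} (hΨ : Ψ ∈ vibStates C L) :
    dxOp C S p.1 p.2 Ψ ∈ vibStates C L := by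
  obtain ⟨h, f, hf⟩ := hΨ
  refine ⟨fun u ε => ?_, ∂_{hS.relRe hK hp} f + Complex.I • ∂_{hS.relIm hK hp} f, fun w => ?_⟩
  · have h1 : fderiv ℝ Ψ.1 (u + uniformShift N L ε) = fderiv ℝ Ψ.1 u := by
      rw [← fderiv_comp_add_right]
      congr 1
      exact funext fun v => h v ε
    rw [dxOp_apply, dxOp_apply, h1]
  · rw [hS.dxOp_schwartz hK hp Ψ f hf]
    rfl

theorem xOp_mem (hS : IsNormalModes C K S) (hK : IsStableForceMatrix K)
    {p : Momentum L × Branch N} (hp : S.omega p ≠ 0) {Ψ : Wave N L} (hΨ : Ψ ∈ vibStates C L) :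
    xOp C S p.1 p.2 Ψ ∈ vibStates C L := by
  obtain ⟨h, f, hf⟩ := hΨ
  refine ⟨fun u ε => ?_, SchwartzMap.smulLeftCLM ℂ
    (LinearMap.toContinuousLinearMap (relCoord C S p)) f, fun w => ?_⟩
  · exact congrArg₂ (· * ·) (hS.normalCoord_shift hK hp u ε) (h u ε)
  · rw [SchwartzMap.smulLeftCLM_apply_apply
      (LinearMap.toContinuousLinearMap (relCoord C S p)).hasTemperateGrowth, hf]
    rfl

theorem omega_neg_ne_zero (hS : IsNormalModes C K S) {p : Momentum L × Branch N}
    (hp : S.omega p ≠ 0) : S.omega (negMode p) ≠ 0 := by rwa [hS.omega_neg]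

theorem annihilation_mem (hS : IsNormalModes C K S) (hK : IsStableForceMatrix K) (p : S.Mode)
    {Ψ : Wave N L} (hΨ : Ψ ∈ vibStates C L) : annihilation C S p Ψ ∈ vibStates C L :=
  (vibStates C L).add_mem ((vibStates C L).smul_mem _ (hS.xOp_mem hK p.2 hΨ))
    ((vibStates C L).smul_mem _ (hS.dxOp_mem hK (p := negMode p.1) (hS.omega_neg_ne_zero p.2) hΨ))

theorem creation_mem (hS : IsNormalModes C K S) (hK : IsStableForceMatrix K) (p : S.Mode)
    {Ψ : Wave N L} (hΨ : Ψ ∈ vibStates C L) : creation C S p Ψ ∈ vibStates C L :=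
  (vibStates C L).sub_mem
    ((vibStates C L).smul_mem _ (hS.xOp_mem hK (p := negMode p.1) (hS.omega_neg_ne_zero p.2) hΨ))
    ((vibStates C L).smul_mem _ (hS.dxOp_mem hK p.2 hΨ))

end IsNormalModes

end Phonon

namespace Phonon

variable {N L : ℕ} [NeZero L] {C : Crystal N} {K : Matrix (Site N L) (Site N L) ℝ}
  {S : ModeData N L}

/-! ### Creation and annihilation operators are mutually adjoint -/

/-- The real bilinear map `(z, w) ↦ conj z * w`. -/
def conjMul : ℂ →L[ℝ] ℂ →L[ℝ] ℂ :=
  (ContinuousLinearMap.mul ℝ ℂ).comp (Complex.conjCLE : ℂ →L[ℝ] ℂ)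

theorem integrable_conj_mul_schwartz (f g : SchwartzMap (relDispl C L) ℂ) :
    MeasureTheory.Integrable fun w => conj (f w) * g w :=
  (SchwartzMap.pairing conjMul f g).integrable

theorem integrable_conj_mul {Φ Ψ : Wave N L} (hΦ : Φ ∈ vibStates C L) (hΨ : Ψ ∈ vibStates C L) :
    MeasureTheory.Integrable fun w : relDispl C L => conj (Φ.1 w) * Ψ.1 w := by
  obtain ⟨-, f, hf⟩ := hΦ
  obtain ⟨-, g, hg⟩ := hΨ
  simpa only [hf, hg] using integrable_conj_mul_schwartz f g

open LineDeriv in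
theorem integral_conj_mul_lineDeriv (f g : SchwartzMap (relDispl C L) ℂ) (v : relDispl C L) :
    ∫ w, conj (f w) * (∂_{v} g) w = -∫ w, conj ((∂_{v} f) w) * g w :=
  SchwartzMap.integral_bilinear_lineDerivOp_right_eq_neg_left f g conjMul v

namespace IsNormalModes

theorem modeRe_neg (hS : IsNormalModes C K S) (p : Momentum L × Branch N) :
    modeRe C S (negMode p) = modeRe C S p ∧ modeIm C S (negMode p) = -modeIm C S p := by
  constructor
  · ext s
    simp [modeRe, hS.modeVec_neg]
  · ext s
    simp [modeIm, hS.modeVec_neg, neg_div]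

open LineDeriv in
theorem integral_conj_mul_dxOp (hS : IsNormalModes C K S) (hK : IsStableForceMatrix K)
    {p : Momentum L × Branch N} (hp : S.omega p ≠ 0) {Φ Ψ : Wave N L}
    (hΦ : Φ ∈ vibStates C L) (hΨ : Ψ ∈ vibStates C L) :
    ∫ w : relDispl C L, conj (Φ.1 w) * (dxOp C S (-p.1) p.2 Ψ).1 w =
      -∫ w : relDispl C L, conj ((dxOp C S p.1 p.2 Φ).1 w) * Ψ.1 w := by
  obtain ⟨-, f, hf⟩ := hΦ
  obtain ⟨-, g, hg⟩ := hΨ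
  have hre : hS.relRe hK (hS.omega_neg_ne_zero hp) = hS.relRe hK hp :=
    Subtype.ext (hS.modeRe_neg p).1
  -- Passing to $-q$ reverses the imaginary direction, which matches the conjugation of the factor
  -- $i$ on the other side after integration by parts.
  have him : hS.relIm hK (hS.omega_neg_ne_zero hp) = -hS.relIm hK hp :=
    Subtype.ext (hS.modeRe_neg p).2
  have h1 : ∀ w : relDispl C L, (dxOp C S (-p.1) p.2 Ψ).1 w =
      (∂_{hS.relRe hK hp} g) w - Complex.I * (∂_{hS.relIm hK hp} g) w := by
    intro w
    have h := hS.dxOp_schwartz hK (hS.omega_neg_ne_zero hp) Ψ g hg w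
    have h2 : (∂_{-hS.relIm hK hp} g) w = -(∂_{hS.relIm hK hp} g) w := by
      simp only [SchwartzMap.lineDerivOp_apply_eq_fderiv, map_neg]
    rw [hre, him, h2] at h
    rw [sub_eq_add_neg, ← mul_neg, ← h]
    rfl
  simp only [h1, hS.dxOp_schwartz hK hp Φ f hf, ← hf, ← hg]
  set a := hS.relRe hK hp
  set b := hS.relIm hK hp
  have e1 : ∀ w, conj (f w) * ((∂_{a} g) w - Complex.I * (∂_{b} g) w) =
      conj (f w) * (∂_{a} g) w - Complex.I * (conj (f w) * (∂_{b} g) w) := fun w => by ring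
  have e2 : ∀ w, conj ((∂_{a} f) w + Complex.I * (∂_{b} f) w) * g w =
      conj ((∂_{a} f) w) * g w - Complex.I * (conj ((∂_{b} f) w) * g w) := fun w => by
    rw [map_add, map_mul, Complex.conj_I]; ring
  simp only [e1, e2]
  rw [MeasureTheory.integral_sub (integrable_conj_mul_schwartz _ _)
      ((integrable_conj_mul_schwartz _ _).const_mul _),
    MeasureTheory.integral_sub (integrable_conj_mul_schwartz _ _)
      ((integrable_conj_mul_schwartz _ _).const_mul _),
    MeasureTheory.integral_const_mul, MeasureTheory.integral_const_mul,
    integral_conj_mul_lineDeriv, integral_conj_mul_lineDeriv]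
  ring

/-- Conjugation turns $x_q$ into $x_{-q}$, and integration by parts turns $\partial_{x_{-q}}$ into
$-\partial_{x_q}$; with real coefficients these are the two terms of the creation operator. -/
theorem integral_conj_mul_annihilation (hS : IsNormalModes C K S) (hK : IsStableForceMatrix K)
    (p : S.Mode) {Φ Ψ : Wave N L} (hΦ : Φ ∈ vibStates C L) (hΨ : Ψ ∈ vibStates C L) :
    ∫ w : relDispl C L, conj (Φ.1 w) * (annihilation C S p Ψ).1 w =
      ∫ w : relDispl C L, conj ((creation C S p Φ).1 w) * Ψ.1 w := by
  have e1 : ∀ w : relDispl C L, conj (Φ.1 w) * (annihilation C S p Ψ).1 w =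
      (Real.sqrt (S.freq p.1.1 p.1.2 / 2) : ℂ) * (conj (Φ.1 w) * (xOp C S p.1.1 p.1.2 Ψ).1 w) +
      ((1 / Real.sqrt (2 * S.freq p.1.1 p.1.2) : ℝ) : ℂ) *
        (conj (Φ.1 w) * (dxOp C S (-p.1.1) p.1.2 Ψ).1 w) := fun w => by
    change conj (Φ.1 w) * ((Real.sqrt (S.freq p.1.1 p.1.2 / 2) : ℂ) *
      (xOp C S p.1.1 p.1.2 Ψ).1 w + ((1 / Real.sqrt (2 * S.freq p.1.1 p.1.2) : ℝ) : ℂ) *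
        (dxOp C S (-p.1.1) p.1.2 Ψ).1 w) = _
    ring
  have e2 : ∀ w : relDispl C L, conj ((creation C S p Φ).1 w) * Ψ.1 w =
      (Real.sqrt (S.freq p.1.1 p.1.2 / 2) : ℂ) * (conj (Φ.1 w) * (xOp C S p.1.1 p.1.2 Ψ).1 w) -
      ((1 / Real.sqrt (2 * S.freq p.1.1 p.1.2) : ℝ) : ℂ) *
        (conj ((dxOp C S p.1.1 p.1.2 Φ).1 w) * Ψ.1 w) := fun w => by
    change conj ((Real.sqrt (S.freq p.1.1 p.1.2 / 2) : ℂ) *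
      (normalCoord C S (-p.1.1) p.1.2 w * Φ.1 w) -
        ((1 / Real.sqrt (2 * S.freq p.1.1 p.1.2) : ℝ) : ℂ) *
        (dxOp C S p.1.1 p.1.2 Φ).1 w) * Ψ.1 w = (Real.sqrt (S.freq p.1.1 p.1.2 / 2) : ℂ) *
        (conj (Φ.1 w) * (normalCoord C S p.1.1 p.1.2 w * Ψ.1 w)) - _
    rw [hS.normalCoord_neg]
    simp only [map_sub, map_mul, Complex.conj_conj, Complex.conj_ofReal]
    ring
  have hx := integrable_conj_mul hΦ (hS.xOp_mem hK p.2 hΨ)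
  have hd : MeasureTheory.Integrable fun w : relDispl C L =>
      conj (Φ.1 w) * (dxOp C S (-p.1.1) p.1.2 Ψ).1 w :=
    integrable_conj_mul hΦ (hS.dxOp_mem hK (hS.omega_neg_ne_zero p.2) hΨ)
  have hd' := integrable_conj_mul (hS.dxOp_mem hK p.2 hΦ) hΨ
  simp only [e1, e2]
  rw [MeasureTheory.integral_add (hx.const_mul _) (hd.const_mul _),
    MeasureTheory.integral_sub (hx.const_mul _) (hd'.const_mul _),
    MeasureTheory.integral_const_mul, MeasureTheory.integral_const_mul,
    MeasureTheory.integral_const_mul, hS.integral_conj_mul_dxOp hK p.2 hΦ hΨ]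
  ring

/-! ### The ground state -/

/-- The relative displacements in normal coordinates, scaled by the oscillator lengths. -/
def oscillatorMap (C : Crystal N) (S : ModeData N L) :
    relDispl C L →L[ℝ] EuclideanSpace ℝ (S.Mode ⊕ S.Mode) :=
  LinearMap.toContinuousLinearMap
    { toFun := fun w => WithLp.toLp 2 (Sum.elim
        (fun p => Real.sqrt (S.omega p.1) * (relCoord C S p.1 w).re)
        (fun p => Real.sqrt (S.omega p.1) * (relCoord C S p.1 w).im))
      map_add' := fun v w => by
        ext (p | p) <;> simp [mul_add]
      map_smul' := fun c w => by
        ext (p | p) <;> simp [mul_left_comm] }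

theorem norm_oscillatorMap_sq (hS : IsNormalModes C K S) (w : relDispl C L) :
    ((‖oscillatorMap C S w‖ ^ 2 : ℝ) : ℂ) = ∑ p : S.Mode, (S.freq p.1.1 p.1.2 : ℂ) *
      (normalCoord C S (-p.1.1) p.1.2 w * normalCoord C S p.1.1 p.1.2 w) := by
  have h : ‖oscillatorMap C S w‖ ^ 2 =
      ∑ p : S.Mode, S.omega p.1 * Complex.normSq (relCoord C S p.1 w) := by
    rw [EuclideanSpace.real_norm_sq_eq, Fintype.sum_sum_type, ← Finset.sum_add_distrib]
    refine Finset.sum_congr rfl fun p _ => ?_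
    change (Real.sqrt (S.omega p.1) * (relCoord C S p.1 w).re) ^ 2 +
      (Real.sqrt (S.omega p.1) * (relCoord C S p.1 w).im) ^ 2 = _
    rw [mul_pow, mul_pow, Real.sq_sqrt (show 0 ≤ S.omega p.1 from hS.freq_nonneg _ _),
      Complex.normSq_apply]
    ring
  rw [h, Complex.ofReal_sum]
  refine Finset.sum_congr rfl fun p _ => ?_
  rw [hS.normalCoord_neg, ← Complex.normSq_eq_conj_mul_self, Complex.ofReal_mul]
  rfl

theorem groundState_apply (hS : IsNormalModes C K S) (w : relDispl C L) :
    (groundState C S).1 w = ((Real.exp (-(‖oscillatorMap C S w‖ ^ 2 / 2)) : ℝ) : ℂ) := by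
  change Complex.exp (-(1 / 2) * _) = _
  rw [← hS.norm_oscillatorMap_sq, Complex.ofReal_exp]
  congr 1
  push_cast
  ring

/-- An injective linear map on a finite-dimensional space is bounded below. This makes the pullback
of the standard Gaussian a Schwartz function and gives its explicit decay. -/
theorem exists_antilipschitz_oscillatorMap (hS : IsNormalModes C K S)
    (hK : IsStableForceMatrix K) : ∃ c > 0, AntilipschitzWith c (oscillatorMap C S) := by
  refine LinearMap.exists_antilipschitzWith (oscillatorMap C S).toLinearMap
    (LinearMap.ker_eq_bot'.2 fun w hw => hS.eq_zero_of_relCoord hK w fun p => ?_)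
  have h1 : Real.sqrt (S.omega p.1) * (relCoord C S p.1 w).re = 0 :=
    congrArg (fun v : EuclideanSpace ℝ (S.Mode ⊕ S.Mode) => v (Sum.inl p)) hw
  have h2 : Real.sqrt (S.omega p.1) * (relCoord C S p.1 w).im = 0 :=
    congrArg (fun v : EuclideanSpace ℝ (S.Mode ⊕ S.Mode) => v (Sum.inr p)) hw
  have h0 : Real.sqrt (S.omega p.1) ≠ 0 := (Real.sqrt_pos.2 (hS.freq_pos p)).ne'
  exact Complex.ext ((mul_eq_zero.1 h1).resolve_left h0) ((mul_eq_zero.1 h2).resolve_left h0)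

theorem groundState_mem (hS : IsNormalModes C K S) (hK : IsStableForceMatrix K) :
    groundState C S ∈ vibStates C L := by
  obtain ⟨c, -, hc⟩ := hS.exists_antilipschitz_oscillatorMap hK
  refine ⟨fun u ε => ?_, SchwartzMap.compCLMOfAntilipschitz ℂ
    (oscillatorMap C S).hasTemperateGrowth hc (gaussianSchwartz _), fun w => ?_⟩
  · refine congrArg (fun z => Complex.exp (-(1 / 2) * z)) (Finset.sum_congr rfl fun p _ => ?_)
    have h := hS.normalCoord_shift hK (p := negMode p.1) (hS.omega_neg_ne_zero p.2) u ε
    simp only [negMode] at h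
    rw [hS.normalCoord_shift hK p.2 u ε, h]
  · rw [hS.groundState_apply]
    exact gaussianSchwartz_apply _

theorem exists_norm_groundState_le (hS : IsNormalModes C K S) (hK : IsStableForceMatrix K) :
    ∃ a > 0, ∀ w : relDispl C L, ‖(groundState C S).1 w‖ ≤ Real.exp (-a * ‖w‖ ^ 2) := by
  obtain ⟨c, hc0, hc⟩ := hS.exists_antilipschitz_oscillatorMap hK
  have hc0' : (0 : ℝ) < c := hc0
  -- With $\|w\|\le c\,\|Tw\|$, where $T$ is the oscillator map, one has
  -- $-\frac12\|Tw\|^2\le-\|w\|^2/(2c^2)$.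
  refine ⟨1 / (2 * (c : ℝ) ^ 2), by positivity, fun w => ?_⟩
  have h1 : ‖w‖ ≤ c * ‖oscillatorMap C S w‖ := by
    have := hc.le_mul_dist w 0
    simpa using this
  rw [hS.groundState_apply, Complex.norm_real, Real.norm_eq_abs, Real.abs_exp, Real.exp_le_exp]
  have h2 : ‖w‖ ^ 2 ≤ (c : ℝ) ^ 2 * ‖oscillatorMap C S w‖ ^ 2 := by
    rw [← mul_pow]; gcongr
  have h3 : 1 / (2 * (c : ℝ) ^ 2) * ‖w‖ ^ 2 ≤
      1 / (2 * (c : ℝ) ^ 2) * ((c : ℝ) ^ 2 * ‖oscillatorMap C S w‖ ^ 2) := by gcongr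
  have h4 : 1 / (2 * (c : ℝ) ^ 2) * ((c : ℝ) ^ 2 * ‖oscillatorMap C S w‖ ^ 2) =
      ‖oscillatorMap C S w‖ ^ 2 / 2 := by field_simp
  linarith

theorem normalCoord_mode (hS : IsNormalModes C K S) (p k : Momentum L × Branch N) :
    normalCoord C S k.1 k.2 (modeRe C S p) + Complex.I * normalCoord C S k.1 k.2 (modeIm C S p) =
      if k = p then 1 else 0 := by
  rw [← hS.sum_modeVec, normalCoord_eq, normalCoord_eq, Finset.mul_sum, ← Finset.sum_add_distrib]
  refine Finset.sum_congr rfl fun s _ => ?_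
  have := C.sqrt_mu_ne_zero s.2
  conv_rhs => rw [← Complex.re_add_im (modeVec C S p s)]
  simp only [modeRe, modeIm, Complex.ofReal_div, Prod.mk.eta]
  field_simp

theorem fderiv_groundState (u v : Displ N L) :
    fderiv ℝ (groundState C S).1 u v = (groundState C S).1 u * (-(1 / 2) *
      ∑ p : S.Mode, (S.freq p.1.1 p.1.2 : ℂ) *
        (normalCoord C S (-p.1.1) p.1.2 v * normalCoord C S p.1.1 p.1.2 u +
          normalCoord C S (-p.1.1) p.1.2 u * normalCoord C S p.1.1 p.1.2 v)) := by
  have hx : ∀ (q : Momentum L) (α : Branch N), HasFDerivAt (normalCoord C S q α)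
      (fderiv ℝ (normalCoord C S q α) u) u := fun q α =>
    ((contDiff_normalCoord C S q α).differentiable (by simp) u).hasFDerivAt
  have h := ((HasFDerivAt.fun_sum (u := (Finset.univ : Finset S.Mode)) fun p _ =>
    ((hx (-p.1.1) p.1.2).fun_mul (hx p.1.1 p.1.2)).const_mul
      (S.freq p.1.1 p.1.2 : ℂ)).const_mul (-(1 / 2) : ℂ)).cexp
  have h1 : fderiv ℝ (groundState C S).1 u = _ := h.fderiv
  rw [h1]
  simp only [smul_apply, sum_apply, add_apply, fderiv_normalCoord, smul_eq_mul, Finset.mul_sum]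
  refine Finset.sum_congr rfl fun p _ => ?_
  rw [← Finset.mul_sum]
  change (groundState C S).1 u * _ = _
  ring

theorem dxOp_groundState (hS : IsNormalModes C K S) (p : S.Mode) (u : Displ N L) :
    (dxOp C S (-p.1.1) p.1.2 (groundState C S)).1 u =
      -(S.freq p.1.1 p.1.2 : ℂ) * normalCoord C S p.1.1 p.1.2 u * (groundState C S).1 u := by
  have h := dxOp_apply (C := C) (S := S) (negMode p.1) (groundState C S) u
  rw [fderiv_groundState, fderiv_groundState] at h
  have h0 : (dxOp C S (-p.1.1) p.1.2 (groundState C S)).1 u = _ := h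
  rw [h0]
  -- The derivative acts on the first factor of the summand $k=(q,\alpha)$ and on the second factor
  -- of $k=(-q,\alpha)$. Both give $\omega x_q$, which compensates the factor $\frac12$; if $-q=q$
  -- the two contributions come from the same summand.
  have e : ∀ k : S.Mode, (S.freq k.1.1 k.1.2 : ℂ) *
      (normalCoord C S (-k.1.1) k.1.2 (modeRe C S (negMode p.1)) * normalCoord C S k.1.1 k.1.2 u +
        normalCoord C S (-k.1.1) k.1.2 u * normalCoord C S k.1.1 k.1.2 (modeRe C S (negMode p.1)))
      + Complex.I * ((S.freq k.1.1 k.1.2 : ℂ) *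
      (normalCoord C S (-k.1.1) k.1.2 (modeIm C S (negMode p.1)) * normalCoord C S k.1.1 k.1.2 u +
        normalCoord C S (-k.1.1) k.1.2 u * normalCoord C S k.1.1 k.1.2 (modeIm C S (negMode p.1))))
      = (if k = p then (S.freq p.1.1 p.1.2 : ℂ) * normalCoord C S p.1.1 p.1.2 u else 0) +
        (if k = hS.negEquiv p then (S.freq p.1.1 p.1.2 : ℂ) * normalCoord C S p.1.1 p.1.2 u
          else 0) := by
    intro k
    have h1 := hS.normalCoord_mode (negMode p.1) (negMode k.1)
    have h2 := hS.normalCoord_mode (negMode p.1) k.1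
    have h3 : (if negMode k.1 = negMode p.1 then (1 : ℂ) else 0) = if k = p then 1 else 0 := by
      simp only [negMode_involutive.injective.eq_iff, Subtype.ext_iff]
    have h4 : (if k.1 = negMode p.1 then (1 : ℂ) else 0) =
        if k = hS.negEquiv p then 1 else 0 := by
      simp only [Subtype.ext_iff]
      rfl
    rw [h3] at h1
    rw [h4] at h2
    have h5 : (if k = p then (S.freq p.1.1 p.1.2 : ℂ) * normalCoord C S p.1.1 p.1.2 u else 0) =
        S.freq k.1.1 k.1.2 * (normalCoord C S k.1.1 k.1.2 u * if k = p then 1 else 0) := by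
      split_ifs with hk
      · rw [hk, mul_one]
      · simp
    have h6 : (if k = hS.negEquiv p then (S.freq p.1.1 p.1.2 : ℂ) *
        normalCoord C S p.1.1 p.1.2 u else 0) = S.freq k.1.1 k.1.2 *
          (normalCoord C S (-k.1.1) k.1.2 u * if k = hS.negEquiv p then 1 else 0) := by
      split_ifs with hk
      · have e1 : k.1.1 = -p.1.1 := by rw [hk]; rfl
        have e2 : k.1.2 = p.1.2 := by rw [hk]; rfl
        rw [e1, e2, hS.freq_neg, neg_neg, mul_one]
      · simp
    rw [h5, h6, ← h1, ← h2]
    simp only [negMode]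
    ring
  have e' := Finset.sum_congr rfl fun k (_ : k ∈ (Finset.univ : Finset S.Mode)) => e k
  rw [Finset.sum_add_distrib, Finset.sum_add_distrib, ← Finset.mul_sum] at e'
  simp only [Finset.sum_ite_eq', Finset.mem_univ, if_true] at e'
  linear_combination (groundState C S).1 u * (-(1 / 2)) * e'

theorem annihilation_groundState (hS : IsNormalModes C K S) (p : S.Mode) :
    annihilation C S p (groundState C S) = 0 := by
  ext u
  change (Real.sqrt (S.freq p.1.1 p.1.2 / 2) : ℂ) *
    (normalCoord C S p.1.1 p.1.2 u * (groundState C S).1 u) +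
    ((1 / Real.sqrt (2 * S.freq p.1.1 p.1.2) : ℝ) : ℂ) *
      (dxOp C S (-p.1.1) p.1.2 (groundState C S)).1 u = 0
  obtain ⟨h1, h2, h3⟩ := sqrt_freq_coeff (hS.freq_pos p)
  rw [hS.dxOp_groundState]
  -- With $r=\sqrt{\omega/2}$ and $k=1/\sqrt{2\omega}$, the identity $k\omega=r$ follows from
  -- $r^2=\omega/2$ and $rk=\frac12$.
  have h4 : ((1 / Real.sqrt (2 * S.freq p.1.1 p.1.2) : ℝ) : ℂ) * S.freq p.1.1 p.1.2 =
      (Real.sqrt (S.freq p.1.1 p.1.2 / 2) : ℂ) := by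
    linear_combination (-2 * ((1 / Real.sqrt (2 * S.freq p.1.1 p.1.2) : ℝ) : ℂ)) * h1 +
      (2 * (Real.sqrt (S.freq p.1.1 p.1.2 / 2) : ℂ)) * h3
  linear_combination (-(normalCoord C S p.1.1 p.1.2 u * (groundState C S).1 u)) * h4

end IsNormalModes

end Phonon

namespace Phonon

variable {N L : ℕ} [NeZero L] {C : Crystal N} {K : Matrix (Site N L) (Site N L) ℝ}
  {S : ModeData N L}

/-! ### The square root of the mass-weighted force matrix -/

/-- The positive square root `(M^{-1/2} K M^{-1/2})^{1/2}`. -/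
def rootMatrix (C : Crystal N) (S : ModeData N L) : Matrix (Site N L) (Site N L) ℝ :=
  Matrix.of fun s t =>
    (∑ p, (S.omega p : ℂ) * (modeVec C S p s * conj (modeVec C S p t))).re

namespace IsNormalModes

/-- The terms of $p$ and its negative are complex conjugates with equal frequencies, so the sum is
real and nothing is lost in taking the real part. -/
theorem ofReal_rootMatrix (hS : IsNormalModes C K S) (s t : Site N L) :
    (rootMatrix C S s t : ℂ) =
      ∑ p, (S.omega p : ℂ) * (modeVec C S p s * conj (modeVec C S p t)) := by
  refine Complex.conj_eq_iff_re.1 ?_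
  simp only [map_sum, map_mul, Complex.conj_ofReal, ← hS.modeVec_neg]
  rw [← (negMode_involutive (N := N) (L := L)).bijective.sum_comp]
  refine Finset.sum_congr rfl fun p _ => ?_
  simp only [hS.omega_neg, negMode_negMode]

theorem rootMatrix_posSemidef (hS : IsNormalModes C K S) : (rootMatrix C S).PosSemidef := by
  refine Matrix.PosSemidef.of_dotProduct_mulVec_nonneg ?_ fun x => ?_
  · ext s t
    rw [Matrix.conjTranspose_apply, star_trivial]
    have h : conj (rootMatrix C S t s : ℂ) = (rootMatrix C S s t : ℂ) := by
      rw [hS.ofReal_rootMatrix, hS.ofReal_rootMatrix]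
      simp only [map_sum, map_mul, Complex.conj_ofReal, Complex.conj_conj]
      exact Finset.sum_congr rfl fun p _ => by ring
    rw [Complex.conj_ofReal] at h
    exact_mod_cast h
  · have h : ((star x ⬝ᵥ (rootMatrix C S).mulVec x : ℝ) : ℂ) =
        ∑ p, (S.omega p : ℂ) * Complex.normSq (∑ s, modeVec C S p s * x s) := by
      have h1 := sum_quadratic (C := C) (S := S) (fun p => (S.omega p : ℂ)) (fun s => (x s : ℂ))
        (fun s => (x s : ℂ))
      simp only [← hS.ofReal_rootMatrix] at h1
      calc _ = _ := ?_
        _ = _ := h1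
        _ = _ := ?_
      · simp [dotProduct, Matrix.mulVec, Finset.mul_sum, mul_assoc]
      · refine Finset.sum_congr rfl fun p _ => ?_
        rw [← Complex.mul_conj]
        simp
    have h2 : star x ⬝ᵥ (rootMatrix C S).mulVec x =
        ∑ p, S.omega p * Complex.normSq (∑ s, modeVec C S p s * x s) := by exact_mod_cast h
    rw [h2]
    exact Finset.sum_nonneg fun p _ => mul_nonneg (hS.freq_nonneg _ _) (Complex.normSq_nonneg _)

theorem rootMatrix_mul_self (hS : IsNormalModes C K S) (hK : IsStableForceMatrix K)
    (s t : Site N L) : (rootMatrix C S * rootMatrix C S) s t = massWeighted C K s t := by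
  have h1 : ∀ p, ∑ r, (∑ p', (S.omega p' : ℂ) * (modeVec C S p' s * conj (modeVec C S p' r))) *
      modeVec C S p r = (S.omega p : ℂ) * modeVec C S p s := by
    intro p
    simp only [Finset.sum_mul]
    rw [Finset.sum_comm]
    have h2 : ∀ p', ∑ r, (S.omega p' : ℂ) * (modeVec C S p' s * conj (modeVec C S p' r)) *
        modeVec C S p r = (S.omega p' : ℂ) * modeVec C S p' s * if p' = p then 1 else 0 := by
      intro p'
      rw [← hS.sum_modeVec, Finset.mul_sum]
      exact Finset.sum_congr rfl fun r _ => by ring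
    simp [h2]
  have h : (((rootMatrix C S * rootMatrix C S) s t : ℝ) : ℂ) = massWeighted C K s t := by
    rw [hS.massWeighted_eq hK, Matrix.mul_apply]
    push_cast
    simp only [hS.ofReal_rootMatrix s]
    calc _ = ∑ r, ∑ p, (∑ p', (S.omega p' : ℂ) *
          (modeVec C S p' s * conj (modeVec C S p' r))) * modeVec C S p r *
            ((S.omega p : ℂ) * conj (modeVec C S p t)) := by
          refine Finset.sum_congr rfl fun r _ => ?_
          rw [hS.ofReal_rootMatrix, Finset.mul_sum]
          exact Finset.sum_congr rfl fun p _ => by ring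
      _ = _ := by
          rw [Finset.sum_comm]
          simp only [← Finset.sum_mul, h1]
          exact Finset.sum_congr rfl fun p _ => by ring
  exact_mod_cast h

theorem groundState_eq_exp (hS : IsNormalModes C K S) (u : Displ N L) :
    (groundState C S).1 u = Complex.exp (-(1 / 2) *
      ((∑ s, ∑ t, u s * (Real.sqrt (C.mu s.2) * rootMatrix C S s t * Real.sqrt (C.mu t.2)) *
        u t : ℝ) : ℂ)) := by
  refine congrArg (fun z => Complex.exp (-(1 / 2) * z)) ?_
  have h1 := sum_mode (S := S) fun p => (S.freq p.1 p.2 : ℂ) *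
    (normalCoord C S (-p.1) p.2 u * normalCoord C S p.1 p.2 u)
  have h2 := hS.sum_normalCoord (fun p => (S.omega p : ℂ)) u
  rw [h1]
  refine (Finset.sum_congr rfl fun p _ => ?_).trans (h2.trans ?_)
  · split_ifs with hp
    · rw [hp, Complex.ofReal_zero, zero_mul]
    · rfl
  · simp only [← hS.ofReal_rootMatrix]
    push_cast
    exact Finset.sum_congr rfl fun s _ => Finset.sum_congr rfl fun t _ => by ring

/-! ### Fock states -/

theorem creation_comm (hS : IsNormalModes C K S) (p p' : S.Mode) :
    creation C S p * creation C S p' = creation C S p' * creation C S p :=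
  (sub_eq_zero (G := Module.End ℂ (Wave N L))).1 (hS.commutation_relations p p').2.1

theorem annihilation_mul_creation (hS : IsNormalModes C K S) (p p' : S.Mode) :
    annihilation C S p * creation C S p' =
      creation C S p' * annihilation C S p + if p = p' then 1 else 0 := by
  rw [← (hS.commutation_relations p p').2.2]
  exact (add_sub_cancel (G := Module.End ℂ (Wave N L)) _ _).symm

end IsNormalModes

theorem phononState_eq (n : S.Mode → ℕ) : phononState C S n =
    listWord (creation C S) (Finset.univ : Finset S.Mode).toList n (groundState C S) := rfl

theorem groundState_apply_ne_zero (u : Displ N L) : (groundState C S).1 u ≠ 0 :=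
  Complex.exp_ne_zero _

theorem groundState_ne_zero : groundState C S ≠ 0 := fun h =>
  groundState_apply_ne_zero (C := C) (S := S) 0 (by rw [h]; rfl)

theorem phononState_zero : phononState C S 0 = groundState C S := by
  simp [phononState_eq, listWord]

theorem mem_of_mem_groundState {W : Submodule ℂ (Wave N L)}
    (hc : ∀ p, ∀ Ψ ∈ W, creation C S p Ψ ∈ W) (h0 : groundState C S ∈ W) (n : S.Mode → ℕ) :
    phononState C S n ∈ W := by
  have hpow : ∀ (p : S.Mode) (k : ℕ), ∀ Ψ ∈ W, (creation C S p ^ k) Ψ ∈ W := by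
    intro p k
    induction k with
    | zero => exact fun Ψ h => h
    | succ k ih =>
      intro Ψ h
      rw [pow_succ', Module.End.mul_apply]
      exact hc p _ (ih Ψ h)
  rw [phononState_eq, listWord]
  induction (Finset.univ : Finset S.Mode).toList with
  | nil => exact h0
  | cons p l ih =>
    rw [List.map_cons, List.prod_cons, Module.End.mul_apply]
    exact hpow _ _ _ ih

namespace IsNormalModes

theorem phononState_mem (hS : IsNormalModes C K S) (hK : IsStableForceMatrix K)
    (n : S.Mode → ℕ) : phononState C S n ∈ vibStates C L :=
  mem_of_mem_groundState (fun p _ h => hS.creation_mem hK p h) (hS.groundState_mem hK) n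

theorem creation_phononState (hS : IsNormalModes C K S) (p : S.Mode) (n : S.Mode → ℕ) :
    creation C S p (phononState C S n) = phononState C S (n + Pi.single p 1) := by
  classical
  have h := listWord_add_single hS.creation_comm (Finset.nodup_toList Finset.univ)
    (Finset.mem_toList.2 (Finset.mem_univ p)) n
  rw [phononState_eq, phononState_eq, ← Module.End.mul_apply]
  convert! congrArg (fun T : Module.End ℂ (Wave N L) => T (groundState C S)) h.symm

theorem annihilation_phononState (hS : IsNormalModes C K S) (p : S.Mode) (n : S.Mode → ℕ) :
    annihilation C S p (phononState C S n) =
      (n p : ℂ) • phononState C S (n - Pi.single p 1) :=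
  annihilate_listWord hS.creation_comm hS.annihilation_mul_creation hS.annihilation_groundState
    (Finset.nodup_toList Finset.univ) (Finset.mem_toList.2 (Finset.mem_univ p)) n

theorem number_phononState (hS : IsNormalModes C K S) (p : S.Mode) (n : S.Mode → ℕ) :
    creation C S p (annihilation C S p (phononState C S n)) =
      (n p : ℂ) • phononState C S n :=
  number_listWord hS.creation_comm hS.annihilation_mul_creation hS.annihilation_groundState
    (Finset.nodup_toList Finset.univ) (Finset.mem_toList.2 (Finset.mem_univ p)) n

theorem phononState_ne_zero (hS : IsNormalModes C K S) (n : S.Mode → ℕ) :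
    phononState C S n ≠ 0 :=
  listWord_ne_zero hS.creation_comm hS.annihilation_mul_creation hS.annihilation_groundState
    groundState_ne_zero (Finset.nodup_toList Finset.univ)
    (fun p => Finset.mem_toList.2 (Finset.mem_univ p)) n

theorem phononHamiltonian_phononState [NeZero N] (hS : IsNormalModes C K S)
    (hK : IsStableForceMatrix K) (n : S.Mode → ℕ) :
    phononHamiltonian C K (phononState C S n) = (S.energy n : ℂ) • phononState C S n := by
  rw [hS.phononHamiltonian_eq_sum hK, LinearMap.sum_apply, ModeData.energy, Complex.ofReal_sum,
    Finset.sum_smul]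
  refine Finset.sum_congr rfl fun p _ => ?_
  have h : (creation C S p * annihilation C S p + (1 / 2 : ℂ) • 1) (phononState C S n) =
      ((n p : ℂ) + 1 / 2) • phononState C S n := by
    rw [LinearMap.add_apply, Module.End.mul_apply, hS.number_phononState, add_smul]
    rfl
  rw [LinearMap.smul_apply, h, smul_smul]
  push_cast
  rfl

/-! ### Discreteness of the energies -/

theorem energy_zero_lt (hS : IsNormalModes C K S) {n : S.Mode → ℕ} (hn : n ≠ 0) :
    S.energy 0 < S.energy n := by
  obtain ⟨p, hp⟩ := Function.ne_iff.1 hn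
  refine Finset.sum_lt_sum (fun k _ => ?_) ⟨p, Finset.mem_univ p, ?_⟩
  · have := (hS.freq_pos k).le
    gcongr
    simp
  · have := hS.freq_pos p
    gcongr
    simpa using Nat.pos_of_ne_zero hp

theorem finite_energy_le (hS : IsNormalModes C K S) (M : ℝ) : {n | S.energy n ≤ M}.Finite := by
  -- An energy at most $M$ bounds each occupation number by $M/\omega_p$, so the admissible `n` lie
  -- in a finite box.
  refine (Set.finite_Iic fun p : S.Mode => ⌊M / S.freq p.1.1 p.1.2⌋₊).subset fun n hn p => ?_
  have hp := hS.freq_pos p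
  refine Nat.le_floor ((le_div_iff₀ hp).2 (le_trans ?_ (show S.energy n ≤ M from hn)))
  have h := Finset.single_le_sum (f := fun p : S.Mode =>
    S.freq p.1.1 p.1.2 * ((n p : ℝ) + 1 / 2)) (fun k _ => by
      have := (hS.freq_pos k).le
      positivity) (Finset.mem_univ p)
  refine le_trans ?_ h
  nlinarith

end IsNormalModes

/-- Only finitely many values lie below $\|z\|+1$, and all others have distance at least 1 from $z$;
so a point outside the range has positive distance from it. -/
theorem exists_pos_le_norm_sub {ι : Type*} {w : ι → ℝ} (hw : ∀ M, {i | w i ≤ M}.Finite) (z : ℂ)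
    (hz : z ∉ Set.range fun i => (w i : ℂ)) : ∃ δ > 0, ∀ i, δ ≤ ‖(w i : ℂ) - z‖ := by
  have hfin := hw (‖z‖ + 1)
  have h : ∃ δ > 0, ∀ i ∈ {i | w i ≤ ‖z‖ + 1}, δ ≤ ‖(w i : ℂ) - z‖ := by
    rcases Set.eq_empty_or_nonempty {i | w i ≤ ‖z‖ + 1} with h0 | h0
    · exact ⟨1, one_pos, by simp [h0]⟩
    · obtain ⟨j, -, hj⟩ := Set.exists_min_image _ (fun i => ‖(w i : ℂ) - z‖) hfin h0
      exact ⟨_, norm_pos_iff.2 (sub_ne_zero.2 fun h => hz ⟨j, h⟩), hj⟩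
  obtain ⟨δ, hδ, h⟩ := h
  refine ⟨min δ 1, lt_min hδ one_pos, fun i => ?_⟩
  by_cases hi : w i ≤ ‖z‖ + 1
  · exact (min_le_left _ _).trans (h i hi)
  · have h1 := norm_sub_norm_le (w i : ℂ) z
    rw [Complex.norm_real] at h1
    have h2 := Real.le_norm_self (w i)
    exact (min_le_right _ _).trans (by linarith)

end Phonon

namespace Phonon

variable {N L : ℕ} [NeZero L] {C : Crystal N} {K : Matrix (Site N L) (Site N L) ℝ}
  {S : ModeData N L}

open MeasureTheory

/-! ### Vibrational states as vectors in the Hilbert space -/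

theorem coeFn_toRelL2 (Ψ : vibStates C L) :
    toRelL2 C L Ψ =ᵐ[volume] fun w : relDispl C L => Ψ.1.1 (w : Displ N L) :=
  (memLp_vibStates C Ψ).coeFn_toLp

theorem inner_toRelL2 (Φ Ψ : vibStates C L) : inner ℂ (toRelL2 C L Φ) (toRelL2 C L Ψ) =
    ∫ w : relDispl C L, conj (Φ.1.1 w) * Ψ.1.1 w := by
  rw [L2.inner_def]
  refine integral_congr_ae ?_
  filter_upwards [coeFn_toRelL2 Φ, coeFn_toRelL2 Ψ] with w h1 h2
  rw [h1, h2, RCLike.inner_apply, mul_comm]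

theorem exists_add_uniformShift_mem [NeZero N] (C : Crystal N) (u : Displ N L) :
    ∃ ε, u + uniformShift N L ε ∈ relDispl C L := by
  have hM := (C.totalMass_pos (L := L)).ne'
  refine ⟨WithLp.toLp 2 fun j =>
    -(∑ R : Cell L, ∑ r : Fin N, C.mass r * u (R, (r, j))) / C.totalMass L, fun j => ?_⟩
  have h : ∀ (R : Cell L) (r : Fin N), C.mass r * (u + uniformShift N L (WithLp.toLp 2 fun j =>
      -(∑ R : Cell L, ∑ r : Fin N, C.mass r * u (R, (r, j))) / C.totalMass L)) (R, (r, j)) =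
      C.mass r * u (R, (r, j)) + C.mass r *
        (-(∑ R : Cell L, ∑ r : Fin N, C.mass r * u (R, (r, j))) / C.totalMass L) :=
    fun R r => mul_add _ _ _
  have hsum : ∑ _R : Cell L, ∑ r : Fin N, C.mass r = C.totalMass L := by
    simp [Crystal.totalMass, ZMod.card]
  simp only [h, Finset.sum_add_distrib, ← Finset.sum_mul, hsum]
  field_simp
  ring

/-- A continuous function that vanishes almost everywhere vanishes on the relative displacements.
Every displacement reaches that subspace by a uniform shift, under which the wave function is
invariant. -/
theorem toRelL2_injective [NeZero N] : Function.Injective (toRelL2 C L) := by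
  rw [injective_iff_map_eq_zero]
  intro Ψ hΨ
  have h1 : (fun w : relDispl C L => Ψ.1.1 (w : Displ N L)) =ᵐ[volume] fun _ => 0 := by
    have h2 := coeFn_toRelL2 Ψ
    rw [hΨ] at h2
    exact h2.symm.trans (Lp.coeFn_zero _ _ _)
  have hc : Continuous fun w : relDispl C L => Ψ.1.1 (w : Displ N L) :=
    (contDiff_wave Ψ.1).continuous.comp continuous_subtype_val
  have h3 := (hc.ae_eq_iff_eq volume continuous_const).1 h1
  refine Subtype.ext (Subtype.ext (funext fun u => ?_))
  obtain ⟨ε, hε⟩ := exists_add_uniformShift_mem C u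
  rw [← Ψ.2.1 u ε]
  exact congrFun h3 ⟨_, hε⟩

namespace IsNormalModes

/-- The annihilation operators on the vibrational states. -/
def vibAnnihilation (hS : IsNormalModes C K S) (hK : IsStableForceMatrix K) (p : S.Mode) :
    vibStates C L →ₗ[ℂ] vibStates C L :=
  (annihilation C S p).restrict fun _ h => hS.annihilation_mem hK p h

/-- The creation operators on the vibrational states. -/
def vibCreation (hS : IsNormalModes C K S) (hK : IsStableForceMatrix K) (p : S.Mode) :
    vibStates C L →ₗ[ℂ] vibStates C L :=
  (creation C S p).restrict fun _ h => hS.creation_mem hK p h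

theorem inner_annihilation (hS : IsNormalModes C K S) (hK : IsStableForceMatrix K) (p : S.Mode)
    (Φ Ψ : vibStates C L) :
    inner ℂ (toRelL2 C L Φ) (toRelL2 C L (hS.vibAnnihilation hK p Ψ)) =
      inner ℂ (toRelL2 C L (hS.vibCreation hK p Φ)) (toRelL2 C L Ψ) := by
  rw [inner_toRelL2, inner_toRelL2]
  exact hS.integral_conj_mul_annihilation hK p Φ.2 Ψ.2

theorem inner_number (hS : IsNormalModes C K S) (hK : IsStableForceMatrix K) (p : S.Mode)
    (Φ Ψ : vibStates C L) :
    inner ℂ (toRelL2 C L (hS.vibCreation hK p (hS.vibAnnihilation hK p Φ))) (toRelL2 C L Ψ) =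
      inner ℂ (toRelL2 C L Φ)
        (toRelL2 C L (hS.vibCreation hK p (hS.vibAnnihilation hK p Ψ))) := by
  rw [← inner_annihilation, ← inner_conj_symm (toRelL2 C L Φ), ← inner_annihilation,
    inner_conj_symm]

/-- The states `Ψ_n` as vibrational states. -/
def vibState (hS : IsNormalModes C K S) (hK : IsStableForceMatrix K) (n : S.Mode → ℕ) :
    vibStates C L := ⟨phononState C S n, hS.phononState_mem hK n⟩

/-- Different `n` may have equal energies, so orthogonality comes from the symmetric number operator
of a single mode in which the occupations differ. -/
theorem inner_vibState (hS : IsNormalModes C K S) (hK : IsStableForceMatrix K)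
    {m n : S.Mode → ℕ} (h : m ≠ n) :
    inner ℂ (toRelL2 C L (hS.vibState hK m)) (toRelL2 C L (hS.vibState hK n)) = 0 := by
  obtain ⟨p, hp⟩ := Function.ne_iff.1 h
  have h1 : ∀ n : S.Mode → ℕ, hS.vibCreation hK p (hS.vibAnnihilation hK p (hS.vibState hK n)) =
      (n p : ℂ) • hS.vibState hK n := fun n => Subtype.ext (hS.number_phononState p n)
  have h2 := hS.inner_number hK p (hS.vibState hK m) (hS.vibState hK n)
  rw [h1, h1, map_smul, map_smul, inner_smul_left, inner_smul_right, Complex.conj_natCast] at h2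
  refine (mul_eq_mul_right_iff.1 h2).resolve_left fun h3 => hp ?_
  exact_mod_cast h3

theorem toRelL2_vibState_ne_zero [NeZero N] (hS : IsNormalModes C K S)
    (hK : IsStableForceMatrix K) (n : S.Mode → ℕ) : toRelL2 C L (hS.vibState hK n) ≠ 0 := by
  rw [Ne, map_eq_zero_iff _ toRelL2_injective]
  exact fun h => hS.phononState_ne_zero n (congrArg Subtype.val h)

/-! ### Completeness -/

/-- In $a_q+a^+_{-q}$ the derivatives cancel. Multiplication by $x_q$ is thus a combination of
ladder operators and preserves the span of the phonon states. -/
theorem annihilation_add_creation (hS : IsNormalModes C K S) (p : S.Mode) :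
    annihilation C S p + creation C S (hS.negEquiv p) =
      (2 * Real.sqrt (S.freq p.1.1 p.1.2 / 2) : ℂ) • xOp C S p.1.1 p.1.2 := by
  have h : creation C S (hS.negEquiv p) =
      (Real.sqrt (S.freq p.1.1 p.1.2 / 2) : ℂ) • xOp C S p.1.1 p.1.2 -
        ((1 / Real.sqrt (2 * S.freq p.1.1 p.1.2) : ℝ) : ℂ) • dxOp C S (-p.1.1) p.1.2 := by
    change (Real.sqrt (S.freq (-p.1.1) p.1.2 / 2) : ℂ) • xOp C S (- -p.1.1) p.1.2 -
        ((1 / Real.sqrt (2 * S.freq (-p.1.1) p.1.2) : ℝ) : ℂ) • dxOp C S (-p.1.1) p.1.2 = _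
    rw [hS.freq_neg, neg_neg]
  have key : ∀ {A : Type _} [Ring A] [Algebra ℂ A] (r k : ℂ) (x d : A),
      r • x + k • d + (r • x - k • d) = (2 * r) • x := fun r k x d => by module
  rw [h]
  exact key (A := Module.End ℂ (Wave N L)) _ _ _ _

theorem creation_mem_span (hS : IsNormalModes C K S) (p : S.Mode) {Ψ : Wave N L}
    (h : Ψ ∈ Submodule.span ℂ (Set.range (phononState C S))) :
    creation C S p Ψ ∈ Submodule.span ℂ (Set.range (phononState C S)) := by
  have h1 : Submodule.span ℂ (Set.range (phononState C S)) ≤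
      (Submodule.span ℂ (Set.range (phononState C S))).comap (creation C S p) := by
    rw [Submodule.span_le]
    rintro _ ⟨n, rfl⟩
    exact Submodule.subset_span ⟨_, (hS.creation_phononState p n).symm⟩
  exact h1 h

theorem annihilation_mem_span (hS : IsNormalModes C K S) (p : S.Mode) {Ψ : Wave N L}
    (h : Ψ ∈ Submodule.span ℂ (Set.range (phononState C S))) :
    annihilation C S p Ψ ∈ Submodule.span ℂ (Set.range (phononState C S)) := by
  have h1 : Submodule.span ℂ (Set.range (phononState C S)) ≤
      (Submodule.span ℂ (Set.range (phononState C S))).comap (annihilation C S p) := by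
    rw [Submodule.span_le]
    rintro _ ⟨n, rfl⟩
    rw [Submodule.comap_coe, Set.mem_preimage, hS.annihilation_phononState]
    exact Submodule.smul_mem _ _ (Submodule.subset_span ⟨_, rfl⟩)
  exact h1 h

theorem xOp_mem_span (hS : IsNormalModes C K S) (p : S.Mode) {Ψ : Wave N L}
    (h : Ψ ∈ Submodule.span ℂ (Set.range (phononState C S))) :
    xOp C S p.1.1 p.1.2 Ψ ∈ Submodule.span ℂ (Set.range (phononState C S)) := by
  have h1 : (2 * Real.sqrt (S.freq p.1.1 p.1.2 / 2) : ℂ) • xOp C S p.1.1 p.1.2 Ψ =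
      annihilation C S p Ψ + creation C S (hS.negEquiv p) Ψ := by
    rw [← LinearMap.smul_apply, ← hS.annihilation_add_creation, LinearMap.add_apply]
  have h2 : (2 * Real.sqrt (S.freq p.1.1 p.1.2 / 2) : ℂ) ≠ 0 :=
    mul_ne_zero two_ne_zero (Complex.ofReal_ne_zero.2
      (Real.sqrt_pos.2 (half_pos (hS.freq_pos p))).ne')
  rw [← Submodule.smul_mem_iff _ h2, h1]
  exact Submodule.add_mem _ (hS.annihilation_mem_span p h) (hS.creation_mem_span _ h)

theorem exists_inner_pow_mem_span (hS : IsNormalModes C K S) (hK : IsStableForceMatrix K)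
    (ξ : relDispl C L) (k : ℕ) : ∃ Ψ ∈ Submodule.span ℂ (Set.range (phononState C S)),
      ∀ w : relDispl C L, Ψ.1 (w : Displ N L) =
        ((inner ℝ w ξ : ℝ) : ℂ) ^ k * (groundState C S).1 w := by
  induction k with
  | zero =>
    exact ⟨groundState C S, Submodule.subset_span ⟨0, phononState_zero⟩, fun w => by simp⟩
  | succ k ih =>
    obtain ⟨Ψ, hΨ, h⟩ := ih
    -- The coefficients of the functional $\langle\cdot,\xi\rangle$ in normal coordinates;
    -- multiplying by it raises the power by one.
    let c : S.Mode → ℂ := fun p =>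
      ∑ s, ((ξ : Displ N L) s : ℂ) * (modeVec C S p.1 s / (Real.sqrt (C.mu s.2) : ℂ))
    refine ⟨∑ p : S.Mode, c p • xOp C S p.1.1 p.1.2 Ψ,
      Submodule.sum_mem _ fun p _ => Submodule.smul_mem _ _ (hS.xOp_mem_span p hΨ), fun w => ?_⟩
    have h1 : ((inner ℝ w ξ : ℝ) : ℂ) = ∑ p : S.Mode, c p * normalCoord C S p.1.1 p.1.2 w := by
      rw [Submodule.coe_inner, PiLp.inner_apply]
      simp only [RCLike.inner_apply, conj_trivial, Complex.ofReal_sum, Complex.ofReal_mul,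
        hS.ofReal_apply_eq hK w, Finset.mul_sum, c, Finset.sum_mul]
      rw [Finset.sum_comm]
      refine Finset.sum_congr rfl fun p _ => Finset.sum_congr rfl fun s _ => ?_
      rw [relCoord_apply]
      ring
    rw [AddSubmonoidClass.coe_finsetSum, Finset.sum_apply, pow_succ', h1, mul_assoc,
      Finset.sum_mul]
    refine Finset.sum_congr rfl fun p _ => ?_
    change c p * (normalCoord C S p.1.1 p.1.2 w * Ψ.1 w) = _
    rw [h, h1]
    ring

theorem topologicalClosure_span_vibState (hS : IsNormalModes C K S) (hK : IsStableForceMatrix K) :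
    (Submodule.span ℂ (Set.range fun n : S.Mode → ℕ =>
      toRelL2 C L (hS.vibState hK n))).topologicalClosure = ⊤ := by
  rw [Submodule.topologicalClosure_eq_top_iff, Submodule.eq_bot_iff]
  intro f hf
  -- Conjugating $\langle\Psi,f\rangle=0$ gives $\int\Psi f^*=0$, so the moment criterion applies to
  -- $f^*$.
  have hfm : MemLp (fun w => conj (f w)) 2 (volume : Measure (relDispl C L)) :=
    (Lp.memLp f).star
  have hspan : ∀ Ψ ∈ Submodule.span ℂ (Set.range (phononState C S)),
      ∃ h : Ψ ∈ vibStates C L, inner ℂ (toRelL2 C L ⟨Ψ, h⟩) f = 0 := by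
    intro Ψ hΨ
    induction hΨ using Submodule.span_induction with
    | mem Ψ h =>
      obtain ⟨n, rfl⟩ := h
      exact ⟨hS.phononState_mem hK n, hf _ (Submodule.subset_span ⟨n, rfl⟩)⟩
    | zero =>
      refine ⟨Submodule.zero_mem _, ?_⟩
      have : (⟨0, Submodule.zero_mem _⟩ : vibStates C L) = 0 := rfl
      rw [this, map_zero, inner_zero_left]
    | add Ψ Φ _ _ h1 h2 =>
      obtain ⟨h1, h1'⟩ := h1
      obtain ⟨h2, h2'⟩ := h2
      refine ⟨Submodule.add_mem _ h1 h2, ?_⟩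
      have : (⟨Ψ + Φ, Submodule.add_mem _ h1 h2⟩ : vibStates C L) = ⟨Ψ, h1⟩ + ⟨Φ, h2⟩ := rfl
      rw [this, map_add, inner_add_left, h1', h2', add_zero]
    | smul c Ψ _ h1 =>
      obtain ⟨h1, h1'⟩ := h1
      refine ⟨Submodule.smul_mem _ c h1, ?_⟩
      have : (⟨c • Ψ, Submodule.smul_mem _ c h1⟩ : vibStates C L) = c • ⟨Ψ, h1⟩ := rfl
      rw [this, map_smul, inner_smul_left, h1', mul_zero]
  obtain ⟨a, ha, hG⟩ := hS.exists_norm_groundState_le hK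
  have h0 := ae_eq_zero_of_gaussian_moments hfm
    (G := fun w : relDispl C L => (groundState C S).1 (w : Displ N L))
    ((contDiff_wave _).continuous.comp continuous_subtype_val)
    (fun w => groundState_apply_ne_zero _) ha hG fun ξ k => by
      obtain ⟨Ψ, hΨ, h⟩ := hS.exists_inner_pow_mem_span hK ξ k
      obtain ⟨hm, h1⟩ := hspan Ψ hΨ
      rw [← inner_conj_symm, map_eq_zero, L2.inner_def] at h1
      rw [← h1]
      refine integral_congr_ae ?_
      filter_upwards [coeFn_toRelL2 (⟨Ψ, hm⟩ : vibStates C L)] with w hw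
      rw [hw, RCLike.inner_apply, h]
      ring
  refine Lp.ext ?_
  filter_upwards [h0, Lp.coeFn_zero ℂ 2 (volume : Measure (relDispl C L))] with w h1 h2
  rw [h2]
  simpa using h1

/-- The orthonormal basis of the phonon states. -/
theorem exists_hilbertBasis [NeZero N] (hS : IsNormalModes C K S) (hK : IsStableForceMatrix K) :
    ∃ b : HilbertBasis (S.Mode → ℕ) ℂ (RelL2 C L), ∀ n, ∃ c : ℂ,
      b n = c • toRelL2 C L (hS.vibState hK n) := by
  let c : (S.Mode → ℕ) → ℂ := fun n => (‖toRelL2 C L (hS.vibState hK n)‖⁻¹ : ℝ)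
  let v : (S.Mode → ℕ) → RelL2 C L := fun n => c n • toRelL2 C L (hS.vibState hK n)
  have hc : ∀ n, c n ≠ 0 := fun n => Complex.ofReal_ne_zero.2
    (inv_ne_zero (norm_ne_zero_iff.2 (hS.toRelL2_vibState_ne_zero hK n)))
  have hv : Orthonormal ℂ v := by
    refine ⟨fun n => ?_, fun m n h => ?_⟩
    · rw [norm_smul, Complex.norm_real, norm_inv, norm_norm]
      exact inv_mul_cancel₀ (norm_ne_zero_iff.2 (hS.toRelL2_vibState_ne_zero hK n))
    · change inner ℂ (c m • _) (c n • _) = 0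
      rw [inner_smul_left, inner_smul_right, hS.inner_vibState hK h, mul_zero, mul_zero]
  have hsp : ⊤ ≤ (Submodule.span ℂ (Set.range v)).topologicalClosure := by
    rw [← hS.topologicalClosure_span_vibState hK]
    refine Submodule.topologicalClosure_mono (Submodule.span_le.2 ?_)
    rintro _ ⟨n, rfl⟩
    have h : v n ∈ Submodule.span ℂ (Set.range v) := Submodule.subset_span ⟨n, rfl⟩
    exact (Submodule.smul_mem_iff _ (hc n)).1 h
  exact ⟨HilbertBasis.mk hv hsp, fun n => ⟨c n, by rw [HilbertBasis.coe_mk]⟩⟩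

/-! ### The phonon Hamiltonian as an unbounded operator -/

theorem phononHamiltonian_mem [NeZero N] (hS : IsNormalModes C K S) (hK : IsStableForceMatrix K)
    {Ψ : Wave N L} (hΨ : Ψ ∈ vibStates C L) : phononHamiltonian C K Ψ ∈ vibStates C L := by
  rw [hS.phononHamiltonian_eq_sum hK, LinearMap.sum_apply]
  refine Submodule.sum_mem _ fun p _ => Submodule.smul_mem _ _ (Submodule.add_mem _ ?_ ?_)
  · exact hS.creation_mem hK p (hS.annihilation_mem hK p hΨ)
  · exact Submodule.smul_mem _ _ hΨ

/-- Symmetry holds mode by mode: each $a^+a$ is symmetric because its factors are mutually adjoint,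
and the frequencies are real. -/
theorem inner_phononHamiltonian [NeZero N] (hS : IsNormalModes C K S) (hK : IsStableForceMatrix K)
    {Φ Φ' Ψ Ψ' : vibStates C L} (hΦ : Φ'.1 = phononHamiltonian C K Φ.1)
    (hΨ : Ψ'.1 = phononHamiltonian C K Ψ.1) :
    inner ℂ (toRelL2 C L Φ') (toRelL2 C L Ψ) = inner ℂ (toRelL2 C L Φ) (toRelL2 C L Ψ') := by
  have h : ∀ {Ψ Ψ' : vibStates C L}, Ψ'.1 = phononHamiltonian C K Ψ.1 →
      Ψ' = ∑ p : S.Mode, (S.freq p.1.1 p.1.2 : ℂ) •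
        (hS.vibCreation hK p (hS.vibAnnihilation hK p Ψ) + (1 / 2 : ℂ) • Ψ) := by
    intro Ψ Ψ' hΨ
    refine Subtype.ext ?_
    rw [hΨ, hS.phononHamiltonian_eq_sum hK, LinearMap.sum_apply, AddSubmonoidClass.coe_finsetSum]
    rfl
  rw [h hΦ, h hΨ, map_sum, map_sum, sum_inner, inner_sum]
  refine Finset.sum_congr rfl fun p _ => ?_
  simp only [map_smul, map_add, inner_smul_left, inner_smul_right, inner_add_left,
    inner_add_right, Complex.conj_ofReal, hS.inner_number,
    map_div₀, map_one, map_ofNat]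

end IsNormalModes

/-- The relation `phononGraph C K` is single-valued because a vibrational wave function is
determined by its class in the Hilbert space, so no pairs are lost when it is turned into an
operator. -/
theorem graph_phononOperator [NeZero N] (C : Crystal N) (K : Matrix (Site N L) (Site N L) ℝ) :
    (phononOperator C K).graph = phononGraph C K := by
  refine Submodule.toLinearPMap_graph_eq _ ?_
  rintro _ ⟨Ψ, Φ, h, rfl⟩ h0
  have h1 : Ψ = 0 := toRelL2_injective (h0.trans (map_zero _).symm)
  have h2 : Φ = 0 := Subtype.ext (by rw [h, h1]; exact map_zero _)
  rw [h2]
  exact map_zero _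

namespace IsNormalModes

theorem isFormalAdjoint_phononOperator [NeZero N] (hS : IsNormalModes C K S)
    (hK : IsStableForceMatrix K) : (phononOperator C K).IsFormalAdjoint (phononOperator C K) := by
  have h : ∀ x : (phononOperator C K).domain, ∃ Ψ Φ : vibStates C L,
      Φ.1 = phononHamiltonian C K Ψ.1 ∧ (x : RelL2 C L) = toRelL2 C L Ψ ∧
        phononOperator C K x = toRelL2 C L Φ := by
    intro x
    have hx := (phononOperator C K).mem_graph x
    rw [graph_phononOperator] at hx
    obtain ⟨Ψ, Φ, h, h'⟩ := hx
    exact ⟨Ψ, Φ, h, congrArg Prod.fst h', congrArg Prod.snd h'⟩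
  intro x y
  obtain ⟨Φ, Φ', h1, h2, h3⟩ := h x
  obtain ⟨Ψ, Ψ', h4, h5, h6⟩ := h y
  rw [h2, h3, h5, h6]
  exact hS.inner_phononHamiltonian hK h1 h4

theorem mem_graph_phononOperator [NeZero N] (hS : IsNormalModes C K S)
    (hK : IsStableForceMatrix K) (n : S.Mode → ℕ) {f : RelL2 C L} {c : ℂ}
    (hf : f = c • toRelL2 C L (hS.vibState hK n)) :
    (f, (S.energy n : ℂ) • f) ∈ (phononOperator C K).graph := by
  rw [graph_phononOperator]
  refine ⟨c • hS.vibState hK n, (S.energy n : ℂ) • c • hS.vibState hK n, ?_, ?_⟩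
  · change (S.energy n : ℂ) • c • phononState C S n =
      phononHamiltonian C K (c • phononState C S n)
    rw [map_smul, hS.phononHamiltonian_phononState hK, smul_comm]
  · rw [hf, map_smul, map_smul, map_smul]

end IsNormalModes

end Phonon

end

/-! ### The phonon spectrum and its eigenstates -/

theorem mainTheorem1 (N L : ℕ) [NeZero N] [NeZero L] (C : Phonon.Crystal N)
    (K : Matrix (Phonon.Site N L) (Phonon.Site N L) ℝ) (hK : Phonon.IsStableForceMatrix K) :
    -- the dynamical matrices are Hermitian, non-negative, and `κ̃(-q) = κ̃(q)^*`
    (∀ q : Phonon.Momentum L, (Phonon.dynamicalMatrix C K q).PosSemidef ∧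
      Phonon.dynamicalMatrix C K (-q) = (Phonon.dynamicalMatrix C K q).map conj) ∧
    -- dispersion relations and polarization vectors exist
    (∃ S : Phonon.ModeData N L, Phonon.IsNormalModes C K S) ∧
    -- any such choice determines the spectrum and the eigenstates
    ∀ S : Phonon.ModeData N L, Phonon.IsNormalModes C K S →
      -- unitary diagonalization; the dispersion relations are even
      (∀ q : Phonon.Momentum L, S.polMatrix q ∈ Matrix.unitaryGroup (Phonon.Branch N) ℂ ∧
        Phonon.dynamicalMatrix C K q = S.polMatrix q *
          Matrix.diagonal (fun α => (S.freq q α : ℂ) ^ 2) * (S.polMatrix q).conjTranspose) ∧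
      (∀ q α, S.freq (-q) α = S.freq q α) ∧
      -- precisely three zero modes, all of them at `q = 0`
      (∀ q α, S.freq q α = 0 → q = 0) ∧
      {α | S.freq 0 α = 0}.ncard = 3 ∧
      -- normal coordinates and their derivatives
      (∀ q α k β, ⁅Phonon.dxOp C S q α, Phonon.xOp C S k β⁆ = if q = k ∧ α = β then 1 else 0) ∧
      -- splitting off the centre-of-mass motion
      Phonon.centerOfMassKinetic C = (-(1 / 2) : ℂ) •
        ∑ α : Phonon.Branch N, (if S.freq 0 α = 0 then Phonon.dxOp C S 0 α ^ 2 else 0) ∧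
      Phonon.phononHamiltonian C K = (1 / 2 : ℂ) • ∑ p : S.Mode,
        (-(Phonon.dxOp C S (-p.1.1) p.1.2 * Phonon.dxOp C S p.1.1 p.1.2) +
          ((S.freq p.1.1 p.1.2 : ℂ) ^ 2) •
            (Phonon.xOp C S (-p.1.1) p.1.2 * Phonon.xOp C S p.1.1 p.1.2)) ∧
      -- sum of independent oscillators
      (∀ p p' : S.Mode, ⁅Phonon.annihilation C S p, Phonon.annihilation C S p'⁆ = 0 ∧
        ⁅Phonon.creation C S p, Phonon.creation C S p'⁆ = 0 ∧
        ⁅Phonon.annihilation C S p, Phonon.creation C S p'⁆ = if p = p' then 1 else 0) ∧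
      Phonon.phononHamiltonian C K = ∑ p : S.Mode, (S.freq p.1.1 p.1.2 : ℂ) •
        (Phonon.creation C S p * Phonon.annihilation C S p + (1 / 2 : ℂ) • 1) ∧
      -- creation and annihilation operators act on the vibrational states, mutually adjoint
      (∀ (p : S.Mode), ∀ Ψ ∈ Phonon.vibStates C L,
        Phonon.annihilation C S p Ψ ∈ Phonon.vibStates C L ∧
        Phonon.creation C S p Ψ ∈ Phonon.vibStates C L) ∧
      (∀ (p : S.Mode), ∀ Φ ∈ Phonon.vibStates C L, ∀ Ψ ∈ Phonon.vibStates C L,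
        ∫ w : Phonon.relDispl C L, conj (Φ.1 w) * (Phonon.annihilation C S p Ψ).1 w =
          ∫ w : Phonon.relDispl C L, conj ((Phonon.creation C S p Φ).1 w) * Ψ.1 w) ∧
      -- the ground state is annihilated by all `a_q^α`, and its form in terms of `u`
      (∀ p : S.Mode, Phonon.annihilation C S p (Phonon.groundState C S) = 0) ∧
      (∃ D : Matrix (Phonon.Site N L) (Phonon.Site N L) ℝ, D.PosSemidef ∧
        (∀ s t, (D * D) s t = K s t / Real.sqrt (C.mu s.2 * C.mu t.2)) ∧
        ∀ u, (Phonon.groundState C S).1 u = Complex.exp (-(1 / 2) *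
          ((∑ s, ∑ t, u s * (Real.sqrt (C.mu s.2) * D s t * Real.sqrt (C.mu t.2)) * u t : ℝ) :
            ℂ))) ∧
      -- eigenstates and eigenvalues
      (∀ n : S.Mode → ℕ, Phonon.phononHamiltonian C K (Phonon.phononState C S n) =
        (S.energy n : ℂ) • Phonon.phononState C S n) ∧
      -- the `Ψ_n` are non-zero, pairwise orthogonal and complete
      (∃ h : ∀ n : S.Mode → ℕ, Phonon.phononState C S n ∈ Phonon.vibStates C L,
        (∀ m n : S.Mode → ℕ, m ≠ n →
          inner ℂ (Phonon.toRelL2 C L ⟨Phonon.phononState C S m, h m⟩)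
            (Phonon.toRelL2 C L ⟨Phonon.phononState C S n, h n⟩) = 0) ∧
        (∀ n : S.Mode → ℕ, Phonon.toRelL2 C L ⟨Phonon.phononState C S n, h n⟩ ≠ 0) ∧
        (Submodule.span ℂ (Set.range fun n : S.Mode → ℕ =>
          Phonon.toRelL2 C L ⟨Phonon.phononState C S n, h n⟩)).topologicalClosure = ⊤ ∧
        -- the ground state is unique up to a factor
        ∀ f : (Phonon.phononOperator C K).closure.domain,
          (Phonon.phononOperator C K).closure f = (S.energy 0 : ℂ) • (f : Phonon.RelL2 C L) →
            ∃ c : ℂ, (f : Phonon.RelL2 C L) =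
              c • Phonon.toRelL2 C L ⟨Phonon.phononState C S 0, h 0⟩) ∧
      Phonon.phononState C S 0 = Phonon.groundState C S ∧
      (∀ n : S.Mode → ℕ, n ≠ 0 → S.energy 0 < S.energy n) ∧
      -- the spectrum of the self-adjoint operator `H_ph` consists of the `E_n`
      (∀ Ψ ∈ Phonon.vibStates C L, Phonon.phononHamiltonian C K Ψ ∈ Phonon.vibStates C L) ∧
      (Phonon.phononOperator C K).graph = Phonon.phononGraph C K ∧
      IsSelfAdjoint (Phonon.phononOperator C K).closure ∧
      Phonon.unboundedSpectrum (Phonon.phononOperator C K).closure =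
        Set.range fun n : S.Mode → ℕ => (S.energy n : ℂ) := by
  refine ⟨fun q => ⟨Phonon.dynamicalMatrix_posSemidef hK q, Phonon.dynamicalMatrix_neg q⟩,
    Phonon.exists_isNormalModes C hK, fun S hS => ?_⟩
  obtain ⟨b, hb⟩ := hS.exists_hilbertBasis hK
  have hA := hS.isFormalAdjoint_phononOperator hK
  have hgraph : ∀ n, (b n, (S.energy n : ℂ) • b n) ∈ (Phonon.phononOperator C K).graph := fun n =>
    hS.mem_graph_phononOperator hK n (hb n).choose_spec
  refine ⟨fun q => ⟨hS.polMatrix_mem_unitaryGroup q, hS.dynamicalMatrix_eq q⟩, hS.freq_neg,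
    fun q α => hS.momentum_eq_zero hK, hS.ncard_zero_modes hK, fun q α k β => ?_,
    hS.centerOfMassKinetic_eq hK, hS.phononHamiltonian_eq hK, hS.commutation_relations,
    hS.phononHamiltonian_eq_sum hK,
    fun p Ψ h => ⟨hS.annihilation_mem hK p h, hS.creation_mem hK p h⟩,
    fun p Φ hΦ Ψ hΨ => hS.integral_conj_mul_annihilation hK p hΦ hΨ,
    hS.annihilation_groundState,
    ⟨Phonon.rootMatrix C S, hS.rootMatrix_posSemidef, hS.rootMatrix_mul_self hK,
      hS.groundState_eq_exp⟩,
    hS.phononHamiltonian_phononState hK,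
    ⟨hS.phononState_mem hK, fun m n h => hS.inner_vibState hK h,
      hS.toRelL2_vibState_ne_zero hK, hS.topologicalClosure_span_vibState hK, fun f hf => ?_⟩,
    Phonon.phononState_zero, fun n hn => hS.energy_zero_lt hn,
    fun Ψ hΨ => hS.phononHamiltonian_mem hK hΨ, Phonon.graph_phononOperator C K,
    Phonon.isSelfAdjoint_closure hA hgraph,
    Phonon.unboundedSpectrum_closure hA hgraph
      (Phonon.exists_pos_le_norm_sub hS.finite_energy_le)⟩
  · rw [hS.lie_dxOp_xOp (q, α) (k, β)]
    simp only [Prod.mk.injEq]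
  -- The lowest energy is simple, so an eigenvector of the closure for it has only the component
  -- along `b 0`, itself a multiple of the ground state.
  · have h := Phonon.eq_smul_of_closure_eq hA hgraph
      (fun n hn => (hS.energy_zero_lt hn).ne') f hf
    obtain ⟨c, hc⟩ := hb 0
    refine ⟨inner ℂ (b 0) (f : Phonon.RelL2 C L) * c, ?_⟩
    rw [mul_smul]
    exact h.trans (congrArg _ hc)
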